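/- Let $n\ge 1$. Let $X=\{xz=y^{n+1}\}\subset\mathbb{C}^3$ be the $A_n$ surface singularity, with singular point $x=0$, and let $\sigma:(\tilde X,E)\to (X,x)$ be its minimal resolution, $E=\sigma^{-1}(x)$. Here $\tilde X$ is glued from $n+1$ affine planes $U_0,\dots,U_n$ with coordinates $(u_1,u_2)$, a point $(u_1,u_2)\in U_r$ with $u_2\ne 0$ being identified with $(u_2^{-1},u_1u_2^2)\in U_{r+1}$, and $\sigma(u_1,u_2)=(u_1^{r+1}u_2^{r},\,u_1u_2,\,u_1^{n-r}u_2^{n+1-r})$ on $U_r$. Regard $(\tilde X,E)$ and $(X,x)$ as complex-analytic germs, so that $H^0(\tilde X,S^m\Omega^1_{\tilde X})$ and $H^0(\tilde X\setminus E,S^m\Omega^1_{\tilde X})$ are the spaces of germs of holomorphic symmetric $m$-differentials on $\sigma^{-1}(V)$ and on $\sigma^{-1}(V)\setminus E$ respectively, $V$ running through the open neighbourhoods of $x$ in $X$. For $m\ge 0$ put $$\hslash^0(A_n,m)=\dim_{\mathbb{C}}\left[H^0(\tilde X\setminus E,S^m\Omega^1_{\tilde X})/H^0(\tilde X,S^m\Omega^1_{\tilde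 X})\right].$$ Then the following holds. (a) For every $m\ge 0$ this dimension is finite, and it is the (finite) weighted lattice sum $$\hslash^0(A_n,m)=\sum_{\substack{\mathbf{x}=(x_1,x_2)\in \mathcal{P}_n(m)\cap \mathbb{Z}^2\\ x_1+(n+1)x_2\equiv m \bmod 2}}h_{n,m}(\mathbf{x}),$$ where (i) the polygon $\mathcal{P}_n(m)\subset\mathbb{R}^2$ is symmetric about the $x_1$-axis (that is, under $(x_1,x_2)\mapsto(x_1,-x_2)$), and $\mathcal{P}_n(m)\cap\{x_2\ge 0\}$ is given by the inequalities $-x_1\le 0$, $-x_2\le 0$, $x_1-(n-1)x_2\le m$ and $-x_1+(n+1)x_2\le m+2$; (ii) $h_{n,m}(\mathbf{x})=\min\left\{\sum_{r=0}^{n-1}\alpha_{n,m,r}(\mathbf{x}),\ \beta_{n,m}(\mathbf{x})\right\}$ with $$\alpha_{n,m,r}(\mathbf{x})=\max\left\{0,\frac{m-x_1+(2r-n+1)x_2}{2}\right\},\qquad \beta_{n,m}(\mathbf{x})=\max\left\{0,\,m+1-\alpha_{n,m,-1}(\mathbf{x})-\alpha_{n,m,n}(\mathbf{x})\right\}.$$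 (b) The limit $\hslash^0_\Omega(A_n):=\lim_{m\to\infty}\hslash^0(A_n,m)/m^3$ exists and equals $$\hslash^0_\Omega(A_n)=\frac43\sum_{j=1}^n\frac1{j^2}-\frac{12n^4+65n^3+117n^2+72n}{6(n+1)^2(n+2)^2},$$ and, for fixed $n$ and $m\to\infty$, $\hslash^0(A_n,m)=\hslash^0_\Omega(A_n)m^3+3\hslash^0_\Omega(A_n)m^2+O(m)$. -/

import Mathlib

open Filter Topology

namespace AnSing

/-! ### The `A_n` singularity and its minimal resolution -/

/-- The surface `X = {x z = y ^ (n + 1)} ⊆ ℂ³`. -/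
def Surface (n : ℕ) : Set (ℂ × ℂ × ℂ) :=
  {p | p.1 * p.2.2 = p.2.1 ^ (n + 1)}

/-- The singular point `x = 0` of `X` (singular for `n ≥ 1`). -/
def origin (n : ℕ) : Surface n :=
  ⟨(0, 0, 0), by simp [Surface]⟩

/-- The disjoint union of `n + 1` affine planes `U_0, …, U_n`, each with its two
coordinates `(u₁, u₂)`. -/
abbrev Charts (n : ℕ) : Type := Fin (n + 1) × (ℂ × ℂ)

/-- The change of coordinates from `U_r` to `U_{r+1}`, on `{u₂ ≠ 0} ⊆ U_r`. -/
noncomputable def transition (u : ℂ × ℂ) : ℂ × ℂ :=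
  (u.2⁻¹, u.1 * u.2 ^ 2)

/-- The gluing of `{u₂ ≠ 0} ⊆ U_r` with `{u₁ ≠ 0} ⊆ U_{r+1}`. -/
def Glue (n : ℕ) (p q : Charts n) : Prop :=
  ∃ (r : Fin n) (u : ℂ × ℂ), u.2 ≠ 0 ∧ p = (r.castSucc, u) ∧ q = (r.succ, transition u)

/-- The minimal resolution `X̃` of `X`: the complex surface obtained by gluing the planes
`U_0, …, U_n`.  The axis `{u₁ = 0}` of `U_{r-1}` and the axis `{u₂ = 0}` of `U_r` are glued to a
smooth rational curve `E_r` (`1 ≤ r ≤ n`) of self-intersection `-2`, as `transition` shows.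
The topology is the quotient topology. -/
def Resolution (n : ℕ) : Type := Quot (Glue n)

instance (n : ℕ) : TopologicalSpace (Resolution n) :=
  inferInstanceAs (TopologicalSpace (Quot (Glue n)))

/-- The quotient map; its restriction to `{r} × ℂ²` is the chart `ℂ² ≅ U_r ⊆ X̃`. -/
def toRes (n : ℕ) (p : Charts n) : Resolution n := Quot.mk (Glue n) p

/-- The map `X̃ → X` in the coordinates of `U_r`. In terms of the quotient map
`ℂ² → X`, `(z₁, z₂) ↦ (z₁^(n+1), z₁ z₂, z₂^(n+1))`, one has
`u₁ = z₁^(n+1-r) z₂^(-r)` and `u₂ = z₁^(r-n) z₂^(r+1)`. -/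
noncomputable def resolveChart (n : ℕ) (p : Charts n) : Surface n :=
  ⟨(p.2.1 ^ ((p.1 : ℕ) + 1) * p.2.2 ^ (p.1 : ℕ), p.2.1 * p.2.2,
      p.2.1 ^ (n - (p.1 : ℕ)) * p.2.2 ^ (n + 1 - (p.1 : ℕ))), by
    obtain ⟨⟨r, hr⟩, a, b⟩ := p
    obtain ⟨k, rfl⟩ := Nat.exists_eq_add_of_le (Nat.lt_succ_iff.mp hr)
    have h1 : r + k - r = k := by omega
    have h2 : r + k + 1 - r = k + 1 := by omega
    simp only [Surface, Set.mem_ofPred_eq, h1, h2]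
    ring⟩

theorem resolveChart_glue (n : ℕ) (p q : Charts n) (h : Glue n p q) :
    resolveChart n p = resolveChart n q := by
  obtain ⟨⟨r, hr⟩, ⟨a, b⟩, hb, rfl, rfl⟩ := h
  obtain ⟨k, rfl⟩ := Nat.exists_eq_add_of_lt hr
  have hb' : b ≠ 0 := hb
  have h1 : r + k + 1 - r = k + 1 := by omega
  have h2 : r + k + 1 + 1 - r = k + 2 := by omega
  have h3 : r + k + 1 - (r + 1) = k := by omega
  have h4 : r + k + 1 + 1 - (r + 1) = k + 1 := by omega
  apply Subtype.ext
  simp only [resolveChart, transition, Fin.castSucc_mk, Fin.succ_mk, h1, h2, h3, h4,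
    Prod.mk.injEq]
  have e : b⁻¹ * (a * b ^ 2) = a * b := by field_simp
  refine ⟨?_, e.symm, ?_⟩
  · calc a ^ (r + 1) * b ^ r = (b⁻¹ * b) * (a ^ (r + 1) * b ^ r) := by
          rw [inv_mul_cancel₀ hb', one_mul]
      _ = b⁻¹ * (a * b) ^ (r + 1) := by ring
      _ = b⁻¹ * (b⁻¹ * (a * b ^ 2)) ^ (r + 1) := by rw [e]
      _ = b⁻¹ ^ (r + 1 + 1) * (a * b ^ 2) ^ (r + 1) := by ring
  · calc a ^ (k + 1) * b ^ (k + 2) = (a * b) ^ k * (a * b ^ 2) := by ring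
      _ = (b⁻¹ * (a * b ^ 2)) ^ k * (a * b ^ 2) := by rw [e]
      _ = b⁻¹ ^ k * (a * b ^ 2) ^ (k + 1) := by ring

/-- The resolution map `σ : X̃ → X`. -/
noncomputable def resolve (n : ℕ) : Resolution n → Surface n :=
  Quot.lift (resolveChart n) (resolveChart_glue n)

theorem continuous_resolve (n : ℕ) : Continuous (resolve n) :=
  continuous_quot_lift _ (continuous_prod_of_discrete_left.2 fun r =>
    Continuous.subtype_mk (by dsimp only; fun_prop) _)

/-- The exceptional locus `E = σ⁻¹(x)`. -/
def exceptional (n : ℕ) : Set (Resolution n) := resolve n ⁻¹' {origin n}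

/-! ### Symmetric differentials -/

/-- The value at the tangent vector `v` of the symmetric form
`∑ q, c q * (du₁)^(m-q) * (du₂)^q`. -/
def evalForm {m : ℕ} (c : Fin (m + 1) → ℂ) (v : ℂ × ℂ) : ℂ :=
  ∑ q : Fin (m + 1), c q * v.1 ^ (m - (q : ℕ)) * v.2 ^ (q : ℕ)

/-- `ω` is a holomorphic section of `S^m Ω¹` over `W ⊆ X̃`. It is given by its expressions
`∑ q, ω (r, u) q * (du₁)^(m-q) * (du₂)^q` in the charts `U_r`: the coefficients are holomorphic
on the part of the chart in `W`, and on overlaps the expression in `U_r` is the pullback of the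
expression in `U_{r+1}`. The values of `ω` outside `W` are irrelevant. -/
structure IsSymDiff (n m : ℕ) (W : Set (Resolution n))
    (ω : Charts n → Fin (m + 1) → ℂ) : Prop where
  holo : ∀ (r : Fin (n + 1)) (q : Fin (m + 1)),
    DifferentiableOn ℂ (fun u : ℂ × ℂ => ω (r, u) q) {u | toRes n (r, u) ∈ W}
  compat : ∀ (r : Fin n) (u : ℂ × ℂ), u.2 ≠ 0 → toRes n (r.castSucc, u) ∈ W →
    ∀ v : ℂ × ℂ, evalForm (ω (r.castSucc, u)) v =
      evalForm (ω (r.succ, transition u)) (fderiv ℂ transition u v)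

theorem evalForm_add {m : ℕ} (c d : Fin (m + 1) → ℂ) (v : ℂ × ℂ) :
    evalForm (c + d) v = evalForm c v + evalForm d v := by
  simp only [evalForm, Pi.add_apply, add_mul, Finset.sum_add_distrib]

theorem evalForm_smul {m : ℕ} (a : ℂ) (c : Fin (m + 1) → ℂ) (v : ℂ × ℂ) :
    evalForm (a • c) v = a * evalForm c v := by
  simp only [evalForm, Pi.smul_apply, smul_eq_mul, mul_assoc, Finset.mul_sum]

theorem IsSymDiff.mono {n m : ℕ} {W W' : Set (Resolution n)}
    {ω : Charts n → Fin (m + 1) → ℂ} (h : IsSymDiff n m W ω) (hW : W' ⊆ W) :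
    IsSymDiff n m W' ω :=
  ⟨fun r q => (h.holo r q).mono fun _ hu => hW hu,
    fun r u hu hm => h.compat r u hu (hW hm)⟩

theorem IsSymDiff.zero (n m : ℕ) (W : Set (Resolution n)) : IsSymDiff n m W 0 :=
  ⟨fun _ _ => differentiableOn_const 0, fun _ _ _ _ _ => by simp [evalForm]⟩

theorem IsSymDiff.add {n m : ℕ} {W : Set (Resolution n)}
    {ω η : Charts n → Fin (m + 1) → ℂ} (h : IsSymDiff n m W ω) (k : IsSymDiff n m W η) :
    IsSymDiff n m W (ω + η) :=
  ⟨fun r q => (h.holo r q).add (k.holo r q), fun r u hu hm v => by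
    simp only [Pi.add_apply, evalForm_add, h.compat r u hu hm v, k.compat r u hu hm v]⟩

theorem IsSymDiff.smul {n m : ℕ} {W : Set (Resolution n)}
    {ω : Charts n → Fin (m + 1) → ℂ} (a : ℂ) (h : IsSymDiff n m W ω) :
    IsSymDiff n m W (a • ω) :=
  ⟨fun r q => (h.holo r q).const_smul a, fun r u hu hm v => by
    simp only [Pi.smul_apply, evalForm_smul, h.compat r u hu hm v]⟩

/-! ### Germs along the exceptional locus -/

/-- The filter of punctured neighbourhoods of `E`, generated by the sets `σ⁻¹(V) \ E` with `V` a
neighbourhood of `x` in `X`, read on the charts. -/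
noncomputable def puncturedNhds (n : ℕ) : Filter (Charts n) :=
  comap (fun p => resolve n (toRes n p)) (𝓝[≠] origin n)

/-- Germs along `E` of (arbitrary) sections off `E`. -/
abbrev SectionGerm (n m : ℕ) : Type := Germ (puncturedNhds n) (Fin (m + 1) → ℂ)

/-- The germs of the holomorphic sections of `S^m Ω¹` over `σ⁻¹(V) \ S`, where `V` runs through
the open neighbourhoods of `x` in `X`. -/
noncomputable def germsOff (n m : ℕ) (S : Set (Resolution n)) : Submodule ℂ (SectionGerm n m) where
  carrier := {g | ∃ V : Set (Surface n), IsOpen V ∧ origin n ∈ V ∧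
    ∃ ω : Charts n → Fin (m + 1) → ℂ,
      IsSymDiff n m (resolve n ⁻¹' V \ S) ω ∧ g = (ω : SectionGerm n m)}
  zero_mem' := ⟨Set.univ, isOpen_univ, trivial, 0, IsSymDiff.zero n m _, rfl⟩
  add_mem' := by
    rintro _ _ ⟨V, hV, hxV, ω, hω, rfl⟩ ⟨V', hV', hxV', η, hη, rfl⟩
    exact ⟨V ∩ V', hV.inter hV', ⟨hxV, hxV'⟩, ω + η,
      (hω.mono fun _ hp => ⟨hp.1.1, hp.2⟩).add (hη.mono fun _ hp => ⟨hp.1.2, hp.2⟩), rfl⟩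
  smul_mem' := by
    rintro a _ ⟨V, hV, hxV, ω, hω, rfl⟩
    exact ⟨V, hV, hxV, a • ω, hω.smul a, rfl⟩

/-- `H⁰(X̃ \ E, S^m Ω¹)` for the germ `(X̃, E)`. -/
noncomputable def formsOffE (n m : ℕ) : Submodule ℂ (SectionGerm n m) := germsOff n m (exceptional n)

/-- `H⁰(X̃, S^m Ω¹)` for the germ `(X̃, E)`, embedded by restriction to `X̃ \ E`. -/
noncomputable def formsOnRes (n m : ℕ) : Submodule ℂ (SectionGerm n m) := germsOff n m ∅

/-- The quotient `H⁰(X̃ \ E, S^m Ω¹) / H⁰(X̃, S^m Ω¹)`. -/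
abbrev Obstruction (n m : ℕ) : Type :=
  formsOffE n m ⧸ (formsOnRes n m).submoduleOf (formsOffE n m)

/-- The invariant `ℏ⁰(A_n, m)`. -/
noncomputable def hbar (n m : ℕ) : ℕ := Module.finrank ℂ (Obstruction n m)

/-! ### The polygon, the weight and the leading coefficient -/

/-- The part `x₂ ≥ 0` of the polygon. -/
def halfPolygon (n m : ℕ) : Set (ℝ × ℝ) :=
  {x | -x.1 ≤ 0 ∧ -x.2 ≤ 0 ∧ x.1 - ((n : ℝ) - 1) * x.2 ≤ m ∧
    -x.1 + ((n : ℝ) + 1) * x.2 ≤ m + 2}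

/-- The polygon `P_n(m)`: the half polygon and its mirror image under `(x₁, x₂) ↦ (x₁, -x₂)`. -/
def polygon (n m : ℕ) : Set (ℝ × ℝ) :=
  {x | x ∈ halfPolygon n m ∨ (x.1, -x.2) ∈ halfPolygon n m}

/-- The lattice points of `P_n(m)` with `x₁ + (n + 1) x₂ ≡ m` modulo `2`. -/
def latticePoints (n m : ℕ) : Set (ℤ × ℤ) :=
  {x | ((x.1 : ℝ), (x.2 : ℝ)) ∈ polygon n m ∧ x.1 + ((n : ℤ) + 1) * x.2 ≡ (m : ℤ) [ZMOD 2]}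

noncomputable def alpha (n m : ℕ) (r : ℤ) (x : ℝ × ℝ) : ℝ :=
  max 0 (((m : ℝ) - x.1 + (2 * (r : ℝ) - n + 1) * x.2) / 2)

noncomputable def beta (n m : ℕ) (x : ℝ × ℝ) : ℝ :=
  max 0 ((m : ℝ) + 1 - alpha n m (-1) x - alpha n m n x)

/-- The weight function `h_{n,m} = min (∑ α, β)`. -/
noncomputable def weight (n m : ℕ) (x : ℝ × ℝ) : ℝ :=
  min (∑ r ∈ Finset.range n, alpha n m (r : ℤ) x) (beta n m x)

/-- The closed formula for `ℏ⁰_Ω(A_n)`. -/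
noncomputable def hbarOmega (n : ℕ) : ℝ :=
  4 / 3 * ∑ j ∈ Finset.Icc 1 n, 1 / (j : ℝ) ^ 2 -
    (12 * (n : ℝ) ^ 4 + 65 * (n : ℝ) ^ 3 + 117 * (n : ℝ) ^ 2 + 72 * (n : ℝ)) /
      (6 * ((n : ℝ) + 1) ^ 2 * ((n : ℝ) + 2) ^ 2)

end AnSing

/-! ### Holomorphic functions of two variables -/

namespace AnSing

/-! The resolution is toric, and the quotient splits according to the characters of the torus. A
form of weight w = (g, d) is a monomial times a degree m form in du₁/u₁, du₂/u₂ with constant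
coefficients. On logarithmic tangent coordinates the transition acts by (t₁, t₂) ↦ (-t₂, t₁ + 2t₂),
which fixes t₁ + t₂ and lowers t₁/(t₁ + t₂) by 1. Hence the constant form amounts to one polynomial
f of degree at most m, common to all charts. Holomorphy along the r-th divisor (E_r for 1 ≤ r ≤ n, a
noncompact axis for r = 0 and r = n + 1) means that f vanishes at r to order max(0, rd - g), which
is `mult w r`. Off E only the conditions at 0 and n + 1 remain; on the resolution all of 0, …, n + 1
count. Both dimensions are truncated differences (`finrank_admissible`), and they differ by the
weight h at the lattice point (m + 2g - (n + 1)d, d) (`weight_latticePoint`).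

Two analytic facts reduce the quotient to these components. Every form off E is a finite sum of
monomial forms modulo forms that extend (`exists_sub_mem_formsOnRes`): its pull-back to ℂ² extends
over 0 by Hartogs, the Taylor polynomial averaged over the cyclic group is a sum of monomial forms,
and a remainder of high enough order has bounded coefficients near E away from the crossings, so it
extends. Conversely, a sum of monomial forms of distinct weights extends only if each of them does
(`mem_admissible_of_sum_mem_formsOnRes`). Together they give `finrank_obstruction`.

For the asymptotics, a symmetry reduces to d ≥ 0, and the rays g = kd cut the weights with d > 0
into unimodular cones on which every `mult w r` is linear. So the dimension is a combination of sums
of truncated linear functions (`hbar_eq_coneSums`), each known up to O(m) by `raySum_isBigO` and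
`coneSum_isBigO`. In terms of m + 1 the quadratic terms cancel, and what is left is `hbarOmega n`
times (m + 1)³, up to O(m). Expanding the cube produces the coefficient 3. -/

/-- Cauchy's estimate for the derivative of a bounded holomorphic function on a ball. -/
theorem lipschitzOnWith_of_bounded {E : Type*} [NormedAddCommGroup E] [NormedSpace ℂ E]
    {f : E → ℂ} {x₀ : E} {δ M : ℝ} (hδ : 0 < δ)
    (hf : ∀ x ∈ Metric.ball x₀ (2 * δ), DifferentiableAt ℂ f x)
    (hM : ∀ x ∈ Metric.ball x₀ (2 * δ), ‖f x‖ ≤ M) :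
    LipschitzOnWith (Real.nnabs (M / δ)) f (Metric.ball x₀ δ) := by
  have hM0 : 0 ≤ M := (norm_nonneg _).trans (hM x₀ (Metric.mem_ball_self (by positivity)))
  refine Convex.lipschitzOnWith_of_nnnorm_fderiv_le (𝕜 := ℂ)
    (fun x hx => hf x (Metric.ball_subset_ball (by linarith) hx)) (fun x hx => ?_)
    (convex_ball _ _)
  rw [← NNReal.coe_le_coe]
  simp only [coe_nnnorm, Real.coe_nnabs]
  refine ContinuousLinearMap.opNorm_le_bound _ (abs_nonneg _) fun v => ?_
  rw [abs_of_nonneg (by positivity)]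
  rcases eq_or_ne v 0 with rfl | hv
  · simp
  have hv' : 0 < ‖v‖ := norm_pos_iff.2 hv
  have hin : ∀ τ : ℂ, ‖τ‖ ≤ δ / ‖v‖ → x + τ • v ∈ Metric.ball x₀ (2 * δ) := by
    intro τ hτ
    rw [le_div_iff₀ hv', ← norm_smul] at hτ
    rw [mem_ball_iff_norm] at hx ⊢
    calc ‖x + τ • v - x₀‖ = ‖(x - x₀) + τ • v‖ := by congr 1; abel
      _ ≤ ‖x - x₀‖ + ‖τ • v‖ := norm_add_le _ _
      _ < 2 * δ := by linarith
  have hline : ∀ τ : ℂ, HasDerivAt (fun τ : ℂ => x + τ • v) v τ := fun τ => by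
    simpa using ((hasDerivAt_id τ).smul_const v).const_add x
  have hd : ∀ τ : ℂ, ‖τ‖ ≤ δ / ‖v‖ → DifferentiableAt ℂ (fun τ : ℂ => f (x + τ • v)) τ :=
    fun τ hτ => (hf _ (hin τ hτ)).comp τ (hline τ).differentiableAt
  have hder : deriv (fun τ : ℂ => f (x + τ • v)) 0 = fderiv ℂ f x v := by
    have h0 := (hf _ (hin 0 (by simpa using by positivity))).hasFDerivAt.comp_hasDerivAt (0 : ℂ)
      (hline 0)
    simpa [Function.comp_def] using h0.deriv
  have := Complex.norm_deriv_le_of_forall_mem_sphere_norm_le (c := 0)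
    (f := fun τ : ℂ => f (x + τ • v)) (C := M) (R := δ / ‖v‖) (by positivity) ?_ ?_
  · rw [hder] at this
    calc _ ≤ _ := this
      _ = _ := by field_simp
  · refine DifferentiableOn.diffContOnCl fun τ hτ => (hd τ ?_).differentiableWithinAt
    rw [closure_ball _ (by positivity)] at hτ
    simpa using hτ
  · intro τ hτ
    exact hM _ (hin τ (by simpa using (mem_sphere_iff_norm.1 hτ).le))

/-- The Cauchy integral in the first variable, over a circle on which the function is
holomorphic, is holomorphic in both variables. -/
theorem differentiableAt_cauchyIntegral {g : ℂ × ℂ → ℂ} {R ε : ℝ} {w₀ : ℂ}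
    (hg : ∀ s w : ℂ, ‖s‖ = R → w ∈ Metric.ball w₀ ε → DifferentiableAt ℂ g (s, w))
    {p : ℂ × ℂ} (hp₁ : ‖p.1‖ < R) (hp₂ : p.2 ∈ Metric.ball w₀ ε) :
    DifferentiableAt ℂ (fun u : ℂ × ℂ => ∮ s in C(0, R), (s - u.1)⁻¹ * g (s, u.2)) p := by
  obtain ⟨p₁, p₂⟩ := p
  simp only at hp₁ hp₂
  have hR : 0 < R := (norm_nonneg _).trans_lt hp₁
  obtain ⟨η, hη, hηs⟩ := Metric.mem_nhds_iff.1 (Metric.isOpen_ball.mem_nhds hp₂)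
  obtain ⟨δ, hδ, hδ₁, hδ₂⟩ : ∃ δ > 0, ‖p₁‖ + 3 * δ < R ∧ 3 * δ < η :=
    ⟨min (R - ‖p₁‖) η / 4, by
      have := lt_min (sub_pos.2 hp₁) hη
      positivity, by
      have := min_le_left (R - ‖p₁‖) η
      have := lt_min (sub_pos.2 hp₁) hη
      linarith, by
      have := min_le_right (R - ‖p₁‖) η
      have := lt_min (sub_pos.2 hp₁) hη
      linarith⟩
  have hgc : ContinuousOn g (Metric.sphere 0 R ×ˢ Metric.closedBall p₂ (2 * δ)) := by
    rintro ⟨s, w⟩ ⟨hs, hw⟩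
    refine (hg s w (by simpa using hs) (hηs ?_)).continuousAt.continuousWithinAt
    exact Metric.closedBall_subset_ball (by linarith) hw
  obtain ⟨K, hK⟩ := ((isCompact_sphere 0 R).prod
    (isCompact_closedBall p₂ (2 * δ))).exists_bound_of_continuousOn hgc
  have hcir : ∀ t : ℝ, ‖circleMap 0 R t‖ = R := fun t => by simp [abs_of_pos hR]
  have hne : ∀ t : ℝ, ∀ x ∈ Metric.ball (p₁, p₂) (2 * δ), δ ≤ ‖circleMap 0 R t - x.1‖ := by
    intro t x hx
    have h1 : ‖x.1 - p₁‖ < 2 * δ := by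
      rw [← Prod.mk.eta (p := x), ← ball_prod_same] at hx
      exact mem_ball_iff_norm.1 hx.1
    have h2 : ‖x.1‖ ≤ ‖x.1 - p₁‖ + ‖p₁‖ := by simpa using norm_add_le (x.1 - p₁) p₁
    have h3 := norm_sub_norm_le (circleMap 0 R t) x.1
    rw [hcir] at h3
    linarith
  have hx2 : ∀ x ∈ Metric.ball (p₁, p₂) (2 * δ), x.2 ∈ Metric.ball p₂ (2 * δ) := by
    intro x hx
    rw [← Prod.mk.eta (p := x), ← ball_prod_same] at hx
    exact hx.2
  have hgd : ∀ t : ℝ, ∀ x ∈ Metric.ball (p₁, p₂) (2 * δ),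
      DifferentiableAt ℂ g (circleMap 0 R t, x.2) := fun t x hx =>
    hg _ _ (hcir t) (hηs (Metric.ball_subset_ball (by linarith) (hx2 x hx)))
  set F : ℂ × ℂ → ℝ → ℂ := fun u t =>
    deriv (circleMap 0 R) t * ((circleMap 0 R t - u.1)⁻¹ * g (circleMap 0 R t, u.2)) with hF
  have hFd : ∀ t : ℝ, ∀ x ∈ Metric.ball (p₁, p₂) (2 * δ),
      DifferentiableAt ℂ (fun x => F x t) x := by
    intro t x hx
    have h0 : circleMap 0 R t - x.1 ≠ 0 := norm_pos_iff.1 (hδ.trans_le (hne t x hx))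
    have h1 : DifferentiableAt ℂ (fun u : ℂ × ℂ => (circleMap 0 R t - u.1)⁻¹) x :=
      (differentiableAt_fst.const_sub _).inv h0
    have h2 : DifferentiableAt ℂ (fun u : ℂ × ℂ => g (circleMap 0 R t, u.2)) x :=
      (hgd t x hx).comp (f := fun u : ℂ × ℂ => (circleMap 0 R t, u.2)) x
        ((differentiableAt_const _).prodMk differentiableAt_snd)
    exact (h1.mul h2).const_mul _
  have hFM : ∀ t : ℝ, ∀ x ∈ Metric.ball (p₁, p₂) (2 * δ), ‖F x t‖ ≤ R * (δ⁻¹ * K) := by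
    intro t x hx
    simp only [hF, norm_mul, norm_inv, deriv_circleMap, Complex.norm_I, mul_one, hcir]
    have h1 := hK (circleMap 0 R t, x.2)
      ⟨by simpa using hcir t, Metric.ball_subset_closedBall (hx2 x hx)⟩
    have h2 := hne t x hx
    gcongr
  have hFc : ∀ x ∈ Metric.ball (p₁, p₂) (2 * δ), Continuous (F x) := by
    intro x hx
    have h1 : Continuous fun t => g (circleMap 0 R t, x.2) := by
      rw [continuous_iff_continuousAt]
      intro t
      exact (hgd t x hx).continuousAt.comp (f := fun t => (circleMap 0 R t, x.2))
        ((continuous_circleMap 0 R).prodMk continuous_const).continuousAt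
    have h2 : Continuous fun t => (circleMap 0 R t - x.1)⁻¹ :=
      ((continuous_circleMap 0 R).sub continuous_const).inv₀ fun t =>
        norm_pos_iff.1 (hδ.trans_le (hne t x hx))
    have h3 : Continuous fun t => deriv (circleMap 0 R) t := by
      simp only [deriv_circleMap]
      exact (continuous_circleMap 0 R).mul continuous_const
    exact h3.mul (h2.mul h1)
  have hself : (p₁, p₂) ∈ Metric.ball (p₁, p₂) (2 * δ) := Metric.mem_ball_self (by positivity)
  set F' : ℝ → ℂ × ℂ →L[ℂ] ℂ := fun t => deriv (circleMap 0 R) t •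
    ((circleMap 0 R t - p₁)⁻¹ • (fderiv ℂ g (circleMap 0 R t, p₂)).comp
        ((0 : ℂ × ℂ →L[ℂ] ℂ).prod (ContinuousLinearMap.snd ℂ ℂ ℂ)) +
      g (circleMap 0 R t, p₂) • (((circleMap 0 R t - p₁) ^ 2)⁻¹ • ContinuousLinearMap.fst ℂ ℂ ℂ))
    with hF'
  have hF'd : ∀ t, HasFDerivAt (fun x => F x t) (F' t) (p₁, p₂) := by
    intro t
    have h0 : circleMap 0 R t - p₁ ≠ 0 := norm_pos_iff.1 (hδ.trans_le (hne t _ hself))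
    have h1 : HasFDerivAt (fun u : ℂ × ℂ => (circleMap 0 R t - u.1)⁻¹)
        (((circleMap 0 R t - p₁) ^ 2)⁻¹ • ContinuousLinearMap.fst ℂ ℂ ℂ) (p₁, p₂) := by
      have := (hasDerivAt_inv h0).comp_hasFDerivAt (f := fun u : ℂ × ℂ => circleMap 0 R t - u.1)
        (p₁, p₂) ((hasFDerivAt_fst (𝕜 := ℂ) (p := (p₁, p₂))).const_sub (circleMap 0 R t))
      simpa [Function.comp_def] using this
    have h2 : HasFDerivAt (fun u : ℂ × ℂ => g (circleMap 0 R t, u.2))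
        ((fderiv ℂ g (circleMap 0 R t, p₂)).comp
          ((0 : ℂ × ℂ →L[ℂ] ℂ).prod (ContinuousLinearMap.snd ℂ ℂ ℂ))) (p₁, p₂) :=
      HasFDerivAt.comp (f := fun u : ℂ × ℂ => (circleMap 0 R t, u.2)) (p₁, p₂)
        (hgd t _ hself).hasFDerivAt ((hasFDerivAt_const _ _).prodMk hasFDerivAt_snd)
    exact (h1.mul h2).const_mul _
  have hF'm : Measurable F' := by
    have hc : Measurable (circleMap 0 R) := (continuous_circleMap 0 R).measurable
    have h1 : Measurable fun t => fderiv ℂ g (circleMap 0 R t, p₂) :=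
      (measurable_fderiv ℂ g).comp (hc.prodMk measurable_const)
    have h2 : Measurable fun t => g (circleMap 0 R t, p₂) := by
      refine Continuous.measurable ?_
      rw [continuous_iff_continuousAt]
      intro t
      exact (hgd t _ hself).continuousAt.comp (f := fun t => (circleMap 0 R t, p₂))
        ((continuous_circleMap 0 R).prodMk continuous_const).continuousAt
    have h3 : Measurable fun t => deriv (circleMap 0 R) t := by
      simp only [deriv_circleMap]
      exact hc.mul measurable_const
    have h4 : Measurable fun t => (fderiv ℂ g (circleMap 0 R t, p₂)).comp
        ((0 : ℂ × ℂ →L[ℂ] ℂ).prod (ContinuousLinearMap.snd ℂ ℂ ℂ)) :=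
      ((ContinuousLinearMap.compL ℂ (ℂ × ℂ) (ℂ × ℂ) ℂ).flip
        ((0 : ℂ × ℂ →L[ℂ] ℂ).prod (ContinuousLinearMap.snd ℂ ℂ ℂ))).continuous.measurable.comp h1
    exact h3.smul (((hc.sub measurable_const).inv.smul h4).add
      (h2.smul ((((hc.sub measurable_const).pow_const 2).inv).smul_const _)))
  -- Differentiation under the integral sign. The dominating constant is the Lipschitz constant from
  -- Cauchy's estimate, so the derivative of `g` only needs to be measurable along the circle.
  have key := intervalIntegral.hasFDerivAt_integral_of_dominated_loc_of_lip (𝕜 := ℂ)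
    (μ := MeasureTheory.volume) (a := 0) (b := 2 * Real.pi) (F := F) (F' := F') (x₀ := (p₁, p₂))
    (s := Metric.ball (p₁, p₂) δ) (bound := fun _ => R * (δ⁻¹ * K) / δ)
    (Metric.ball_mem_nhds _ hδ) ?_ ?_ hF'm.aestronglyMeasurable ?_ ?_ ?_
  · simpa only [circleIntegral, smul_eq_mul] using key.2.differentiableAt
  · filter_upwards [Metric.ball_mem_nhds (p₁, p₂) (show 0 < 2 * δ by positivity)] with x hx
    exact (hFc x hx).aestronglyMeasurable
  · exact (hFc _ hself).intervalIntegrable _ _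
  · refine Eventually.of_forall fun t _ => ?_
    exact lipschitzOnWith_of_bounded hδ (hFd t) (hFM t)
  · simp
  · exact Eventually.of_forall fun t _ => hF'd t

end AnSing

/-! ### Removable singularities along the axes and at the origin -/

namespace AnSing

/-- The complement of the two coordinate axes in the plane. -/
def torus : Set (ℂ × ℂ) := {u | u.1 ≠ 0 ∧ u.2 ≠ 0}

theorem isOpen_torus : IsOpen torus :=
  (isOpen_ne_fun continuous_fst continuous_const).inter
    (isOpen_ne_fun continuous_snd continuous_const)

theorem dense_torus : Dense torus := by
  have := (dense_compl_singleton (0 : ℂ)).prod (dense_compl_singleton (0 : ℂ))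
  exact this

instance nhdsWithin_torus_neBot (p : ℂ × ℂ) : (𝓝[torus] p).NeBot :=
  mem_closure_iff_nhdsWithin_neBot.1 (dense_torus p)

/-- Identities proved where both coordinates are nonzero pass to points on the axes by density and
continuity; this is used throughout. -/
theorem eq_of_eventually_eq_torus {E : Type*} [TopologicalSpace E] [T2Space E]
    {f g : ℂ × ℂ → E} {p : ℂ × ℂ} (hf : ContinuousAt f p)
    (hg : ContinuousAt g p) (h : ∀ᶠ u in 𝓝 p, u ∈ torus → f u = g u) : f p = g p := by
  have h1 : Tendsto f (𝓝[torus] p) (𝓝 (f p)) := hf.tendsto.mono_left nhdsWithin_le_nhds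
  have h2 : Tendsto g (𝓝[torus] p) (𝓝 (g p)) := hg.tendsto.mono_left nhdsWithin_le_nhds
  exact tendsto_nhds_unique (h1.congr' (eventually_nhdsWithin_iff.2 h)) h2

theorem eventually_prod_ball {p : ℂ × ℂ} {P : ℂ × ℂ → Prop} (h : ∀ᶠ u in 𝓝 p, P u) :
    ∃ ε > 0, ∀ a b : ℂ, ‖a - p.1‖ < ε → ‖b - p.2‖ < ε → P (a, b) := by
  obtain ⟨ε, hε, hb⟩ := Metric.eventually_nhds_iff_ball.1 h
  refine ⟨ε, hε, fun a b ha hb' => hb _ ?_⟩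
  rw [← Prod.mk.eta (p := p), ← ball_prod_same]
  exact ⟨mem_ball_iff_norm.2 ha, mem_ball_iff_norm.2 hb'⟩

theorem eventually_of_prod_ball {p : ℂ × ℂ} {P : ℂ × ℂ → Prop} {ε : ℝ} (hε : 0 < ε)
    (h : ∀ a b : ℂ, ‖a - p.1‖ < ε → ‖b - p.2‖ < ε → P (a, b)) : ∀ᶠ u in 𝓝 p, P u := by
  refine Metric.eventually_nhds_iff_ball.2 ⟨ε, hε, ?_⟩
  rintro ⟨a, b⟩ hu
  rw [← Prod.mk.eta (p := p), ← ball_prod_same] at hu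
  exact h a b (mem_ball_iff_norm.1 hu.1) (mem_ball_iff_norm.1 hu.2)

theorem cauchyFormula {f : ℂ → ℂ} {R : ℝ} {w : ℂ}
    (hf : ∀ s : ℂ, ‖s‖ ≤ R → DifferentiableAt ℂ f s) (hw : ‖w‖ < R) :
    (∮ s in C(0, R), (s - w)⁻¹ * f s) = 2 * Real.pi * Complex.I * f w := by
  have hR : 0 < R := (norm_nonneg _).trans_lt hw
  have h1 : DiffContOnCl ℂ f (Metric.ball 0 R) := by
    refine DifferentiableOn.diffContOnCl fun s hs => (hf s ?_).differentiableWithinAt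
    rw [closure_ball _ hR.ne'] at hs
    simpa using hs
  simpa [smul_eq_mul] using h1.circleIntegral_sub_inv_smul (w := w) (by simpa using hw)

/-- A bounded holomorphic function extends holomorphically across `{u₁ = 0}`. -/
theorem exists_extension_axis {g : ℂ × ℂ → ℂ} {p₂ : ℂ} (hp : p₂ ≠ 0) {K : ℝ}
    (hd : ∀ᶠ u in 𝓝 ((0 : ℂ), p₂), u ∈ torus → DifferentiableAt ℂ g u)
    (hK : ∀ᶠ u in 𝓝 ((0 : ℂ), p₂), u ∈ torus → ‖g u‖ ≤ K) :
    ∃ h : ℂ × ℂ → ℂ, ∀ᶠ u in 𝓝 ((0 : ℂ), p₂), DifferentiableAt ℂ h u ∧ (u ∈ torus → h u = g u) := by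
  have hne : ∀ᶠ u : ℂ × ℂ in 𝓝 ((0 : ℂ), p₂), u.2 ≠ 0 :=
    continuousAt_snd.eventually_ne hp
  obtain ⟨ε, hε, H⟩ := eventually_prod_ball (hd.and (hK.and hne))
  simp only [sub_zero] at H
  set R := ε / 2 with hR
  have hR0 : 0 < R := by positivity
  refine ⟨fun u => (2 * Real.pi * Complex.I)⁻¹ * ∮ s in C(0, R), (s - u.1)⁻¹ * g (s, u.2),
    eventually_of_prod_ball hR0 fun a b ha hb => ?_⟩
  simp only [sub_zero] at ha hb
  have hb' : ‖b - p₂‖ < ε := by linarith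
  constructor
  · refine DifferentiableAt.const_mul (differentiableAt_cauchyIntegral (w₀ := p₂) (ε := ε)
      (fun s w hs hw => ?_) ha (mem_ball_iff_norm.2 hb')) _
    have h1 := H s w (by rw [hs]; linarith) (mem_ball_iff_norm.1 hw)
    exact h1.1 ⟨norm_pos_iff.1 (by simp only [hs]; exact hR0), h1.2.2⟩
  · rintro ⟨ha0, hb0⟩
    have hline : ∀ s : ℂ, ‖s‖ < ε → s ≠ 0 → DifferentiableAt ℂ (fun s => g (s, b)) s :=
      fun s hs hs0 => ((H s b hs hb').1 ⟨hs0, hb0⟩).comp (f := fun s => (s, b)) s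
        (differentiableAt_id.prodMk (differentiableAt_const _))
    have hmem : Metric.ball (0 : ℂ) ε ∈ 𝓝 (0 : ℂ) := Metric.ball_mem_nhds _ hε
    -- On the slice u₂ = b the one-variable theorem removes the singularity at 0. Cauchy's formula
    -- for the extended slice then identifies the integral with `g` off the axis.
    have hext := Complex.differentiableOn_update_limUnder_of_bddAbove (f := fun s => g (s, b))
      (s := Metric.ball 0 ε) (c := 0) hmem
      (fun s hs => (hline s (by simpa using hs.1) hs.2).differentiableWithinAt)
      ⟨K, by
        rintro _ ⟨s, hs, rfl⟩
        exact (H s b (by simpa using hs.1) hb').2.1 ⟨hs.2, hb0⟩⟩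
    have hc := cauchyFormula (R := R) (w := a) (fun s hs =>
      hext.differentiableAt (Metric.isOpen_ball.mem_nhds (by simp; linarith))) ha
    rw [Function.update_of_ne ha0] at hc
    have hpi : (2 * Real.pi * Complex.I : ℂ) ≠ 0 := Complex.two_pi_I_ne_zero
    rw [inv_mul_eq_iff_eq_mul₀ hpi, ← hc]
    refine circleIntegral.integral_congr hR0.le fun s hs => ?_
    have hs0 : s ≠ 0 := by
      rintro rfl
      simp [hR0.ne] at hs
    simp only [Function.update_of_ne hs0]

/-- Hartogs' theorem: isolated singularities in the plane are removable. -/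
theorem exists_extension_origin {g : ℂ × ℂ → ℂ}
    (hd : ∀ᶠ u in 𝓝 (0 : ℂ × ℂ), u ≠ 0 → DifferentiableAt ℂ g u) :
    ∃ h : ℂ × ℂ → ℂ, ∀ᶠ u in 𝓝 (0 : ℂ × ℂ), DifferentiableAt ℂ h u ∧ (u ≠ 0 → h u = g u) := by
  obtain ⟨ε, hε, H⟩ := eventually_prod_ball hd
  simp only [Prod.fst_zero, Prod.snd_zero, sub_zero] at H
  set R := ε / 2 with hR
  have hR0 : 0 < R := by positivity
  set h : ℂ × ℂ → ℂ := fun u =>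
    (2 * Real.pi * Complex.I)⁻¹ * ∮ s in C(0, R), (s - u.1)⁻¹ * g (s, u.2) with hh
  have h1 : ∀ a b : ℂ, ‖a‖ < R → ‖b‖ < R → DifferentiableAt ℂ h (a, b) := by
    intro a b ha hb
    refine DifferentiableAt.const_mul (differentiableAt_cauchyIntegral (w₀ := 0) (ε := ε)
      (fun s w hs hw => ?_) ha (by simp; linarith)) _
    refine H s w (by rw [hs]; linarith) (by simpa using hw) fun h0 => ?_
    simp [(Prod.mk.inj h0).1, hR0.ne] at hs
  -- A slice with b ≠ 0 misses the origin, so Cauchy's formula applies to it as it stands. The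
  -- remaining points with b = 0 follow by density.
  have h2 : ∀ a b : ℂ, ‖a‖ < R → ‖b‖ < R → b ≠ 0 → h (a, b) = g (a, b) := by
    intro a b ha hb hb0
    have hc := cauchyFormula (R := R) (f := fun s => g (s, b)) (w := a) (fun s hs =>
      (H s b (by linarith) (by linarith) fun h0 => hb0 (Prod.mk.inj h0).2).comp
        (f := fun s => (s, b)) s (differentiableAt_id.prodMk (differentiableAt_const _))) ha
    simp only [hh]
    rw [inv_mul_eq_iff_eq_mul₀ Complex.two_pi_I_ne_zero, ← hc]
  refine ⟨h, eventually_of_prod_ball hR0 fun a b ha hb => ?_⟩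
  simp only [Prod.fst_zero, Prod.snd_zero, sub_zero] at ha hb
  refine ⟨h1 a b ha hb, fun hab => ?_⟩
  refine eq_of_eventually_eq_torus (h1 a b ha hb).continuousAt
    (H a b (by linarith) (by linarith) hab).continuousAt ?_
  have e1 : ∀ᶠ u : ℂ × ℂ in 𝓝 (a, b), ‖u.1‖ < R :=
    continuousAt_fst.norm.eventually_lt_const ha
  have e2 : ∀ᶠ u : ℂ × ℂ in 𝓝 (a, b), ‖u.2‖ < R :=
    continuousAt_snd.norm.eventually_lt_const hb
  filter_upwards [e1, e2] with u hu1 hu2 hu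
  exact h2 u.1 u.2 hu1 hu2 hu.2

/-- A holomorphic function off the axes, which is locally bounded near the points lying on
exactly one axis, extends holomorphically. -/
theorem exists_extension {D : Set (ℂ × ℂ)} (hD : IsOpen D) {g : ℂ × ℂ → ℂ}
    (hd : ∀ u ∈ D, u ∈ torus → DifferentiableAt ℂ g u)
    (hb : ∀ p ∈ D, p ≠ 0 → p ∉ torus → ∃ K : ℝ, ∀ᶠ u in 𝓝 p, u ∈ torus → ‖g u‖ ≤ K) :
    ∃ h : ℂ × ℂ → ℂ, DifferentiableOn ℂ h D ∧ ∀ u ∈ D, u ∈ torus → h u = g u := by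
  have hde : ∀ p ∈ D, ∀ᶠ u in 𝓝 p, u ∈ torus → DifferentiableAt ℂ g u := fun p hp => by
    filter_upwards [hD.mem_nhds hp] with u hu using hd u hu
  have hloc : ∀ p ∈ D, p ≠ 0 → ∃ h : ℂ × ℂ → ℂ,
      ∀ᶠ u in 𝓝 p, DifferentiableAt ℂ h u ∧ (u ∈ torus → h u = g u) := by
    rintro ⟨p₁, p₂⟩ hp hp0
    by_cases ht : (p₁, p₂) ∈ torus
    · refine ⟨g, ?_⟩
      filter_upwards [hde _ hp, isOpen_torus.mem_nhds ht] with u hu hu' using ⟨hu hu', fun _ => rfl⟩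
    obtain ⟨K, hK⟩ := hb _ hp hp0 ht
    rcases eq_or_ne p₁ 0 with rfl | h1
    · exact exists_extension_axis (fun h => hp0 (by rw [h]; rfl)) (hde _ hp) hK
    have h2 : p₂ = 0 := by
      by_contra h2
      exact ht ⟨h1, h2⟩
    subst h2
    have hsw : Tendsto Prod.swap (𝓝 ((0 : ℂ), p₁)) (𝓝 (p₁, (0 : ℂ))) :=
      continuous_swap.tendsto' _ _ rfl
    have hsw' : Tendsto Prod.swap (𝓝 (p₁, (0 : ℂ))) (𝓝 ((0 : ℂ), p₁)) :=
      continuous_swap.tendsto' _ _ rfl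
    have hsd : ∀ u : ℂ × ℂ, DifferentiableAt ℂ (Prod.swap : ℂ × ℂ → ℂ × ℂ) u := fun u =>
      differentiableAt_snd.prodMk differentiableAt_fst
    obtain ⟨h, hh⟩ := exists_extension_axis (g := g ∘ Prod.swap) (K := K) h1
      (by
        filter_upwards [hsw.eventually (hde _ hp)] with u hu ht
        exact (hu ⟨ht.2, ht.1⟩).comp u (hsd u))
      (by
        filter_upwards [hsw.eventually hK] with u hu ht using hu ⟨ht.2, ht.1⟩)
    refine ⟨h ∘ Prod.swap, ?_⟩
    filter_upwards [hsw'.eventually hh] with u hu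
    exact ⟨hu.1.comp u (hsd u), fun ht => hu.2 ⟨ht.2, ht.1⟩⟩
  -- Limits taken through the torus glue the local extensions: near each point `G` agrees with any
  -- local extension, so no compatibility between them has to be checked.
  set G : ℂ × ℂ → ℂ := fun u => limUnder (𝓝[torus] u) g with hG
  have hGe : ∀ (p : ℂ × ℂ) (h : ℂ × ℂ → ℂ),
      (∀ᶠ u in 𝓝 p, DifferentiableAt ℂ h u ∧ (u ∈ torus → h u = g u)) →
      ∀ᶠ u in 𝓝 p, G u = h u := by
    intro p h hh
    filter_upwards [hh.eventually_nhds] with u hu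
    have h1 : Tendsto h (𝓝[torus] u) (𝓝 (h u)) :=
      hu.self_of_nhds.1.continuousAt.tendsto.mono_left nhdsWithin_le_nhds
    exact (h1.congr' (eventually_nhdsWithin_iff.2 (hu.mono fun _ h => h.2))).limUnder_eq
  have hfin : ∀ (p : ℂ × ℂ) (h : ℂ × ℂ → ℂ),
      (∀ᶠ u in 𝓝 p, DifferentiableAt ℂ h u ∧ (u ∈ torus → h u = g u)) →
      DifferentiableAt ℂ G p ∧ (p ∈ torus → G p = g p) := by
    intro p h hh
    have h1 := hGe p h hh
    have h2 := hh.self_of_nhds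
    exact ⟨h2.1.congr_of_eventuallyEq h1, fun ht => h1.self_of_nhds.trans (h2.2 ht)⟩
  have hall : ∀ p ∈ D, DifferentiableAt ℂ G p ∧ (p ∈ torus → G p = g p) := by
    intro p hp
    rcases eq_or_ne p 0 with rfl | hp0
    -- By now `G` is holomorphic on a punctured neighbourhood of the origin, crossing the axes
    -- included, so Hartogs applies to `G`, though not to `g`.
    · obtain ⟨h, hh⟩ := exists_extension_origin (g := G) (by
        filter_upwards [hD.mem_nhds hp] with u hu hu0
        obtain ⟨h, hh⟩ := hloc u hu hu0
        exact (hfin u h hh).1)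
      refine hfin 0 h ?_
      filter_upwards [hh, hD.mem_nhds hp] with u hu huD
      refine ⟨hu.1, fun ht => ?_⟩
      have hu0 : u ≠ 0 := fun h0 => ht.1 (by rw [h0]; rfl)
      obtain ⟨h', hh'⟩ := hloc u huD hu0
      exact (hu.2 hu0).trans ((hfin u h' hh').2 ht)
    · obtain ⟨h, hh⟩ := hloc p hp hp0
      exact hfin p h hh
  exact ⟨G, fun u hu => (hall u hu).1.differentiableWithinAt, fun u hu => (hall u hu).2⟩

/-! ### Taylor approximation at the origin -/

/-- The span of the monomials in two variables, as functions. -/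
noncomputable def polyFun : Submodule ℂ (ℂ × ℂ → ℂ) :=
  Submodule.span ℂ (Set.range fun ij : ℕ × ℕ => fun z : ℂ × ℂ => z.1 ^ ij.1 * z.2 ^ ij.2)

/-- The quotient by z₁ is (f(a, b) - f(0, b))/a, written as the Cauchy integral of f(s, b)/s so that
it is jointly holomorphic across a = 0. The quotient by z₂ is the divided difference of f(0, ·). -/
theorem exists_division {f : ℂ × ℂ → ℂ} (hf : ∀ᶠ z in 𝓝 (0 : ℂ × ℂ), DifferentiableAt ℂ f z) :
    ∃ g h : ℂ × ℂ → ℂ, (∀ᶠ z in 𝓝 (0 : ℂ × ℂ), DifferentiableAt ℂ g z) ∧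
      (∀ᶠ z in 𝓝 (0 : ℂ × ℂ), DifferentiableAt ℂ h z) ∧
      ∀ᶠ z in 𝓝 (0 : ℂ × ℂ), f z = f 0 + z.1 * g z + z.2 * h z := by
  obtain ⟨ε, hε, H⟩ := eventually_prod_ball hf
  simp only [Prod.fst_zero, Prod.snd_zero, sub_zero] at H
  set R := ε / 2 with hR
  have hR0 : 0 < R := by positivity
  have hpi : (2 * Real.pi * Complex.I : ℂ) ≠ 0 := Complex.two_pi_I_ne_zero
  set k : ℂ → ℂ := fun w => f (0, w) with hk
  have hk' : ∀ w, ‖w‖ < ε → DifferentiableAt ℂ k w := fun w hw =>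
    (H 0 w (by simpa) hw).comp (f := fun w => ((0 : ℂ), w)) w
      ((differentiableAt_const _).prodMk differentiableAt_id)
  have hds : DifferentiableOn ℂ (dslope k 0) (Metric.ball 0 ε) :=
    (Complex.differentiableOn_dslope (Metric.ball_mem_nhds _ hε)).2 fun w hw =>
      (hk' w (by simpa using hw)).differentiableWithinAt
  refine ⟨fun u => (2 * Real.pi * Complex.I)⁻¹ *
      ∮ s in C(0, R), (s - u.1)⁻¹ * (fun z : ℂ × ℂ => z.1⁻¹ * f z) (s, u.2),
    fun u => dslope k 0 u.2, eventually_of_prod_ball hR0 fun a b ha hb => ?_,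
    eventually_of_prod_ball hR0 fun a b ha hb => ?_,
    eventually_of_prod_ball hR0 fun a b ha hb => ?_⟩ <;>
  simp only [Prod.fst_zero, Prod.snd_zero, sub_zero] at ha hb
  · refine DifferentiableAt.const_mul (differentiableAt_cauchyIntegral
      (g := fun z : ℂ × ℂ => z.1⁻¹ * f z) (w₀ := 0) (ε := ε)
      (fun s w hs hw => ?_) ha (by simp; linarith)) _
    refine DifferentiableAt.mul (differentiableAt_fst.inv ?_)
      (H s w (by rw [hs]; linarith) (by simpa using hw))
    exact norm_pos_iff.1 (by simp only [hs]; exact hR0)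
  · exact (hds.differentiableAt (Metric.isOpen_ball.mem_nhds (by simp; linarith))).comp
      (f := fun u : ℂ × ℂ => u.2) (a, b) differentiableAt_snd
  · have hline : ∀ s : ℂ, ‖s‖ ≤ R → DifferentiableAt ℂ (fun s => f (s, b)) s := fun s hs =>
      (H s b (by linarith) (by linarith)).comp (f := fun s => (s, b)) s
        (differentiableAt_id.prodMk (differentiableAt_const _))
    have c1 := cauchyFormula hline ha
    have c0 := cauchyFormula (w := 0) hline (by simpa using hR0)
    have hcont : ContinuousOn (fun s => f (s, b)) (Metric.sphere 0 R) := fun s hs =>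
      (hline s (by simpa using (mem_sphere_iff_norm.1 hs).le)).continuousAt.continuousWithinAt
    have hi : ∀ w : ℂ, ‖w‖ < R → CircleIntegrable (fun s => (s - w)⁻¹ * f (s, b)) 0 R := by
      intro w hw
      refine ContinuousOn.circleIntegrable hR0.le (ContinuousOn.mul (ContinuousOn.inv₀
        (continuousOn_id.sub continuousOn_const) fun s hs h0 => ?_) hcont)
      rw [sub_eq_zero.1 h0] at hs
      simp at hs
      linarith
    -- Partial fractions: a/((s - a)s) = 1/(s - a) - 1/s.
    have e : (∮ s in C(0, R), (s - a)⁻¹ * (s⁻¹ * f (s, b))) * a =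
        (∮ s in C(0, R), (s - a)⁻¹ * f (s, b)) - ∮ s in C(0, R), (s - 0)⁻¹ * f (s, b) := by
      rw [← circleIntegral.integral_sub (hi a ha) (hi 0 (by simpa using hR0)), mul_comm,
        ← circleIntegral.integral_const_mul]
      refine circleIntegral.integral_congr hR0.le fun s hs => ?_
      have hs' : ‖s‖ = R := by simpa using hs
      have hs0 : s ≠ 0 := norm_pos_iff.1 (by rw [hs']; exact hR0)
      have hsa : s - a ≠ 0 := by
        intro h0
        rw [sub_eq_zero.1 h0] at hs'
        linarith
      simp only [sub_zero]
      field_simp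
      ring
    rw [c1, c0] at e
    have e2 : f (0, b) = f 0 + b * dslope k 0 b := by
      have := sub_smul_dslope k 0 b
      simp only [sub_zero, smul_eq_mul, hk] at this
      rw [this, show f 0 = f (0, 0) from rfl]
      ring
    set J := ∮ s in C(0, R), (s - a)⁻¹ * (s⁻¹ * f (s, b))
    have e3 : a * ((2 * Real.pi * Complex.I)⁻¹ * J) = f (a, b) - f (0, b) := by
      rw [mul_left_comm, inv_mul_eq_iff_eq_mul₀ hpi]
      linear_combination e
    rw [e3]
    linear_combination e2

theorem mul_mem_polyFun {T : ℂ × ℂ → ℂ} (hT : T ∈ polyFun) (i j : ℕ) :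
    (fun z : ℂ × ℂ => z.1 ^ i * z.2 ^ j * T z) ∈ polyFun := by
  induction hT using Submodule.span_induction with
  | mem x hx =>
    obtain ⟨⟨a, b⟩, rfl⟩ := hx
    refine Submodule.subset_span ⟨(i + a, j + b), ?_⟩
    funext z
    simp only
    ring
  | zero =>
    convert polyFun.zero_mem using 1
    funext z
    simp
  | add x y _ _ hx hy =>
    convert polyFun.add_mem hx hy using 1
    funext z
    simp only [Pi.add_apply]
    ring
  | smul a x _ hx =>
    convert polyFun.smul_mem a hx using 1
    funext z
    simp only [Pi.smul_apply, smul_eq_mul]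
    ring

/-- Dividing repeatedly by the coordinates gains one order each time, and no estimate on derivatives
is needed. -/
theorem exists_taylor (N : ℕ) {f : ℂ × ℂ → ℂ}
    (hf : ∀ᶠ z in 𝓝 (0 : ℂ × ℂ), DifferentiableAt ℂ f z) :
    ∃ T ∈ polyFun, (fun z => f z - T z) =O[𝓝 0] fun z => ‖z‖ ^ N := by
  induction N generalizing f with
  | zero =>
    refine ⟨0, polyFun.zero_mem, ?_⟩
    simpa using hf.self_of_nhds.continuousAt.norm.isBoundedUnder_le.isBigO_one ℝ
  | succ N ih =>
    obtain ⟨g, h, hg, hh, e⟩ := exists_division hf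
    obtain ⟨S, hS, hgS⟩ := ih hg
    obtain ⟨T, hT, hhT⟩ := ih hh
    refine ⟨fun z => f 0 + z.1 * S z + z.2 * T z, ?_, ?_⟩
    · have h1 : (fun _ : ℂ × ℂ => f 0) ∈ polyFun := by
        have : (fun z : ℂ × ℂ => z.1 ^ 0 * z.2 ^ 0) ∈ polyFun := Submodule.subset_span ⟨(0, 0), rfl⟩
        convert polyFun.smul_mem (f 0) this using 1
        funext z
        simp
      have h2 := mul_mem_polyFun hS 1 0
      have h3 := mul_mem_polyFun hT 0 1
      simp only [pow_one, pow_zero, mul_one, one_mul] at h2 h3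
      exact polyFun.add_mem (polyFun.add_mem h1 h2) h3
    · have b1 : (fun z : ℂ × ℂ => z.1) =O[𝓝 0] fun z => ‖z‖ :=
        Asymptotics.IsBigO.of_bound 1 (Eventually.of_forall fun z => by
          simpa using norm_fst_le z)
      have b2 : (fun z : ℂ × ℂ => z.2) =O[𝓝 0] fun z => ‖z‖ :=
        Asymptotics.IsBigO.of_bound 1 (Eventually.of_forall fun z => by
          simpa using norm_snd_le z)
      have := (b1.mul hgS).add (b2.mul hhT)
      refine Asymptotics.IsBigO.congr' this ?_ (Eventually.of_forall fun z => by ring)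
      filter_upwards [e] with z hz
      rw [hz]
      ring

end AnSing

/-! ### Binary forms -/

namespace AnSing

theorem evalForm_eq_sum_range {m : ℕ} (c : ℕ → ℂ) (v : ℂ × ℂ) :
    evalForm (fun q : Fin (m + 1) => c q) v =
      ∑ q ∈ Finset.range (m + 1), c q * v.1 ^ (m - q) * v.2 ^ q := by
  simp only [evalForm]
  rw [Fin.sum_univ_eq_sum_range (fun q => c q * v.1 ^ (m - q) * v.2 ^ q)]

theorem evalForm_sum {m : ℕ} {ι : Type*} (s : Finset ι) (c : ι → Fin (m + 1) → ℂ) (v : ℂ × ℂ) :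
    evalForm (fun q => ∑ i ∈ s, c i q) v = ∑ i ∈ s, evalForm (c i) v := by
  simp only [evalForm, Finset.sum_mul]
  rw [Finset.sum_comm]

theorem evalForm_sub {m : ℕ} (c d : Fin (m + 1) → ℂ) (v : ℂ × ℂ) :
    evalForm (c - d) v = evalForm c v - evalForm d v := by
  simp only [evalForm, Pi.sub_apply, sub_mul, Finset.sum_sub_distrib]

theorem continuous_evalForm {m : ℕ} (c : Fin (m + 1) → ℂ) : Continuous (evalForm c) := by
  unfold evalForm
  fun_prop

/-- The matrix recovering the coefficients of a binary form from its values at `(1, k)`. -/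
noncomputable def interp (m : ℕ) : Matrix (Fin (m + 1)) (Fin (m + 1)) ℂ :=
  (Matrix.vandermonde fun k : Fin (m + 1) => ((k : ℕ) : ℂ))⁻¹

/-- Invertibility of the Vandermonde matrix at the nodes 0, …, m. Thus bounds and holomorphy pass
from values of a form on fixed tangent vectors to its coefficients. -/
theorem coeff_eq_interp {m : ℕ} (c : Fin (m + 1) → ℂ) (q : Fin (m + 1)) :
    c q = ∑ k : Fin (m + 1), interp m q k * evalForm c (1, ((k : ℕ) : ℂ)) := by
  set V := Matrix.vandermonde fun k : Fin (m + 1) => ((k : ℕ) : ℂ) with hV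
  have hdet : IsUnit V.det := by
    rw [isUnit_iff_ne_zero, hV, Matrix.det_vandermonde_ne_zero_iff]
    intro a b hab
    exact Fin.ext (Nat.cast_injective (R := ℂ) hab)
  have h1 : ∀ k : Fin (m + 1), evalForm c (1, ((k : ℕ) : ℂ)) = V.mulVec c k := by
    intro k
    simp only [evalForm, Matrix.mulVec, dotProduct, hV, Matrix.vandermonde_apply, one_pow, mul_one]
    exact Finset.sum_congr rfl fun q _ => mul_comm _ _
  have h2 : (V⁻¹).mulVec (V.mulVec c) = c := by
    rw [Matrix.mulVec_mulVec, Matrix.nonsing_inv_mul _ hdet, Matrix.one_mulVec]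
  conv_lhs => rw [← h2]
  simp only [h1, interp, ← hV]
  rfl

theorem evalForm_injective {m : ℕ} {c d : Fin (m + 1) → ℂ}
    (h : ∀ k : ℕ, evalForm c (1, (k : ℂ)) = evalForm d (1, (k : ℂ))) : c = d := by
  funext q
  rw [coeff_eq_interp c, coeff_eq_interp d]
  simp only [h]

/-- Functions given by binary forms of degree `m`. -/
def forms (m : ℕ) : Submodule ℂ (ℂ × ℂ → ℂ) where
  carrier := {P | ∃ c : Fin (m + 1) → ℂ, ∀ v, evalForm c v = P v}
  zero_mem' := ⟨0, fun v => by simp [evalForm]⟩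
  add_mem' := by
    rintro _ _ ⟨c, hc⟩ ⟨d, hd⟩
    exact ⟨c + d, fun v => by rw [evalForm_add, hc, hd]; rfl⟩
  smul_mem' := by
    rintro a _ ⟨c, hc⟩
    exact ⟨a • c, fun v => by rw [evalForm_smul, hc]; rfl⟩

theorem monomial_mem_forms {m i j : ℕ} (h : i + j = m) :
    (fun v : ℂ × ℂ => v.1 ^ i * v.2 ^ j) ∈ forms m := by
  refine ⟨fun q => if (q : ℕ) = j then 1 else 0, fun v => ?_⟩
  rw [evalForm_eq_sum_range (fun q => if q = j then (1 : ℂ) else 0),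
    Finset.sum_eq_single_of_mem j (by simp; omega)]
  · rw [if_pos rfl, one_mul]
    congr 2
    omega
  · intro q _ hq
    simp [hq]

/-- Ensures that the pull-back of a form under a linear map of tangent vectors is again given by
coefficients. -/
theorem exists_linear_subst {m : ℕ} (c : Fin (m + 1) → ℂ) (α β γ δ : ℂ) :
    ∃ c' : Fin (m + 1) → ℂ, ∀ v : ℂ × ℂ,
      evalForm c' v = evalForm c (α * v.1 + β * v.2, γ * v.1 + δ * v.2) := by
  change (fun v : ℂ × ℂ => evalForm c (α * v.1 + β * v.2, γ * v.1 + δ * v.2)) ∈ forms m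
  have : (fun v : ℂ × ℂ => evalForm c (α * v.1 + β * v.2, γ * v.1 + δ * v.2)) =
      ∑ q : Fin (m + 1), ∑ i ∈ Finset.range (m - q + 1), ∑ j ∈ Finset.range ((q : ℕ) + 1),
        (c q * α ^ i * β ^ (m - q - i) * (m - q).choose i * γ ^ j * δ ^ (q - j) *
          (q : ℕ).choose j) • fun v : ℂ × ℂ => v.1 ^ (i + j) * v.2 ^ (m - q - i + (q - j)) := by
    funext v
    simp only [evalForm, Finset.sum_apply, Pi.smul_apply, smul_eq_mul]
    refine Finset.sum_congr rfl fun q _ => ?_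
    rw [add_pow, add_pow, mul_assoc, Finset.sum_mul_sum, Finset.mul_sum]
    refine Finset.sum_congr rfl fun i _ => ?_
    rw [Finset.mul_sum]
    refine Finset.sum_congr rfl fun j _ => ?_
    ring
  rw [this]
  refine Submodule.sum_mem _ fun q _ => Submodule.sum_mem _ fun i hi => Submodule.sum_mem _
    fun j hj => Submodule.smul_mem _ _ (monomial_mem_forms ?_)
  have := q.2
  simp only [Finset.mem_range] at hi hj
  omega

/-! ### The coefficients of a polynomial in the charts -/

/-- The coefficients of `f` in the basis `(X - r) ^ (m - q) * (r + 1 - X) ^ q`. -/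
noncomputable def chartCoeff (m r : ℕ) (f : Polynomial ℂ) (q : Fin (m + 1)) : ℂ :=
  ∑ k ∈ Finset.range (m + 1),
    (Polynomial.taylor (r : ℂ) f).coeff k * ((m - k).choose q : ℂ)

/-- Summing over all q ≤ m is harmless because the binomial coefficient vanishes for q > m - k. -/
theorem sum_choose_mul_pow {m k : ℕ} (hk : k ≤ m) (x y : ℂ) :
    ∑ q ∈ Finset.range (m + 1), ((m - k).choose q : ℂ) * x ^ q * y ^ (m - q) =
      y ^ k * (x + y) ^ (m - k) := by
  rw [add_pow, Finset.mul_sum]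
  refine (Finset.sum_subset (s₁ := Finset.range (m - k + 1)) (Finset.range_mono (by omega))
    ?_).symm.trans ?_
  rotate_left
  · refine Finset.sum_congr rfl fun q hq => ?_
    simp only [Finset.mem_range] at hq
    rw [show m - q = k + (m - k - q) by omega, pow_add]
    ring
  · intro q _ hq
    simp only [Finset.mem_range] at hq
    rw [Nat.choose_eq_zero_of_lt (by omega)]
    simp

theorem evalForm_chartCoeff_sum (m r : ℕ) (f : Polynomial ℂ) (t : ℂ × ℂ) :
    evalForm (chartCoeff m r f) t = ∑ k ∈ Finset.range (m + 1),
      (Polynomial.taylor (r : ℂ) f).coeff k * (t.1 ^ k * (t.2 + t.1) ^ (m - k)) := by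
  have h := evalForm_eq_sum_range (m := m) (fun q => ∑ k ∈ Finset.range (m + 1),
    (Polynomial.taylor (r : ℂ) f).coeff k * ((m - k).choose q : ℂ)) t
  refine h.trans ?_
  simp only [Finset.sum_mul]
  rw [Finset.sum_comm]
  refine Finset.sum_congr rfl fun k hk => ?_
  rw [← sum_choose_mul_pow (Nat.lt_succ_iff.1 (Finset.mem_range.1 hk)), Finset.mul_sum]
  exact Finset.sum_congr rfl fun q _ => by ring

theorem sum_coeff_mul_homog {m : ℕ} {g : Polynomial ℂ} (hg : g.natDegree ≤ m) {x h : ℂ}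
    (hh : h ≠ 0) :
    ∑ k ∈ Finset.range (m + 1), g.coeff k * (x ^ k * h ^ (m - k)) = h ^ m * g.eval (x / h) := by
  rw [Polynomial.eval_eq_sum_range' (Nat.lt_succ_of_le hg), Finset.mul_sum]
  refine Finset.sum_congr rfl fun k hk => ?_
  have hk' : k ≤ m := Nat.lt_succ_iff.1 (Finset.mem_range.1 hk)
  rw [div_pow, ← Nat.sub_add_cancel hk', pow_add, Nat.add_sub_cancel]
  field_simp

/-- The chart coefficients describe the homogenisation of f, with t₁ + t₂ as homogenising coordinate
and the affine coordinate shifted by r. -/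
theorem evalForm_chartCoeff {m : ℕ} (r : ℕ) {f : Polynomial ℂ} (hf : f.natDegree ≤ m) {t : ℂ × ℂ}
    (ht : t.1 + t.2 ≠ 0) :
    evalForm (chartCoeff m r f) t =
      (t.1 + t.2) ^ m * f.eval ((t.1 + r * (t.1 + t.2)) / (t.1 + t.2)) := by
  rw [evalForm_chartCoeff_sum, add_comm t.2,
    sum_coeff_mul_homog (by rwa [Polynomial.natDegree_taylor]) ht, Polynomial.taylor_eval, add_div,
    mul_div_cancel_right₀ _ ht]

/-- The linear change (s₁, s₂) ↦ (s₁, s₂ - s₁) turns the density of the torus into that of {t₁ + t₂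
≠ 0}. -/
theorem eq_of_eq_of_sum_ne_zero {F G : ℂ × ℂ → ℂ} (hF : Continuous F) (hG : Continuous G)
    (h : ∀ t : ℂ × ℂ, t.1 + t.2 ≠ 0 → F t = G t) (t : ℂ × ℂ) : F t = G t := by
  have hc : Continuous fun s : ℂ × ℂ => (s.1, s.2 - s.1) := by fun_prop
  have := eq_of_eventually_eq_torus (p := (t.1, t.1 + t.2)) (hF.comp hc).continuousAt
    (hG.comp hc).continuousAt (Eventually.of_forall fun s hs => h (s.1, s.2 - s.1) (by
      simpa using hs.2))
  simpa using this

/-- With s = t₁ + t₂ one has -t₂ + (r + 1)s = t₁ + rs, so both charts evaluate f at the same point.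
-/
theorem evalForm_chartCoeff_succ {m : ℕ} (r : ℕ) {f : Polynomial ℂ} (hf : f.natDegree ≤ m)
    (t : ℂ × ℂ) :
    evalForm (chartCoeff m r f) t = evalForm (chartCoeff m (r + 1) f) (-t.2, t.1 + 2 * t.2) := by
  refine eq_of_eq_of_sum_ne_zero (continuous_evalForm _)
    ((continuous_evalForm (chartCoeff m (r + 1) f)).comp
      (g := evalForm (chartCoeff m (r + 1) f)) (f := fun t : ℂ × ℂ => (-t.2, t.1 + 2 * t.2))
      (by fun_prop)) (fun t ht => ?_) t
  have e : -t.2 + (t.1 + 2 * t.2) = t.1 + t.2 := by ring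
  simp only [Function.comp]
  rw [evalForm_chartCoeff r hf ht, evalForm_chartCoeff (r + 1) hf (by simpa only [e] using ht)]
  simp only [e]
  congr 3
  push_cast
  ring

/-- Restriction of the binary form to the line t = (s - r, r + 1 - s), on which t₁ + t₂ = 1. -/
theorem eq_sum_chartCoeff {m : ℕ} (r : ℕ) {f : Polynomial ℂ} (hf : f.natDegree ≤ m) :
    f = ∑ q : Fin (m + 1), Polynomial.C (chartCoeff m r f q) *
      (Polynomial.X - Polynomial.C (r : ℂ)) ^ (m - (q : ℕ)) *
        (Polynomial.C ((r : ℂ) + 1) - Polynomial.X) ^ (q : ℕ) := by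
  refine Polynomial.funext fun s => ?_
  have h := evalForm_chartCoeff r hf (t := (s - r, r + 1 - s)) (by simp)
  simp only [show s - r + (r + 1 - s) = 1 by ring, one_pow, one_mul, mul_one,
    div_one, sub_add_cancel] at h
  rw [← h, Polynomial.eval_finsetSum]
  simp [evalForm]

/-- Vanishing order at `r` in terms of coefficients. -/
theorem X_sub_pow_dvd_iff_left {m r K : ℕ} {f : Polynomial ℂ} (hf : f.natDegree ≤ m) :
    (Polynomial.X - Polynomial.C (r : ℂ)) ^ K ∣ f ↔
      ∀ q : Fin (m + 1), m - (q : ℕ) < K → chartCoeff m r f q = 0 := by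
  constructor
  · intro h q hq
    rw [Polynomial.X_sub_C_pow_dvd_iff] at h
    rw [Polynomial.X_pow_dvd_iff] at h
    refine Finset.sum_eq_zero fun k hk => ?_
    have hk' : k ≤ m := Nat.lt_succ_iff.1 (Finset.mem_range.1 hk)
    by_cases hk : k < K
    · have := h k hk
      rw [Polynomial.taylor_apply, this, zero_mul]
    · rw [Nat.choose_eq_zero_of_lt (by have := q.2; omega)]
      simp
  · intro h
    rw [eq_sum_chartCoeff r hf]
    refine Finset.dvd_sum fun q _ => ?_
    by_cases hq : m - (q : ℕ) < K
    · simp [h q hq]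
    · exact Dvd.dvd.mul_right (Dvd.dvd.mul_left (pow_dvd_pow _ (by omega)) _) _

/-- The same coefficients read from the Taylor expansion at r + 1, the other end of the chart; this
makes vanishing at r + 1 visible. -/
theorem chartCoeff_eq_right {m : ℕ} (r : ℕ) {f : Polynomial ℂ} (hf : f.natDegree ≤ m) :
    chartCoeff m r f = fun q : Fin (m + 1) => ∑ k ∈ Finset.range (m + 1),
      (Polynomial.taylor ((r : ℂ) + 1) f).coeff k * (-1) ^ k * ((m - k).choose (m - q) : ℂ) := by
  refine evalForm_injective fun j => ?_
  have hj : (1 : ℂ) + (j : ℂ) ≠ 0 := by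
    rw [add_comm]
    exact Nat.cast_add_one_ne_zero j
  rw [evalForm_chartCoeff r hf (by simpa using hj),
    evalForm_eq_sum_range (fun q => ∑ k ∈ Finset.range (m + 1),
      (Polynomial.taylor ((r : ℂ) + 1) f).coeff k * (-1) ^ k * ((m - k).choose (m - q) : ℂ))]
  simp only [Finset.sum_mul]
  rw [Finset.sum_comm]
  have e : ∀ k ∈ Finset.range (m + 1), ∑ q ∈ Finset.range (m + 1),
      (Polynomial.taylor ((r : ℂ) + 1) f).coeff k * (-1) ^ k * ((m - k).choose (m - q) : ℂ) *
        1 ^ (m - q) * (j : ℂ) ^ q =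
      (Polynomial.taylor ((r : ℂ) + 1) f).coeff k * ((-(j : ℂ)) ^ k * (1 + (j : ℂ)) ^ (m - k)) := by
    intro k hk
    have hk' : k ≤ m := Nat.lt_succ_iff.1 (Finset.mem_range.1 hk)
    rw [← Finset.sum_range_reflect]
    have := sum_choose_mul_pow hk' 1 (j : ℂ)
    rw [neg_pow (j : ℂ), mul_assoc ((-1 : ℂ) ^ k), ← this, Finset.mul_sum, Finset.mul_sum]
    refine Finset.sum_congr rfl fun q hq => ?_
    have hq' : q ≤ m := Nat.lt_succ_iff.1 (Finset.mem_range.1 hq)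
    rw [show m + 1 - 1 - q = m - q by omega, show m - (m - q) = q by omega]
    ring
  rw [Finset.sum_congr rfl e, sum_coeff_mul_homog (by rwa [Polynomial.natDegree_taylor]) hj,
    Polynomial.taylor_eval]
  congr 2
  field_simp
  ring

/-- Vanishing order at `r + 1` in terms of coefficients. -/
theorem X_sub_pow_dvd_iff_right {m r K : ℕ} {f : Polynomial ℂ} (hf : f.natDegree ≤ m) :
    (Polynomial.X - Polynomial.C ((r + 1 : ℕ) : ℂ)) ^ K ∣ f ↔
      ∀ q : Fin (m + 1), (q : ℕ) < K → chartCoeff m r f q = 0 := by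
  rw [Nat.cast_succ]
  constructor
  · intro h q hq
    rw [Polynomial.X_sub_C_pow_dvd_iff] at h
    rw [Polynomial.X_pow_dvd_iff] at h
    rw [chartCoeff_eq_right r hf]
    refine Finset.sum_eq_zero fun k hk => ?_
    have hk' : k ≤ m := Nat.lt_succ_iff.1 (Finset.mem_range.1 hk)
    by_cases hk : k < K
    · have := h k hk
      rw [Polynomial.taylor_apply, this, zero_mul, zero_mul]
    · rw [Nat.choose_eq_zero_of_lt (by have := q.2; omega)]
      simp
  · intro h
    rw [eq_sum_chartCoeff r hf]
    refine Finset.dvd_sum fun q _ => ?_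
    by_cases hq : (q : ℕ) < K
    · simp [h q hq]
    · refine Dvd.dvd.mul_left ?_ _
      rw [← neg_sub Polynomial.X (Polynomial.C ((r : ℂ) + 1)), neg_pow]
      exact Dvd.dvd.mul_left (pow_dvd_pow (Polynomial.X - Polynomial.C ((r : ℂ) + 1))
        (not_lt.1 hq)) _

/-! ### Logarithmic forms and monomial forms -/

theorem hasFDerivAt_transition {u : ℂ × ℂ} (hu : u.2 ≠ 0) :
    HasFDerivAt transition
      ((-(u.2 ^ 2)⁻¹ • ContinuousLinearMap.snd ℂ ℂ ℂ).prod
        (u.1 • (((2 : ℕ) • u.2 ^ (2 - 1)) • ContinuousLinearMap.snd ℂ ℂ ℂ) +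
          u.2 ^ 2 • ContinuousLinearMap.fst ℂ ℂ ℂ)) u := by
  have h1 : HasFDerivAt (fun u : ℂ × ℂ => u.2⁻¹)
      (-(u.2 ^ 2)⁻¹ • ContinuousLinearMap.snd ℂ ℂ ℂ) u := by
    simpa [Function.comp_def] using (hasDerivAt_inv hu).comp_hasFDerivAt u
      (hasFDerivAt_snd (𝕜 := ℂ) (p := u))
  exact h1.prodMk ((hasFDerivAt_fst (𝕜 := ℂ) (p := u)).mul
    ((hasFDerivAt_snd (𝕜 := ℂ) (p := u)).pow 2))

theorem fderiv_transition {u : ℂ × ℂ} (hu : u.2 ≠ 0) (v : ℂ × ℂ) :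
    fderiv ℂ transition u v =
      (-(u.2 ^ 2)⁻¹ * v.2, u.2 ^ 2 * v.1 + 2 * u.1 * u.2 * v.2) := by
  rw [(hasFDerivAt_transition hu).fderiv]
  ext
  · simp
  · simp
    ring

theorem transition_mem_torus {u : ℂ × ℂ} (hu : u ∈ torus) : transition u ∈ torus :=
  ⟨inv_ne_zero hu.2, mul_ne_zero hu.1 (pow_ne_zero 2 hu.2)⟩

/-- The value of a form at the tangent vector with logarithmic coordinates `t`. -/
def logEval {m : ℕ} (c : Fin (m + 1) → ℂ) (u t : ℂ × ℂ) : ℂ :=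
  evalForm c (u.1 * t.1, u.2 * t.2)

theorem fderiv_transition_log {u : ℂ × ℂ} (hu : u.2 ≠ 0) (t : ℂ × ℂ) :
    fderiv ℂ transition u (u.1 * t.1, u.2 * t.2) =
      ((transition u).1 * -t.2, (transition u).2 * (t.1 + 2 * t.2)) := by
  rw [fderiv_transition hu]
  ext
  · simp only [transition]
    field_simp
  · simp only [transition]
    ring

theorem IsSymDiff.logEval_succ {n m : ℕ} {W : Set (Resolution n)}
    {ω : Charts n → Fin (m + 1) → ℂ} (h : IsSymDiff n m W ω) (r : Fin n) {u : ℂ × ℂ}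
    (hu : u ∈ torus) (hW : toRes n (r.castSucc, u) ∈ W) (t : ℂ × ℂ) :
    logEval (ω (r.castSucc, u)) u t =
      logEval (ω (r.succ, transition u)) (transition u) (-t.2, t.1 + 2 * t.2) := by
  unfold logEval
  rw [h.compat r u hu.2 hW, fderiv_transition_log hu.2]

/-- The order along the `r`-th divisor of the weight `(g, d)`, shifted by the degree `m`. -/
def ord (m : ℕ) (w : ℤ × ℤ) (r : ℕ) : ℤ := m + w.1 - r * w.2

/-- The form of weight `w` whose logarithmic coefficients are those of `f`. -/
noncomputable def monoForm (n m : ℕ) (w : ℤ × ℤ) (f : Polynomial ℂ) :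
    Charts n → Fin (m + 1) → ℂ := fun p q =>
  chartCoeff m p.1 f q * (p.2.1 ^ (ord m w (p.1 + 1) - (m - (q : ℕ) : ℤ)) *
    p.2.2 ^ (ord m w p.1 - (q : ℕ)))

theorem logEval_monoForm {n m : ℕ} (w : ℤ × ℤ) (f : Polynomial ℂ) (r : Fin (n + 1)) {u : ℂ × ℂ}
    (hu : u ∈ torus) (t : ℂ × ℂ) :
    logEval (monoForm n m w f (r, u)) u t =
      u.1 ^ ord m w (r + 1) * u.2 ^ ord m w r * evalForm (chartCoeff m r f) t := by
  simp only [logEval, evalForm, monoForm, Finset.mul_sum]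
  refine Finset.sum_congr rfl fun q _ => ?_
  have hq : ((m - (q : ℕ) : ℕ) : ℤ) = m - (q : ℕ) := by
    have := q.2
    omega
  rw [← hq, zpow_sub₀ hu.1, zpow_sub₀ hu.2, zpow_natCast, zpow_natCast, mul_pow, mul_pow]
  have h1 := hu.1
  have h2 := hu.2
  field_simp

/-- `ord m w` is affine in r, so ord(r) + ord(r + 2) = 2 ord(r + 1). This matches the exponent 2 in
`transition`, that is, self-intersection -2. -/
theorem zpow_transition {m : ℕ} (w : ℤ × ℤ) (r : ℕ) {u : ℂ × ℂ} (hu : u ∈ torus) :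
    (transition u).1 ^ ord m w (r + 2) * (transition u).2 ^ ord m w (r + 1) =
      u.1 ^ ord m w (r + 1) * u.2 ^ ord m w r := by
  simp only [transition]
  rw [inv_zpow', mul_zpow, ← zpow_natCast u.2 2, ← zpow_mul, mul_left_comm, ← zpow_add₀ hu.2]
  congr 2
  simp only [ord]
  push_cast
  ring

theorem continuousAt_evalForm {m : ℕ} {X : Type*} [TopologicalSpace X]
    {c : X → Fin (m + 1) → ℂ} {v : X → ℂ × ℂ} {x : X}
    (hc : ∀ q, ContinuousAt (fun x => c x q) x) (hv : ContinuousAt v x) :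
    ContinuousAt (fun x => evalForm (c x) (v x)) x := by
  unfold evalForm
  refine tendsto_finsetSum _ fun q _ => ?_
  exact ((hc q).mul (hv.fst.pow _)).mul (hv.snd.pow _)

theorem continuousAt_transition {u : ℂ × ℂ} (hu : u.2 ≠ 0) : ContinuousAt transition u :=
  (hasFDerivAt_transition hu).continuousAt

theorem continuousAt_fderiv_transition {u : ℂ × ℂ} (hu : u.2 ≠ 0) (v : ℂ × ℂ) :
    ContinuousAt (fun u => fderiv ℂ transition u v) u := by
  have h : ContinuousAt (fun u : ℂ × ℂ =>
      (-(u.2 ^ 2)⁻¹ * v.2, u.2 ^ 2 * v.1 + 2 * u.1 * u.2 * v.2)) u := by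
    refine ContinuousAt.prodMk ?_ (by fun_prop)
    exact ((continuousAt_snd.pow 2).inv₀ (pow_ne_zero 2 hu)).neg.mul continuousAt_const
  refine h.congr ?_
  filter_upwards [continuousAt_snd.eventually_ne hu] with u' hu'
  exact (fderiv_transition hu' v).symm

theorem toRes_transition {n : ℕ} (r : Fin n) {u : ℂ × ℂ} (hu : u.2 ≠ 0) :
    toRes n (r.castSucc, u) = toRes n (r.succ, transition u) :=
  Quot.sound ⟨r, u, hu, rfl, rfl⟩

/-- The compatibility of chart expressions extends by continuity from the torus. -/
theorem compat_of_torus {n m : ℕ} {ω : Charts n → Fin (m + 1) → ℂ} (r : Fin n) {u : ℂ × ℂ}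
    (hu : u.2 ≠ 0) (h1 : ∀ q, ContinuousAt (fun u => ω (r.castSucc, u) q) u)
    (h2 : ∀ q, ContinuousAt (fun u => ω (r.succ, u) q) (transition u))
    (H : ∀ᶠ u in 𝓝 u, u ∈ torus → ∀ t, logEval (ω (r.castSucc, u)) u t =
      logEval (ω (r.succ, transition u)) (transition u) (-t.2, t.1 + 2 * t.2)) (v : ℂ × ℂ) :
    evalForm (ω (r.castSucc, u)) v =
      evalForm (ω (r.succ, transition u)) (fderiv ℂ transition u v) := by
  refine eq_of_eventually_eq_torus (f := fun u => evalForm (ω (r.castSucc, u)) v)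
    (g := fun u => evalForm (ω (r.succ, transition u)) (fderiv ℂ transition u v))
    (continuousAt_evalForm h1 continuousAt_const)
    (continuousAt_evalForm (fun q => ContinuousAt.comp (f := transition) (h2 q)
      (continuousAt_transition hu)) (continuousAt_fderiv_transition hu v)) ?_
  filter_upwards [H] with u' hu' ht
  have := hu' ht (v.1 / u'.1, v.2 / u'.2)
  unfold logEval at this
  rw [← fderiv_transition_log ht.2] at this
  simpa only [mul_div_cancel₀ _ ht.1, mul_div_cancel₀ _ ht.2, mul_div_cancel_left₀ _ ht.1,
    mul_div_cancel_left₀ _ ht.2, Prod.mk.eta] using this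

/-- Gluing holds for every polynomial and weight, because f is common to all charts. The condition
`hW` only asks that no monomial with nonzero coefficient has a pole at a point of W. -/
theorem isSymDiff_monoForm {n m : ℕ} {w : ℤ × ℤ} {f : Polynomial ℂ} (hf : f.natDegree ≤ m)
    {W : Set (Resolution n)}
    (hW : ∀ (r : Fin (n + 1)) (q : Fin (m + 1)) (u : ℂ × ℂ), toRes n (r, u) ∈ W →
      chartCoeff m r f q ≠ 0 → (u.1 ≠ 0 ∨ 0 ≤ ord m w (r + 1) - (m - (q : ℕ) : ℤ)) ∧
        (u.2 ≠ 0 ∨ 0 ≤ ord m w r - (q : ℕ))) :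
    IsSymDiff n m W (monoForm n m w f) := by
  have hd : ∀ (r : Fin (n + 1)) (q : Fin (m + 1)) (u : ℂ × ℂ), toRes n (r, u) ∈ W →
      DifferentiableAt ℂ (fun u => monoForm n m w f (r, u) q) u := by
    intro r q u hu
    simp only [monoForm]
    by_cases hc : chartCoeff m r f q = 0
    · simp [hc]
    obtain ⟨h1, h2⟩ := hW r q u hu hc
    exact ((differentiableAt_fst.zpow h1).mul (differentiableAt_snd.zpow h2)).const_mul _
  refine ⟨fun r q u hu => (hd r q u hu).differentiableWithinAt, fun r u hu hm v => ?_⟩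
  refine compat_of_torus r hu (fun q => (hd _ q u hm).continuousAt)
    (fun q => (hd _ q _ (by rwa [← toRes_transition r hu])).continuousAt)
    (Eventually.of_forall fun u hu t => ?_) v
  rw [logEval_monoForm w f _ hu, logEval_monoForm w f _ (transition_mem_torus hu)]
  simp only [Fin.val_castSucc, Fin.val_succ]
  rw [evalForm_chartCoeff_succ _ hf, ← zpow_transition w r hu]

end AnSing

/-! ### Pull-back to the plane -/

namespace AnSing

theorem continuous_resolveChart (n : ℕ) (r : Fin (n + 1)) :
    Continuous fun u : ℂ × ℂ => resolveChart n (r, u) :=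
  Continuous.subtype_mk (by dsimp only; fun_prop) _

/-- The quotient map `ℂ² → X`. -/
def quotientMap (n : ℕ) (z : ℂ × ℂ) : Surface n :=
  ⟨(z.1 ^ (n + 1), z.1 * z.2, z.2 ^ (n + 1)), by simp [Surface, mul_pow]⟩

theorem continuous_quotientMap (n : ℕ) : Continuous (quotientMap n) :=
  Continuous.subtype_mk (by fun_prop) _

theorem quotientMap_zero (n : ℕ) : quotientMap n 0 = origin n := by
  simp [quotientMap, origin]

theorem quotientMap_ne_origin {n : ℕ} {z : ℂ × ℂ} (hz : z ≠ 0) : quotientMap n z ≠ origin n := by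
  intro h
  have h' := congrArg Subtype.val h
  simp only [quotientMap, origin, Prod.mk.injEq] at h'
  exact hz (Prod.ext (pow_eq_zero_iff (Nat.succ_ne_zero n) |>.1 h'.1)
    (pow_eq_zero_iff (Nat.succ_ne_zero n) |>.1 h'.2.2))

theorem pow_succ_mul_inv_pow {a : ℂ} (ha : a ≠ 0) (b : ℂ) (n : ℕ) :
    a ^ (n + 1) * ((a ^ n)⁻¹ * b) = a * b := by
  rw [pow_succ]
  field_simp

theorem pow_pow_mul_inv_pow {a : ℂ} (ha : a ≠ 0) (b : ℂ) (n : ℕ) :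
    (a ^ (n + 1)) ^ n * ((a ^ n)⁻¹ * b) ^ (n + 1) = b ^ (n + 1) := by
  rw [mul_pow, inv_pow, ← pow_mul, ← pow_mul, mul_comm n (n + 1), ← mul_assoc,
    mul_inv_cancel₀ (pow_ne_zero _ ha), one_mul]

/-- The lift of the quotient map to the `r`-th chart, on the torus. -/
noncomputable def chartPoint (n r : ℕ) (z : ℂ × ℂ) : ℂ × ℂ :=
  (z.1 ^ ((n : ℤ) + 1 - r) * z.2 ^ (-(r : ℤ)), z.1 ^ ((r : ℤ) - n) * z.2 ^ ((r : ℤ) + 1))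

theorem chartPoint_mem_torus {n r : ℕ} {z : ℂ × ℂ} (hz : z ∈ torus) : chartPoint n r z ∈ torus :=
  ⟨mul_ne_zero (zpow_ne_zero _ hz.1) (zpow_ne_zero _ hz.2),
    mul_ne_zero (zpow_ne_zero _ hz.1) (zpow_ne_zero _ hz.2)⟩

theorem transition_chartPoint {n r : ℕ} {z : ℂ × ℂ} (hz : z ∈ torus) :
    transition (chartPoint n r z) = chartPoint n (r + 1) z := by
  obtain ⟨h1, h2⟩ := hz
  simp only [transition, chartPoint]
  ext
  · simp only [mul_inv, ← zpow_neg]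
    congr 2 <;> push_cast <;> ring
  · simp only [mul_pow]
    simp only [← zpow_natCast, ← zpow_mul]
    rw [mul_mul_mul_comm, ← zpow_add₀ h1, ← zpow_add₀ h2]
    congr 2 <;> push_cast <;> ring

theorem resolveChart_chartPoint {n : ℕ} (r : Fin (n + 1)) {z : ℂ × ℂ} (hz : z ∈ torus) :
    resolveChart n (r, chartPoint n r z) = quotientMap n z := by
  induction r using Fin.induction with
  | zero =>
    obtain ⟨h1, h2⟩ := hz
    apply Subtype.ext
    simp only [resolveChart, quotientMap, chartPoint, Fin.val_zero, Nat.cast_zero, sub_zero,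
      neg_zero, zpow_zero, mul_one, zero_add, pow_one, pow_zero, zpow_one, Prod.mk.injEq,
      zero_sub, Nat.sub_zero]
    refine ⟨by norm_cast, ?_, ?_⟩
    · rw [← mul_assoc, ← zpow_add₀ h1]
      simp
    · rw [mul_pow, ← mul_assoc, ← zpow_natCast, ← zpow_natCast, ← zpow_mul, ← zpow_mul,
        ← zpow_add₀ h1]
      have : ((n : ℤ) + 1) * (n : ℤ) + -(n : ℤ) * ((n + 1 : ℕ) : ℤ) = 0 := by
        push_cast
        ring
      rw [this, zpow_zero, one_mul]
  | succ r ih =>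
    rw [← ih]
    refine (resolveChart_glue n _ _ ⟨r, chartPoint n (r.castSucc : ℕ) z,
      (chartPoint_mem_torus hz).2, rfl, ?_⟩).symm
    rw [transition_chartPoint hz]
    rfl

/-- The change of logarithmic coordinates under `chartPoint`. -/
def chartLog (n r : ℕ) (τ : ℂ × ℂ) : ℂ × ℂ :=
  ((n + 1) * τ.1 - r * (τ.1 + τ.2), (r + 1) * (τ.1 + τ.2) - (n + 1) * τ.1)

/-- All charts pull back to one form on the torus of ℂ²: by induction along the chain, `chartPoint`
and `chartLog` change from r to r + 1 exactly as the transition and its logarithmic derivative do.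
-/
theorem IsSymDiff.logEval_chartPoint {n m : ℕ} {V : Set (Surface n)}
    {ω : Charts n → Fin (m + 1) → ℂ} (h : IsSymDiff n m (resolve n ⁻¹' V \ exceptional n) ω)
    {z : ℂ × ℂ} (hz : z ∈ torus) (hV : quotientMap n z ∈ V) (r : Fin (n + 1)) (τ : ℂ × ℂ) :
    logEval (ω (r, chartPoint n r z)) (chartPoint n r z) (chartLog n r τ) =
      logEval (ω (0, chartPoint n 0 z)) (chartPoint n 0 z) (chartLog n 0 τ) := by
  induction r using Fin.induction with
  | zero => rfl
  | succ r ih =>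
    rw [← ih, h.logEval_succ r (chartPoint_mem_torus hz), transition_chartPoint hz]
    · simp only [Fin.val_castSucc, Fin.val_succ]
      congr 1
      simp only [chartLog]
      ext
      · push_cast; ring
      · push_cast; ring
    · have e : resolve n (toRes n (r.castSucc, chartPoint n (r.castSucc : ℕ) z)) =
          quotientMap n z := resolveChart_chartPoint r.castSucc hz
      refine ⟨?_, ?_⟩
      · rw [Set.mem_preimage, e]
        exact hV
      · intro h
        have h' : resolve n (toRes n (r.castSucc, chartPoint n (r.castSucc : ℕ) z)) = origin n := h
        rw [e] at h'
        exact quotientMap_ne_origin (fun h0 => hz.1 (by rw [h0]; rfl)) h'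

theorem chartPoint_zero {n : ℕ} (z : ℂ × ℂ) :
    chartPoint n 0 z = (z.1 ^ (n + 1), (z.1 ^ n)⁻¹ * z.2) := by
  simp only [chartPoint, Nat.cast_zero, sub_zero, neg_zero, zpow_zero, mul_one, zero_sub, zero_add,
    zpow_one, zpow_neg, zpow_natCast]
  norm_cast

theorem chartPoint_self {n : ℕ} (z : ℂ × ℂ) :
    chartPoint n n z = (z.1 * (z.2 ^ n)⁻¹, z.2 ^ (n + 1)) := by
  simp only [chartPoint, add_sub_cancel_left, sub_self, zpow_zero, one_mul, zpow_one, zpow_neg,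
    zpow_natCast]
  norm_cast

theorem differentiableAt_evalForm {m : ℕ} {c : ℂ × ℂ → Fin (m + 1) → ℂ} {v : ℂ × ℂ → ℂ × ℂ}
    {x : ℂ × ℂ} (hc : ∀ q, DifferentiableAt ℂ (fun x => c x q) x) (hv : DifferentiableAt ℂ v x) :
    DifferentiableAt ℂ (fun x => evalForm (c x) (v x)) x := by
  unfold evalForm
  refine DifferentiableAt.fun_sum fun q _ => ?_
  exact ((hc q).mul (hv.fst.pow _)).mul (hv.snd.pow _)

theorem IsSymDiff.differentiableAt {n m : ℕ} {V : Set (Surface n)} (hV : IsOpen V)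
    {ω : Charts n → Fin (m + 1) → ℂ} (h : IsSymDiff n m (resolve n ⁻¹' V \ exceptional n) ω)
    {r : Fin (n + 1)} {u : ℂ × ℂ} (hu : resolveChart n (r, u) ∈ V)
    (hu0 : resolveChart n (r, u) ≠ origin n) (q : Fin (m + 1)) :
    DifferentiableAt ℂ (fun u => ω (r, u) q) u := by
  refine (h.holo r q).differentiableAt ?_
  have hc := continuous_resolveChart n r
  exact ((hV.preimage hc).inter (isOpen_ne_fun hc continuous_const)).mem_nhds ⟨hu, hu0⟩

/-- The pull-back to the plane of a form off `E`, extended over the origin. -/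
theorem IsSymDiff.exists_pullback {n m : ℕ} {V : Set (Surface n)} (hV : IsOpen V)
    (hV0 : origin n ∈ V) {ω : Charts n → Fin (m + 1) → ℂ}
    (h : IsSymDiff n m (resolve n ⁻¹' V \ exceptional n) ω) :
    ∃ A : ℂ × ℂ → Fin (m + 1) → ℂ,
      (∀ q, ∀ᶠ z in 𝓝 (0 : ℂ × ℂ), DifferentiableAt ℂ (fun z => A z q) z) ∧
      ∀ᶠ z in 𝓝 (0 : ℂ × ℂ), z ∈ torus → ∀ (r : Fin (n + 1)) (τ : ℂ × ℂ),
        logEval (ω (r, chartPoint n r z)) (chartPoint n r z) (chartLog n r τ) =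
          logEval (A z) z τ := by
  classical
  -- Chart 0 gives the pull-back where z₁ ≠ 0 and chart n gives it where z₂ ≠ 0. Together they cover
  -- the punctured plane, so the two end charts suffice. The second arguments are du₁, du₂ expressed
  -- in dz₁, dz₂.
  set E₀ : ℂ × ℂ → ℂ × ℂ → ℂ := fun z w => evalForm (ω (0, (z.1 ^ (n + 1), (z.1 ^ n)⁻¹ * z.2)))
    (((n + 1) * z.1 ^ n) * w.1 + 0 * w.2,
      (-n * ((z.1 ^ n)⁻¹ * z.1⁻¹ * z.2)) * w.1 + (z.1 ^ n)⁻¹ * w.2) with hE₀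
  set E₁ : ℂ × ℂ → ℂ × ℂ → ℂ := fun z w =>
    evalForm (ω (Fin.last n, (z.1 * (z.2 ^ n)⁻¹, z.2 ^ (n + 1))))
      ((z.2 ^ n)⁻¹ * w.1 + (-n * ((z.2 ^ n)⁻¹ * z.2⁻¹ * z.1)) * w.2,
        0 * w.1 + ((n + 1) * z.2 ^ n) * w.2) with hE₁
  have e₀ : ∀ z ∈ torus, ∀ τ : ℂ × ℂ, E₀ z (z.1 * τ.1, z.2 * τ.2) =
      logEval (ω (0, chartPoint n 0 z)) (chartPoint n 0 z) (chartLog n 0 τ) := by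
    rintro z ⟨h1, h2⟩ τ
    simp only [hE₀, logEval, chartPoint_zero, chartLog]
    congr 2
    · push_cast
      ring
    · push_cast
      field_simp
      ring
  have e₁ : ∀ z ∈ torus, ∀ τ : ℂ × ℂ, E₁ z (z.1 * τ.1, z.2 * τ.2) =
      logEval (ω (Fin.last n, chartPoint n n z)) (chartPoint n n z) (chartLog n n τ) := by
    rintro z ⟨h1, h2⟩ τ
    simp only [hE₁, logEval, chartPoint_self, chartLog]
    congr 2
    · field_simp
      ring
    · ring
  have e₀₁ : ∀ z ∈ torus, quotientMap n z ∈ V → ∀ w, E₀ z w = E₁ z w := by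
    intro z hz hzV w
    have e := h.logEval_chartPoint hz hzV (Fin.last n) (w.1 / z.1, w.2 / z.2)
    simp only [Fin.val_last] at e
    rw [← e₀ z hz, ← e₁ z hz] at e
    simpa only [mul_div_cancel₀ _ hz.1, mul_div_cancel₀ _ hz.2, mul_div_cancel_left₀ _ hz.1,
      mul_div_cancel_left₀ _ hz.2, Prod.mk.eta] using e.symm
  have hqV : ∀ᶠ z in 𝓝 (0 : ℂ × ℂ), quotientMap n z ∈ V :=
    (continuous_quotientMap n).continuousAt.eventually_mem
      (hV.mem_nhds (by rwa [quotientMap_zero]))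
  -- The value at z = 0 is arbitrary; it is discarded by the Hartogs extension below.
  set E : ℂ × ℂ → ℂ × ℂ → ℂ := fun z w => if z.1 ≠ 0 then E₀ z w else E₁ z w with hE
  have hform : ∀ z, ∃ c : Fin (m + 1) → ℂ, ∀ w, evalForm c w = E z w := by
    intro z
    by_cases hz : z.1 ≠ 0
    · simp only [hE, if_pos hz]
      exact exists_linear_subst _ _ _ _ _
    · simp only [hE, if_neg hz]
      exact exists_linear_subst _ _ _ _ _
  set A : ℂ × ℂ → Fin (m + 1) → ℂ := fun z q =>
    ∑ k : Fin (m + 1), interp m q k * E z (1, ((k : ℕ) : ℂ)) with hA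
  have hAE : ∀ z w, evalForm (A z) w = E z w := by
    intro z w
    obtain ⟨c, hc⟩ := hform z
    have : A z = c := by
      funext q
      rw [coeff_eq_interp c q]
      simp only [hA, hc]
    rw [this, hc]
  have hEd : ∀ w, ∀ᶠ z in 𝓝 (0 : ℂ × ℂ), z ≠ 0 → DifferentiableAt ℂ (fun z => E z w) z := by
    intro w
    filter_upwards [hqV.eventually_nhds] with z hzV hz0
    by_cases h1 : z.1 ≠ 0
    · have hev : (fun z => E z w) =ᶠ[𝓝 z] fun z => E₀ z w := by
        filter_upwards [continuousAt_fst.eventually_ne h1] with z' hz'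
        simp only [hE, if_pos hz']
      refine DifferentiableAt.congr_of_eventuallyEq ?_ hev
      have hr : resolveChart n (0, (z.1 ^ (n + 1), (z.1 ^ n)⁻¹ * z.2)) = quotientMap n z := by
        apply Subtype.ext
        simp only [resolveChart, quotientMap, Fin.val_zero, zero_add, pow_one, pow_zero, mul_one,
          Nat.sub_zero, Prod.mk.injEq, true_and]
        exact ⟨pow_succ_mul_inv_pow h1 _ _, pow_pow_mul_inv_pow h1 _ _⟩
      refine differentiableAt_evalForm (fun q => ?_) ?_
      · refine (h.differentiableAt (r := 0) hV (by rw [hr]; exact hzV.self_of_nhds)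
          (by rw [hr]; exact quotientMap_ne_origin hz0) q).comp
            (f := fun z : ℂ × ℂ => (z.1 ^ (n + 1), (z.1 ^ n)⁻¹ * z.2)) z ?_
        exact (differentiableAt_fst.pow _).prodMk
          (((differentiableAt_fst.pow _).inv (pow_ne_zero _ h1)).mul differentiableAt_snd)
      · have i1 : DifferentiableAt ℂ (fun z : ℂ × ℂ => (z.1 ^ n)⁻¹) z :=
          (differentiableAt_fst.pow _).inv (pow_ne_zero _ h1)
        have i2 : DifferentiableAt ℂ (fun z : ℂ × ℂ => z.1⁻¹) z := differentiableAt_fst.inv h1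
        fun_prop
    · have h2 : z.2 ≠ 0 := fun h2 => hz0 (Prod.ext (not_not.1 h1) h2)
      have hev : (fun z => E z w) =ᶠ[𝓝 z] fun z => E₁ z w := by
        filter_upwards [continuousAt_snd.eventually_ne h2, hzV] with z' hz' hz'V
        by_cases h3 : z'.1 ≠ 0
        · simp only [hE, if_pos h3]
          exact e₀₁ z' ⟨h3, hz'⟩ hz'V w
        · simp only [hE, if_neg h3]
      refine DifferentiableAt.congr_of_eventuallyEq ?_ hev
      have hr : resolveChart n (Fin.last n, (z.1 * (z.2 ^ n)⁻¹, z.2 ^ (n + 1))) =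
          quotientMap n z := by
        apply Subtype.ext
        simp only [resolveChart, quotientMap, Fin.val_last, Nat.sub_self, pow_zero, one_mul,
          Nat.add_sub_cancel_left, pow_one, Prod.mk.injEq, and_true]
        constructor
        · rw [mul_comm z.1, mul_comm, pow_pow_mul_inv_pow h2]
        · rw [mul_comm z.1, mul_comm, pow_succ_mul_inv_pow h2, mul_comm]
      refine differentiableAt_evalForm (fun q => ?_) ?_
      · refine (h.differentiableAt (r := Fin.last n) hV (by rw [hr]; exact hzV.self_of_nhds)
          (by rw [hr]; exact quotientMap_ne_origin hz0) q).comp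
            (f := fun z : ℂ × ℂ => (z.1 * (z.2 ^ n)⁻¹, z.2 ^ (n + 1))) z ?_
        exact (differentiableAt_fst.mul ((differentiableAt_snd.pow _).inv
          (pow_ne_zero _ h2))).prodMk (differentiableAt_snd.pow _)
      · have i1 : DifferentiableAt ℂ (fun z : ℂ × ℂ => (z.2 ^ n)⁻¹) z :=
          (differentiableAt_snd.pow _).inv (pow_ne_zero _ h2)
        have i2 : DifferentiableAt ℂ (fun z : ℂ × ℂ => z.2⁻¹) z := differentiableAt_snd.inv h2
        fun_prop
  have hext : ∀ q, ∃ B : ℂ × ℂ → ℂ,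
      ∀ᶠ z in 𝓝 (0 : ℂ × ℂ), DifferentiableAt ℂ B z ∧ (z ≠ 0 → B z = A z q) := by
    intro q
    refine exists_extension_origin ?_
    have := eventually_all.2 fun k : Fin (m + 1) => hEd (1, ((k : ℕ) : ℂ))
    filter_upwards [this] with z hz hz0
    simp only [hA]
    exact DifferentiableAt.fun_sum fun k _ => (hz k hz0).const_mul _
  choose B hB using hext
  refine ⟨fun z q => B q z, fun q => (hB q).mono fun z hz => hz.1, ?_⟩
  filter_upwards [eventually_all.2 hB, hqV] with z hz hzV hzt r τ
  have hBA : (fun q => B q z) = A z := funext fun q =>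
    (hz q).2 fun h0 => hzt.1 (by rw [h0]; rfl)
  rw [hBA, h.logEval_chartPoint hzt hzV, ← e₀ z hzt]
  simp only [logEval, hAE, hE, if_pos hzt.1]

end AnSing

/-! ### Admissible weight components -/

namespace AnSing

/-- The polynomials whose form of weight `w` is holomorphic along the divisors in `s`. -/
noncomputable def admissible (m : ℕ) (w : ℤ × ℤ) (s : Finset ℕ) :
    Submodule ℂ (Polynomial ℂ) where
  carrier := {f | f.degree < (m + 1 : ℕ) ∧
    ∀ r ∈ s, (Polynomial.X - Polynomial.C (r : ℂ)) ^ (m - ord m w r).toNat ∣ f}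
  zero_mem' := ⟨by simp only [Polynomial.degree_zero]; exact WithBot.bot_lt_coe _,
    fun _ _ => dvd_zero _⟩
  add_mem' := fun hf hg => ⟨(Polynomial.degree_add_le _ _).trans_lt (max_lt hf.1 hg.1),
    fun r hr => dvd_add (hf.2 r hr) (hg.2 r hr)⟩
  smul_mem' := fun a f hf => ⟨(Polynomial.degree_smul_le _ _).trans_lt hf.1,
    fun r hr => by
      rw [Polynomial.smul_eq_C_mul]
      exact (hf.2 r hr).mul_left _⟩

theorem natDegree_le_of_mem_admissible {m : ℕ} {w : ℤ × ℤ} {s : Finset ℕ} {f : Polynomial ℂ}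
    (hf : f ∈ admissible m w s) : f.natDegree ≤ m :=
  Polynomial.natDegree_le_iff_coeff_eq_zero.2 fun N hN =>
    (Polynomial.degree_lt_iff_coeff_zero f (m + 1)).1 hf.1 N hN

theorem coeff_condition_right {m r : ℕ} {w : ℤ × ℤ} {s : Finset ℕ} {f : Polynomial ℂ}
    (hf : f ∈ admissible m w s) (hr : r + 1 ∈ s) {q : Fin (m + 1)}
    (hq : chartCoeff m r f q ≠ 0) : 0 ≤ ord m w (r + 1) - (m - (q : ℕ) : ℤ) := by
  by_contra hlt
  refine hq ((X_sub_pow_dvd_iff_right (natDegree_le_of_mem_admissible hf)).1 (hf.2 _ hr) q ?_)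
  omega

theorem coeff_condition_left {m r : ℕ} {w : ℤ × ℤ} {s : Finset ℕ} {f : Polynomial ℂ}
    (hf : f ∈ admissible m w s) (hr : r ∈ s) {q : Fin (m + 1)}
    (hq : chartCoeff m r f q ≠ 0) : 0 ≤ ord m w r - (q : ℕ) := by
  by_contra hlt
  refine hq ((X_sub_pow_dvd_iff_left (natDegree_le_of_mem_admissible hf)).1 (hf.2 _ hr) q ?_)
  have := q.2
  omega

theorem resolveChart_eq_origin_of_left {n : ℕ} {r : Fin (n + 1)} {u : ℂ × ℂ} (hu : u.1 = 0)
    (hr : (r : ℕ) < n) : resolveChart n (r, u) = origin n := by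
  apply Subtype.ext
  simp only [resolveChart, origin, hu]
  rw [zero_pow (by omega), zero_pow (by omega)]
  simp

theorem resolveChart_eq_origin_of_right {n : ℕ} {r : Fin (n + 1)} {u : ℂ × ℂ} (hu : u.2 = 0)
    (hr : 0 < (r : ℕ)) : resolveChart n (r, u) = origin n := by
  apply Subtype.ext
  simp only [resolveChart, origin, hu]
  have := r.2
  rw [zero_pow (by omega), zero_pow (by omega)]
  simp

/-- Every coordinate axis of a chart lies in E except {u₂ = 0} in chart 0 and {u₁ = 0} in chart n.
These are the divisors 0 and n + 1, so off E only their conditions matter. -/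
theorem isSymDiff_of_admissible_ends {n m : ℕ} {w : ℤ × ℤ} {f : Polynomial ℂ}
    (hf : f ∈ admissible m w {0, n + 1}) :
    IsSymDiff n m (resolve n ⁻¹' Set.univ \ exceptional n) (monoForm n m w f) := by
  refine isSymDiff_monoForm (natDegree_le_of_mem_admissible hf) fun r q u hu hq => ⟨?_, ?_⟩
  · by_contra! hc
    refine hu.2 (resolveChart_eq_origin_of_left hc.1 ?_)
    by_contra hr
    have hrn : (r : ℕ) = n := by have := r.2; omega
    exact absurd (coeff_condition_right hf (by simp [hrn]) hq) (not_le.2 hc.2)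
  · by_contra! hc
    refine hu.2 (resolveChart_eq_origin_of_right hc.1 ?_)
    by_contra hr
    have hrn : (r : ℕ) = 0 := by omega
    exact absurd (coeff_condition_left hf (by simp [hrn]) hq) (not_le.2 hc.2)

theorem isSymDiff_of_admissible {n m : ℕ} {w : ℤ × ℤ} {f : Polynomial ℂ}
    (hf : f ∈ admissible m w (Finset.range (n + 2))) :
    IsSymDiff n m (resolve n ⁻¹' Set.univ \ ∅) (monoForm n m w f) := by
  refine isSymDiff_monoForm (natDegree_le_of_mem_admissible hf) fun r q u hu hq => ⟨?_, ?_⟩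
  · exact Or.inr (coeff_condition_right hf (Finset.mem_range.2 (by have := r.2; omega)) hq)
  · exact Or.inr (coeff_condition_left hf (Finset.mem_range.2 (by have := r.2; omega)) hq)

/-- The span of the monomial forms that are holomorphic off `E`. -/
noncomputable def monoSpan (n m : ℕ) : Submodule ℂ (Charts n → Fin (m + 1) → ℂ) :=
  Submodule.span ℂ {θ | ∃ w, ∃ f ∈ admissible m w {0, n + 1}, θ = monoForm n m w f}

theorem isSymDiff_of_mem_monoSpan {n m : ℕ} {θ : Charts n → Fin (m + 1) → ℂ}
    (hθ : θ ∈ monoSpan n m) : IsSymDiff n m (resolve n ⁻¹' Set.univ \ exceptional n) θ := by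
  induction hθ using Submodule.span_induction with
  | mem x hx =>
    obtain ⟨w, f, hf, rfl⟩ := hx
    exact isSymDiff_of_admissible_ends hf
  | zero => exact IsSymDiff.zero _ _ _
  | add x y _ _ hx hy => exact hx.add hy
  | smul a x _ hx => exact hx.smul a

/-! ### Averaging over the cyclic group -/

/-- The action of the cyclic group of order `n + 1`. -/
noncomputable def rot (ζ : ℂ) (k : ℕ) (z : ℂ × ℂ) : ℂ × ℂ := (ζ ^ k * z.1, (ζ ^ k)⁻¹ * z.2)

theorem rot_mem_torus {ζ : ℂ} (hζ : ζ ≠ 0) (k : ℕ) {z : ℂ × ℂ} (hz : z ∈ torus) :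
    rot ζ k z ∈ torus :=
  ⟨mul_ne_zero (pow_ne_zero _ hζ) hz.1, mul_ne_zero (inv_ne_zero (pow_ne_zero _ hζ)) hz.2⟩

theorem norm_rot {ζ : ℂ} (hζ : ‖ζ‖ = 1) (k : ℕ) (z : ℂ × ℂ) : ‖rot ζ k z‖ = ‖z‖ := by
  simp [rot, Prod.norm_def, hζ]

theorem chartPoint_rot {n : ℕ} {ζ : ℂ} (hζ : ζ ^ (n + 1) = 1) (k r : ℕ) (z : ℂ × ℂ) :
    chartPoint n r (rot ζ k z) = chartPoint n r z := by
  have hζ0 : ζ ≠ 0 := by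
    rintro rfl
    simp at hζ
  have h1 : (ζ ^ k) ^ ((n : ℤ) + 1) = 1 := by
    have : ((n : ℤ) + 1) = ((n + 1 : ℕ) : ℤ) := by push_cast; ring
    rw [this, zpow_natCast, ← pow_mul, mul_comm, pow_mul, hζ, one_pow]
  have h0 : ζ ^ k ≠ 0 := pow_ne_zero _ hζ0
  set ξ := ζ ^ k
  have e1 : ξ ^ ((n : ℤ) + 1 - r) * ξ⁻¹ ^ (-(r : ℤ)) = 1 := by
    rw [inv_zpow', neg_neg, ← zpow_add₀ h0, sub_add_cancel, h1]
  have e2 : ξ ^ ((r : ℤ) - n) * ξ⁻¹ ^ ((r : ℤ) + 1) = 1 := by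
    rw [inv_zpow', ← zpow_add₀ h0, show (r : ℤ) - n + -((r : ℤ) + 1) = -((n : ℤ) + 1) by ring,
      zpow_neg, h1, inv_one]
  simp only [chartPoint, rot, mul_zpow]
  ext
  · change ξ ^ _ * _ * (ξ⁻¹ ^ _ * _) = _
    rw [mul_mul_mul_comm, e1, one_mul]
  · change ξ ^ _ * _ * (ξ⁻¹ ^ _ * _) = _
    rw [mul_mul_mul_comm, e2, one_mul]

/-- Orthogonality of characters: averaging keeps the invariant monomials and kills the others. -/
theorem sum_pow_mul_inv_pow {n : ℕ} {ζ : ℂ} (hζ : IsPrimitiveRoot ζ (n + 1)) (a b : ℕ) :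
    ∑ k ∈ Finset.range (n + 1), (ζ ^ k) ^ a * ((ζ ^ k)⁻¹) ^ b =
      if ((n + 1 : ℕ) : ℤ) ∣ (a : ℤ) - b then ((n : ℂ) + 1) else 0 := by
  have hζ0 : ζ ≠ 0 := hζ.ne_zero (Nat.succ_ne_zero n)
  have e : ∀ k ∈ Finset.range (n + 1),
      (ζ ^ k) ^ a * ((ζ ^ k)⁻¹) ^ b = (ζ ^ ((a : ℤ) - b)) ^ k := by
    intro k _
    rw [zpow_sub₀ hζ0, zpow_natCast, zpow_natCast, div_pow, inv_pow, ← pow_mul, ← pow_mul,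
      ← pow_mul, ← pow_mul, mul_comm k a, mul_comm k b, div_eq_mul_inv]
  rw [Finset.sum_congr rfl e]
  split_ifs with h
  · rw [(hζ.zpow_eq_one_iff_dvd _).2 h]
    simp
  · have h1 : ζ ^ ((a : ℤ) - b) ≠ 1 := fun h1 => h ((hζ.zpow_eq_one_iff_dvd _).1 h1)
    rw [geom_sum_eq h1, ← zpow_natCast, ← zpow_mul, mul_comm, zpow_mul, zpow_natCast,
      hζ.pow_eq_one, one_zpow, sub_self, zero_div]

/-- The polynomial of the logarithmic monomial `τ₁ ^ (m - q) * τ₂ ^ q` on the plane. -/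
noncomputable def logMonomial (n m q : ℕ) : Polynomial ℂ :=
  (Polynomial.C ((n : ℂ) + 1)⁻¹) ^ m * (Polynomial.X ^ (m - q) *
    (Polynomial.C ((n : ℂ) + 1) - Polynomial.X) ^ q)

theorem natDegree_logMonomial {n m q : ℕ} (hq : q ≤ m) : (logMonomial n m q).natDegree ≤ m := by
  unfold logMonomial
  refine (Polynomial.natDegree_mul_le).trans ?_
  rw [← Polynomial.C_pow, Polynomial.natDegree_C, zero_add]
  refine (Polynomial.natDegree_mul_le).trans ?_
  have h1 : (Polynomial.X ^ (m - q) : Polynomial ℂ).natDegree ≤ m - q := by simp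
  have h2 : ((Polynomial.C ((n : ℂ) + 1) - Polynomial.X) ^ q).natDegree ≤ q := by
    refine Polynomial.natDegree_pow_le_of_le q (m := 1) ?_ |>.trans (by simp)
    refine (Polynomial.natDegree_sub_le _ _).trans ?_
    rw [Polynomial.natDegree_C, Polynomial.natDegree_X]
    simp
  omega

/-- Under `chartLog` the affine coordinate becomes (n + 1)τ₁/(τ₁ + τ₂), the same for every r. The
factor (n + 1)⁻ᵐ in `logMonomial` compensates the scaling by n + 1. -/
theorem evalForm_logMonomial {n m q : ℕ} (hq : q ≤ m) (r : ℕ) (τ : ℂ × ℂ) :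
    evalForm (chartCoeff m r (logMonomial n m q)) (chartLog n r τ) = τ.1 ^ (m - q) * τ.2 ^ q := by
  refine eq_of_eq_of_sum_ne_zero
    (F := fun τ => evalForm (chartCoeff m r (logMonomial n m q)) (chartLog n r τ))
    (G := fun τ => τ.1 ^ (m - q) * τ.2 ^ q) ((continuous_evalForm _).comp
    (f := chartLog n r) (by unfold chartLog; fun_prop)) (by fun_prop) (fun τ hτ => ?_) τ
  have e : (chartLog n r τ).1 + (chartLog n r τ).2 = τ.1 + τ.2 := by
    simp only [chartLog]
    ring
  have e2 : (chartLog n r τ).1 + r * (τ.1 + τ.2) = (n + 1) * τ.1 := by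
    simp only [chartLog]
    ring
  have hn : (n : ℂ) + 1 ≠ 0 := Nat.cast_add_one_ne_zero n
  rw [evalForm_chartCoeff r (natDegree_logMonomial hq) (by rwa [e]), e, e2]
  simp only [logMonomial, Polynomial.eval_mul, Polynomial.eval_pow, Polynomial.eval_C,
    Polynomial.eval_X, Polynomial.eval_sub]
  have e3 : (n : ℂ) + 1 - (n + 1) * τ.1 / (τ.1 + τ.2) = (n + 1) * (τ.2 / (τ.1 + τ.2)) := by
    field_simp
    ring
  rw [e3, mul_div_assoc, mul_pow, mul_pow, div_pow, div_pow]
  obtain ⟨j, rfl⟩ := Nat.exists_eq_add_of_le hq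
  rw [Nat.add_sub_cancel_left, pow_add, pow_add, inv_pow, inv_pow]
  field_simp

theorem logMonomial_mem_admissible {n m q : ℕ} (hq : q ≤ m) {w : ℤ × ℤ} {i j : ℕ}
    (h0 : ord m w 0 = j + q) (h1 : ord m w (n + 1) = (i + (m - q) : ℕ)) :
    logMonomial n m q ∈ admissible m w {0, n + 1} := by
  refine ⟨Polynomial.degree_le_natDegree.trans_lt (by
    exact_mod_cast Nat.lt_succ_of_le (natDegree_logMonomial hq)), fun r hr => ?_⟩
  simp only [Finset.mem_insert, Finset.mem_singleton] at hr
  refine Dvd.dvd.mul_left ?_ _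
  rcases hr with rfl | rfl
  · refine Dvd.dvd.mul_right ?_ _
    rw [h0, Nat.cast_zero, Polynomial.C_0, sub_zero]
    exact pow_dvd_pow _ (by omega)
  · refine Dvd.dvd.mul_left ?_ _
    rw [h1, ← neg_sub Polynomial.X (Polynomial.C ((n : ℂ) + 1)), neg_pow]
    refine Dvd.dvd.mul_left ?_ _
    push_cast
    exact pow_dvd_pow _ (by omega)

theorem zpow_chartPoint {n m : ℕ} {w : ℤ × ℤ} (r : ℕ) {z : ℂ × ℂ} (hz : z ∈ torus) :
    (chartPoint n r z).1 ^ ord m w (r + 1) * (chartPoint n r z).2 ^ ord m w r =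
      z.1 ^ ord m w (n + 1) * z.2 ^ ord m w 0 := by
  simp only [chartPoint, mul_zpow, ← zpow_mul]
  rw [mul_mul_mul_comm, ← zpow_add₀ hz.1, ← zpow_add₀ hz.2]
  congr 2 <;> simp only [ord] <;> push_cast <;> ring

/-- A monomial form zⁱzʲ dz₁^(m-q) dz₂^q is an eigenvector of the cyclic group. Its average is
itself, when it descends to a monomial form of some weight, or zero. -/
theorem exists_average {n m : ℕ} {ζ : ℂ} (hζ : IsPrimitiveRoot ζ (n + 1)) {q : ℕ} (hq : q ≤ m)
    {P : ℂ × ℂ → ℂ} (hP : P ∈ polyFun) :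
    ∃ θ ∈ monoSpan n m, ∀ z ∈ torus, ∀ (r : Fin (n + 1)) (τ : ℂ × ℂ),
      logEval (θ (r, chartPoint n r z)) (chartPoint n r z) (chartLog n r τ) =
        ((n : ℂ) + 1)⁻¹ * ∑ k ∈ Finset.range (n + 1), P (rot ζ k z) *
          ((rot ζ k z).1 * τ.1) ^ (m - q) * ((rot ζ k z).2 * τ.2) ^ q := by
  have hn : (n : ℂ) + 1 ≠ 0 := Nat.cast_add_one_ne_zero n
  induction hP using Submodule.span_induction with
  | zero =>
    exact ⟨0, Submodule.zero_mem _, fun z _ r τ => by simp [logEval, evalForm]⟩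
  | add x y _ _ hx hy =>
    obtain ⟨θ, hθ, h1⟩ := hx
    obtain ⟨θ', hθ', h2⟩ := hy
    refine ⟨θ + θ', Submodule.add_mem _ hθ hθ', fun z hz r τ => ?_⟩
    have e := congrArg₂ (· + ·) (h1 z hz r τ) (h2 z hz r τ)
    rw [← mul_add, ← Finset.sum_add_distrib] at e
    simp only [Pi.add_apply, add_mul]
    rw [← e]
    exact evalForm_add _ _ _
  | smul a x _ hx =>
    obtain ⟨θ, hθ, h1⟩ := hx
    refine ⟨a • θ, Submodule.smul_mem _ _ hθ, fun z hz r τ => ?_⟩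
    have e := congrArg (a * ·) (h1 z hz r τ)
    rw [mul_left_comm, Finset.mul_sum] at e
    simp only [Pi.smul_apply, smul_eq_mul, mul_assoc] at e ⊢
    rw [← e]
    exact evalForm_smul _ _ _
  | mem x hx =>
    obtain ⟨⟨i, j⟩, rfl⟩ := hx
    have hsum : ∀ z τ : ℂ × ℂ, ∑ k ∈ Finset.range (n + 1),
        (rot ζ k z).1 ^ i * (rot ζ k z).2 ^ j *
          ((rot ζ k z).1 * τ.1) ^ (m - q) * ((rot ζ k z).2 * τ.2) ^ q =
        (if ((n + 1 : ℕ) : ℤ) ∣ ((i + (m - q) : ℕ) : ℤ) - (j + q : ℕ) then ((n : ℂ) + 1) else 0) *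
          (z.1 ^ (i + (m - q)) * z.2 ^ (j + q) * (τ.1 ^ (m - q) * τ.2 ^ q)) := by
      intro z τ
      rw [← sum_pow_mul_inv_pow hζ, Finset.sum_mul]
      refine Finset.sum_congr rfl fun k _ => ?_
      simp only [rot]
      ring
    by_cases hdvd : ((n + 1 : ℕ) : ℤ) ∣ ((i + (m - q) : ℕ) : ℤ) - (j + q : ℕ)
    · obtain ⟨d, hd⟩ := hdvd
      -- The weight is forced by the two logarithmic exponents: they must equal `ord m w 0` and `ord
      -- m w (n + 1)`, whose difference is a multiple of n + 1.
      set w : ℤ × ℤ := ((j : ℤ) + q - m, -d) with hw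
      have h0 : ord m w 0 = j + q := by
        simp only [ord, hw]
        push_cast
        ring
      have h1 : ord m w (n + 1) = (i + (m - q) : ℕ) := by
        rw [sub_eq_iff_eq_add.1 hd]
        simp only [ord, hw]
        push_cast
        ring
      refine ⟨monoForm n m w (logMonomial n m q), Submodule.subset_span
        ⟨w, _, logMonomial_mem_admissible hq h0 h1, rfl⟩, fun z hz r τ => ?_⟩
      rw [logEval_monoForm _ _ _ (chartPoint_mem_torus hz), zpow_chartPoint _ hz,
        evalForm_logMonomial hq]
      simp only
      rw [hsum, if_pos ⟨d, hd⟩, inv_mul_cancel_left₀ hn, h0, h1, zpow_natCast]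
      norm_cast
    · refine ⟨0, Submodule.zero_mem _, fun z _ r τ => ?_⟩
      simp only
      rw [hsum, if_neg hdvd]
      simp [logEval, evalForm]

/-! ### Approximation of forms off E by monomial forms -/

theorem norm_logEval_le {m : ℕ} {c : Fin (m + 1) → ℂ} {B : ℝ} (hc : ∀ q, ‖c q‖ ≤ B)
    (z τ : ℂ × ℂ) : ‖logEval c z τ‖ ≤ (m + 1) * B * (‖z‖ * ‖τ‖) ^ m := by
  have hB : 0 ≤ B := (norm_nonneg _).trans (hc 0)
  have h1 : ‖z.1 * τ.1‖ ≤ ‖z‖ * ‖τ‖ := by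
    rw [norm_mul]
    exact mul_le_mul (norm_fst_le z) (norm_fst_le τ) (norm_nonneg _) (norm_nonneg _)
  have h2 : ‖z.2 * τ.2‖ ≤ ‖z‖ * ‖τ‖ := by
    rw [norm_mul]
    exact mul_le_mul (norm_snd_le z) (norm_snd_le τ) (norm_nonneg _) (norm_nonneg _)
  unfold logEval evalForm
  refine (norm_sum_le _ _).trans ?_
  calc _ ≤ ∑ _q : Fin (m + 1), B * (‖z‖ * ‖τ‖) ^ m := by
        refine Finset.sum_le_sum fun q _ => ?_
        have hq : m - (q : ℕ) + q = m := by
          have := q.2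
          omega
        conv_rhs => rw [← hq, pow_add, ← mul_assoc]
        simp only [norm_mul (_ * _) _, norm_mul (c q), norm_pow]
        have := hc q
        gcongr
    _ = _ := by
        rw [Finset.sum_const, Finset.card_univ, Fintype.card_fin, nsmul_eq_mul]
        push_cast
        ring

/-- The pull-back is invariant under the group, hence equal to its own average, so ω - θ is the
average of the Taylor remainders. The extra m in the exponent comes from dz₁ = z₁τ₁, dz₂ = z₂τ₂. -/
theorem exists_remainder_bound {n m : ℕ} {V : Set (Surface n)} (hV : IsOpen V)
    (hV0 : origin n ∈ V) {ω : Charts n → Fin (m + 1) → ℂ}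
    (h : IsSymDiff n m (resolve n ⁻¹' V \ exceptional n) ω) (N : ℕ) :
    ∃ θ ∈ monoSpan n m, ∃ C : ℝ, 0 ≤ C ∧ ∀ᶠ z in 𝓝 (0 : ℂ × ℂ), z ∈ torus →
      ∀ (r : Fin (n + 1)) (τ : ℂ × ℂ),
        ‖logEval ((ω - θ) (r, chartPoint n r z)) (chartPoint n r z) (chartLog n r τ)‖ ≤
          C * ‖z‖ ^ (N + m) * ‖τ‖ ^ m := by
  obtain ⟨A, hA, hAω⟩ := h.exists_pullback hV hV0
  choose T hT hTA using fun q => exists_taylor N (hA q)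
  choose C hC using fun q => (hTA q).bound
  set ζ := Complex.exp (2 * Real.pi * Complex.I / ((n + 1 : ℕ) : ℂ)) with hζd
  have hζ : IsPrimitiveRoot ζ (n + 1) := Complex.isPrimitiveRoot_exp _ (Nat.succ_ne_zero n)
  have hζ1 : ‖ζ‖ = 1 := hζ.norm'_eq_one (Nat.succ_ne_zero n)
  have hζ0 : ζ ≠ 0 := hζ.ne_zero (Nat.succ_ne_zero n)
  have hn : (n : ℂ) + 1 ≠ 0 := Nat.cast_add_one_ne_zero n
  choose θ hθ hθT using fun q : Fin (m + 1) =>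
    exists_average hζ (Nat.lt_succ_iff.1 q.2) (hT q)
  set B : ℝ := ∑ q, |C q| with hB
  -- The group preserves the norm, hence every ball around 0, so one neighbourhood serves all
  -- rotations.
  have hrot : ∀ {p : ℂ × ℂ → Prop}, (∀ᶠ z in 𝓝 (0 : ℂ × ℂ), p z) →
      ∀ᶠ z in 𝓝 (0 : ℂ × ℂ), ∀ k, p (rot ζ k z) := by
    intro p hp
    obtain ⟨ε, hε, hb⟩ := Metric.eventually_nhds_iff_ball.1 hp
    refine Metric.eventually_nhds_iff_ball.2 ⟨ε, hε, fun z hz k => hb _ ?_⟩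
    rw [mem_ball_zero_iff] at hz ⊢
    rwa [norm_rot hζ1]
  refine ⟨∑ q, θ q, Submodule.sum_mem _ fun q _ => hθ q, (m + 1) * B, by positivity, ?_⟩
  filter_upwards [hrot hAω, hrot (eventually_all.2 hC)] with z hz1 hz2 hz r τ
  have key : logEval ((ω - ∑ q, θ q) (r, chartPoint n r z)) (chartPoint n r z) (chartLog n r τ) =
      ((n : ℂ) + 1)⁻¹ * ∑ k ∈ Finset.range (n + 1),
        logEval (fun q => A (rot ζ k z) q - T q (rot ζ k z)) (rot ζ k z) τ := by
    have e1 : ∀ k ∈ Finset.range (n + 1), logEval (A (rot ζ k z)) (rot ζ k z) τ =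
        logEval (ω (r, chartPoint n r z)) (chartPoint n r z) (chartLog n r τ) := by
      intro k _
      rw [← hz1 k (rot_mem_torus hζ0 k hz), chartPoint_rot hζ.pow_eq_one]
    have e2 : logEval ((∑ q, θ q) (r, chartPoint n r z)) (chartPoint n r z) (chartLog n r τ) =
        ((n : ℂ) + 1)⁻¹ * ∑ k ∈ Finset.range (n + 1),
          logEval (fun q => T q (rot ζ k z)) (rot ζ k z) τ := by
      have : (∑ q, θ q) (r, chartPoint n r z) =
          fun q' => ∑ q, θ q (r, chartPoint n r z) q' := by
        funext q'
        simp
      have e : logEval ((∑ q, θ q) (r, chartPoint n r z)) (chartPoint n r z) (chartLog n r τ) =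
          ∑ q, logEval (θ q (r, chartPoint n r z)) (chartPoint n r z) (chartLog n r τ) := by
        rw [this]
        exact evalForm_sum _ _ _
      rw [e, Finset.sum_congr rfl fun q _ => hθT q z hz r τ, ← Finset.mul_sum, Finset.sum_comm]
      rfl
    have e3 : logEval ((ω - ∑ q, θ q) (r, chartPoint n r z)) (chartPoint n r z)
        (chartLog n r τ) =
        logEval (ω (r, chartPoint n r z)) (chartPoint n r z) (chartLog n r τ) -
        logEval ((∑ q, θ q) (r, chartPoint n r z)) (chartPoint n r z) (chartLog n r τ) :=
      evalForm_sub _ _ _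
    have e4 : ∀ k, logEval (fun q => A (rot ζ k z) q - T q (rot ζ k z)) (rot ζ k z) τ =
        logEval (A (rot ζ k z)) (rot ζ k z) τ -
          logEval (fun q => T q (rot ζ k z)) (rot ζ k z) τ := fun k => evalForm_sub _ _ _
    simp only [e4]
    rw [e3, e2, Finset.sum_sub_distrib, Finset.sum_congr rfl e1, Finset.sum_const,
      Finset.card_range, nsmul_eq_mul, mul_sub]
    push_cast
    rw [inv_mul_cancel_left₀ hn]
  have hbound : ∀ k, ‖logEval (fun q => A (rot ζ k z) q - T q (rot ζ k z)) (rot ζ k z) τ‖ ≤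
      (m + 1) * B * ‖z‖ ^ (N + m) * ‖τ‖ ^ m := by
    intro k
    refine (norm_logEval_le (B := B * ‖z‖ ^ N) (fun q => ?_) _ _).trans (le_of_eq ?_)
    · refine (hz2 k q).trans ?_
      rw [norm_pow, norm_norm, norm_rot hζ1]
      gcongr
      exact (le_abs_self _).trans
        (Finset.single_le_sum (f := fun q => |C q|) (fun _ _ => abs_nonneg _) (Finset.mem_univ q))
    · rw [norm_rot hζ1, pow_add, mul_pow]
      ring
  rw [key, norm_mul, norm_inv]
  have hn' : ‖(n : ℂ) + 1‖ = (n : ℝ) + 1 := by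
    have := Complex.norm_natCast (n + 1)
    push_cast at this
    exact this
  rw [hn', inv_mul_le_iff₀ (by positivity)]
  refine (norm_sum_le _ _).trans ((Finset.sum_le_sum fun k _ => hbound k).trans (le_of_eq ?_))
  rw [Finset.sum_const, Finset.card_range, nsmul_eq_mul]
  push_cast
  ring

end AnSing

/-! ### Decomposition of forms off the exceptional locus -/

namespace AnSing

theorem exists_chartPoint_eq {n : ℕ} (r : Fin (n + 1)) {u : ℂ × ℂ} (hu : u ∈ torus) :
    ∃ z ∈ torus, chartPoint n r z = u := by
  obtain ⟨u₁, u₂⟩ := u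
  obtain ⟨h1, h2⟩ := hu
  simp only at h1 h2
  obtain ⟨z, hz⟩ := IsAlgClosed.exists_pow_nat_eq (u₁ ^ ((r : ℕ) + 1) * u₂ ^ (r : ℕ))
    (Nat.succ_pos n)
  have hz0 : z ≠ 0 := by
    rintro rfl
    rw [zero_pow (Nat.succ_ne_zero n)] at hz
    exact mul_ne_zero (pow_ne_zero _ h1) (pow_ne_zero _ h2) hz.symm
  have hz' : z ^ ((n : ℤ) + 1) = u₁ ^ ((r : ℤ) + 1) * u₂ ^ (r : ℤ) := by
    have : z ^ ((n + 1 : ℕ) : ℤ) = u₁ ^ (((r : ℕ) + 1 : ℕ) : ℤ) * u₂ ^ ((r : ℕ) : ℤ) := by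
      simpa only [zpow_natCast] using hz
    simpa using this
  refine ⟨(z, u₁ * u₂ / z), ⟨hz0, div_ne_zero (mul_ne_zero h1 h2) hz0⟩, ?_⟩
  simp only [chartPoint]
  ext
  · simp only
    rw [div_zpow, zpow_neg z, div_inv_eq_mul, mul_comm (_ ^ _) (z ^ (r : ℤ)), ← mul_assoc,
      ← zpow_add₀ hz0, sub_add_cancel, hz', mul_zpow, mul_mul_mul_comm, ← zpow_add₀ h1,
      ← zpow_add₀ h2]
    rw [show (r : ℤ) + 1 + -(r : ℤ) = 1 by ring, add_neg_cancel, zpow_one, zpow_zero, mul_one]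
  · simp only
    rw [div_zpow, mul_div_assoc', mul_comm, mul_div_assoc, ← zpow_sub₀ hz0,
      show (r : ℤ) - n - ((r : ℤ) + 1) = -((n : ℤ) + 1) by ring, zpow_neg, hz', mul_zpow, mul_inv,
      ← zpow_neg, ← zpow_neg, mul_mul_mul_comm, ← zpow_add₀ h1, ← zpow_add₀ h2]
    rw [show (r : ℤ) + 1 + -(r : ℤ) = 1 by ring, add_neg_cancel, zpow_one, zpow_zero, one_mul]

/-- `chartLog` preserves the sum of the coordinates, which determines τ₁ = ((r + 1)t₁ + rt₂)/(n +
1). The bound is crude but independent of the point. -/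
theorem exists_chartLog_eq (n r : ℕ) (t : ℂ × ℂ) :
    ∃ τ : ℂ × ℂ, chartLog n r τ = t ∧ ‖τ‖ ≤ (2 * r + 3) * ‖t‖ := by
  have hn : (n : ℂ) + 1 ≠ 0 := Nat.cast_add_one_ne_zero n
  set σ : ℂ := ((n : ℂ) + 1)⁻¹ * ((r + 1) * t.1 + r * t.2) with hσ
  have h1 := norm_fst_le t
  have h2 := norm_snd_le t
  have hi : ‖((n : ℂ) + 1)⁻¹‖ ≤ 1 := by
    rw [norm_inv]
    refine inv_le_one_of_one_le₀ ?_
    have := Complex.norm_natCast (n + 1)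
    push_cast at this
    rw [this]
    simp
  have hr1 : ‖(r : ℂ) + 1‖ = r + 1 := by
    have := Complex.norm_natCast (r + 1)
    push_cast at this
    exact this
  have hσb : ‖σ‖ ≤ (2 * r + 1) * ‖t‖ := by
    rw [hσ, norm_mul]
    calc _ ≤ 1 * (((r : ℝ) + 1) * ‖t‖ + r * ‖t‖) := by
          gcongr
          refine (norm_add_le _ _).trans ?_
          rw [norm_mul, norm_mul, hr1, Complex.norm_natCast]
          gcongr
      _ = _ := by ring
  refine ⟨(σ, t.1 + t.2 - σ), ?_, ?_⟩
  · simp only [chartLog, hσ]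
    ext
    · simp only
      field_simp
      ring
    · simp only
      field_simp
      ring
  · rw [Prod.norm_def]
    refine max_le ?_ ?_
    · refine hσb.trans ?_
      gcongr
      norm_num
    · calc ‖t.1 + t.2 - σ‖ ≤ ‖t.1 + t.2‖ + ‖σ‖ := norm_sub_le _ _
        _ ≤ (‖t.1‖ + ‖t.2‖) + ‖σ‖ := by gcongr; exact norm_add_le _ _
        _ ≤ (‖t‖ + ‖t‖) + (2 * r + 1) * ‖t‖ := by gcongr
        _ = _ := by ring

/-- Boundedness of the product of a power of the distance to the singular point with the
logarithmic poles, near a point of the exceptional locus off the crossings. -/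
theorem eventually_order_bound {n : ℕ} (r : Fin (n + 1)) {p : ℂ × ℂ}
    (h1 : p.1 ≠ 0 ∨ (r : ℕ) < n) (h2 : p.2 ≠ 0 ∨ 0 < (r : ℕ)) :
    ∃ K : ℝ, 0 ≤ K ∧ ∀ᶠ u : ℂ × ℂ in 𝓝 p, u ∈ torus →
      (‖u.1‖ ^ ((r : ℕ) + 1) * ‖u.2‖ ^ (r : ℕ) + ‖u.1‖ ^ (n - r) * ‖u.2‖ ^ (n + 1 - r)) *
        (‖u.1‖⁻¹ + ‖u.2‖⁻¹) ≤ K := by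
  have hr := r.2
  -- The expanded product. Only the integer exponents r - 1 and n - r - 1 can be negative, exactly
  -- when r = 0 or r = n, and there `h2` or `h1` keeps the base away from zero.
  set G : ℂ × ℂ → ℝ := fun u => ‖u.1‖ ^ (r : ℕ) * ‖u.2‖ ^ (r : ℕ) +
    ‖u.1‖ ^ ((r : ℕ) + 1) * ‖u.2‖ ^ ((r : ℤ) - 1) +
    (‖u.1‖ ^ ((n : ℤ) - r - 1) * ‖u.2‖ ^ (n + 1 - r) + ‖u.1‖ ^ (n - r) * ‖u.2‖ ^ (n - r)) with hG
  have hc : ContinuousAt G p := by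
    have c1 : ContinuousAt (fun u : ℂ × ℂ => ‖u.1‖) p := continuousAt_fst.norm
    have c2 : ContinuousAt (fun u : ℂ × ℂ => ‖u.2‖) p := continuousAt_snd.norm
    have z1 : ContinuousAt (fun u : ℂ × ℂ => ‖u.1‖ ^ ((n : ℤ) - r - 1)) p :=
      c1.zpow₀ _ (h1.imp norm_ne_zero_iff.2 (by omega))
    have z2 : ContinuousAt (fun u : ℂ × ℂ => ‖u.2‖ ^ ((r : ℤ) - 1)) p :=
      c2.zpow₀ _ (h2.imp norm_ne_zero_iff.2 (by omega))
    exact (((c1.pow _).mul (c2.pow _)).add ((c1.pow _).mul z2)).add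
      ((z1.mul (c2.pow _)).add ((c1.pow _).mul (c2.pow _)))
  refine ⟨|G p| + 1, by positivity, ?_⟩
  filter_upwards [hc.eventually_lt_const (show G p < |G p| + 1 by
    linarith [le_abs_self (G p)])] with u hu ht
  refine le_trans (le_of_eq ?_) hu.le
  have n1 : ‖u.1‖ ≠ 0 := norm_ne_zero_iff.2 ht.1
  have n2 : ‖u.2‖ ≠ 0 := norm_ne_zero_iff.2 ht.2
  have e1 : ‖u.2‖ ^ ((r : ℤ) - 1) = ‖u.2‖ ^ (r : ℕ) * ‖u.2‖⁻¹ := by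
    rw [zpow_sub_one₀ n2, zpow_natCast]
  have e2 : ‖u.1‖ ^ ((n : ℤ) - r - 1) = ‖u.1‖ ^ (n - r) * ‖u.1‖⁻¹ := by
    rw [zpow_sub_one₀ n1, ← zpow_natCast ‖u.1‖ (n - r), Nat.cast_sub (by omega)]
  have e3 : n + 1 - (r : ℕ) = n - r + 1 := by omega
  simp only [hG, e1, e2, e3]
  field_simp
  ring

/-- The estimate for the remainder, in the coordinates of a chart. -/
theorem eventually_norm_coeff_le {n m : ℕ} {V : Set (Surface n)} {η : Charts n → Fin (m + 1) → ℂ}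
    {C : ℝ} (hC : 0 ≤ C)
    (hη : ∀ z ∈ torus, quotientMap n z ∈ V → ∀ (r : Fin (n + 1)) (τ : ℂ × ℂ),
      ‖logEval (η (r, chartPoint n r z)) (chartPoint n r z) (chartLog n r τ)‖ ≤
        C * ‖z‖ ^ (n * m + m) * ‖τ‖ ^ m)
    (r : Fin (n + 1)) {p : ℂ × ℂ} (hp : ∀ᶠ u in 𝓝 p, resolveChart n (r, u) ∈ V)
    (h1 : p.1 ≠ 0 ∨ (r : ℕ) < n) (h2 : p.2 ≠ 0 ∨ 0 < (r : ℕ)) (q : Fin (m + 1)) :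
    ∃ K : ℝ, ∀ᶠ u in 𝓝 p, u ∈ torus → ‖η (r, u) q‖ ≤ K := by
  obtain ⟨K, hK0, hK⟩ := eventually_order_bound r h1 h2
  refine ⟨∑ k : Fin (m + 1), ‖interp m q k‖ * (C * ((2 * r + 3) * (m + 1) * K) ^ m), ?_⟩
  filter_upwards [hp, hK] with u huV huK ht
  obtain ⟨z, hz, rfl⟩ := exists_chartPoint_eq r ht
  set u := chartPoint n r z with hu
  have hq : resolveChart n (r, u) = quotientMap n z := resolveChart_chartPoint r hz
  rw [coeff_eq_interp (η (r, u)) q]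
  refine (norm_sum_le _ _).trans (Finset.sum_le_sum fun k _ => ?_)
  rw [norm_mul]
  refine mul_le_mul_of_nonneg_left ?_ (norm_nonneg _)
  -- The tangent vector (1, k) has logarithmic coordinates (1/u₁, k/u₂), which blow up along the
  -- axes.
  obtain ⟨τ, hτ, hτb⟩ := exists_chartLog_eq n r (u.1⁻¹, ((k : ℕ) : ℂ) * u.2⁻¹)
  have e : evalForm (η (r, u)) (1, ((k : ℕ) : ℂ)) = logEval (η (r, u)) u (chartLog n r τ) := by
    rw [hτ, logEval]
    simp only
    rw [mul_inv_cancel₀ ht.1, mul_left_comm, mul_inv_cancel₀ ht.2, mul_one]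
  rw [e]
  refine (hη z hz (hq ▸ huV) r τ).trans ?_
  have hz1 : ‖z.1‖ ^ (n + 1) = ‖u.1‖ ^ ((r : ℕ) + 1) * ‖u.2‖ ^ (r : ℕ) := by
    have := congrArg (fun s : Surface n => ‖s.1.1‖) hq
    simpa [resolveChart, quotientMap] using this.symm
  have hz2 : ‖z.2‖ ^ (n + 1) = ‖u.1‖ ^ (n - r) * ‖u.2‖ ^ (n + 1 - r) := by
    have := congrArg (fun s : Surface n => ‖s.1.2.2‖) hq
    simpa [resolveChart, quotientMap] using this.symm
  have hzn : ‖z‖ ^ (n + 1) ≤ ‖z.1‖ ^ (n + 1) + ‖z.2‖ ^ (n + 1) := by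
    rw [Prod.norm_def]
    rcases max_choice ‖z.1‖ ‖z.2‖ with h | h <;> rw [h]
    · exact le_add_of_nonneg_right (by positivity)
    · exact le_add_of_nonneg_left (by positivity)
  have htn : ‖(u.1⁻¹, ((k : ℕ) : ℂ) * u.2⁻¹)‖ ≤ (m + 1) * (‖u.1‖⁻¹ + ‖u.2‖⁻¹) := by
    have hk : ((k : ℕ) : ℝ) ≤ m + 1 := by exact_mod_cast k.2.le
    have a1 : 0 ≤ ‖u.1‖⁻¹ := by positivity
    have a2 : 0 ≤ ‖u.2‖⁻¹ := by positivity
    have a3 : (0 : ℝ) ≤ m := Nat.cast_nonneg m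
    rw [Prod.norm_def]
    refine max_le ?_ ?_
    · simp only [norm_inv]
      nlinarith
    · simp only [norm_mul, norm_inv, Complex.norm_natCast]
      nlinarith
  have hprod : ‖z‖ ^ (n + 1) * ‖τ‖ ≤ (2 * r + 3) * (m + 1) * K := by
    calc ‖z‖ ^ (n + 1) * ‖τ‖ ≤ (‖z.1‖ ^ (n + 1) + ‖z.2‖ ^ (n + 1)) *
          ((2 * r + 3) * ((m + 1) * (‖u.1‖⁻¹ + ‖u.2‖⁻¹))) := by
          gcongr
          exact hτb.trans (by gcongr)
      _ = (2 * r + 3) * (m + 1) * ((‖z.1‖ ^ (n + 1) + ‖z.2‖ ^ (n + 1)) *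
          (‖u.1‖⁻¹ + ‖u.2‖⁻¹)) := by ring
      _ ≤ _ := by
          rw [hz1, hz2]
          have := huK ht
          gcongr
  -- This fixes the Taylor order nm: each of the m logarithmic poles is absorbed by one factor
  -- ‖z‖ⁿ⁺¹, which is bounded by the sizes of the first and third coordinates on X.
  have e2 : ‖z‖ ^ (n * m + m) * ‖τ‖ ^ m = (‖z‖ ^ (n + 1) * ‖τ‖) ^ m := by
    rw [mul_pow, ← pow_mul, add_mul, one_mul]
  rw [mul_assoc, e2]
  gcongr

theorem mem_germsOff {n m : ℕ} {S : Set (Resolution n)} {g : SectionGerm n m} :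
    g ∈ germsOff n m S ↔ ∃ V : Set (Surface n), IsOpen V ∧ origin n ∈ V ∧
      ∃ ω : Charts n → Fin (m + 1) → ℂ,
        IsSymDiff n m (resolve n ⁻¹' V \ S) ω ∧ g = (ω : SectionGerm n m) := Iff.rfl

theorem eventually_puncturedNhds {n : ℕ} {P : Charts n → Prop} {V : Set (Surface n)}
    (hV : IsOpen V) (hV0 : origin n ∈ V)
    (h : ∀ p, resolveChart n p ∈ V → resolveChart n p ≠ origin n → P p) :
    ∀ᶠ p in puncturedNhds n, P p := by
  have : ∀ᶠ s in 𝓝[≠] origin n, s ∈ V ∧ s ≠ origin n := by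
    rw [eventually_nhdsWithin_iff]
    filter_upwards [hV.mem_nhds hV0] with s hs hs' using ⟨hs, hs'⟩
  exact (this.comap _).mono fun p hp => h p hp.1 hp.2

/-- Every form off `E` is a combination of monomial forms up to forms that extend over `E`. -/
theorem exists_sub_mem_formsOnRes {n m : ℕ} {g : SectionGerm n m} (hg : g ∈ formsOffE n m) :
    ∃ θ ∈ monoSpan n m, g - (θ : SectionGerm n m) ∈ formsOnRes n m := by
  obtain ⟨V, hV, hV0, ω, hω, rfl⟩ := mem_germsOff.1 hg
  obtain ⟨θ, hθ, C, hC, hb⟩ := exists_remainder_bound hV hV0 hω (n * m)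
  refine ⟨θ, hθ, ?_⟩
  obtain ⟨ε, hε, hball⟩ := Metric.eventually_nhds_iff_ball.1 hb
  -- Membership in V₀ bounds |z₁|ⁿ⁺¹ and |z₂|ⁿ⁺¹, which puts every preimage z in the ball where the
  -- remainder estimate holds.
  set V₀ : Set (Surface n) := V ∩ {s | ‖s.1.1‖ < ε ^ (n + 1) ∧ ‖s.1.2.2‖ < ε ^ (n + 1)} with hV₀
  have hV₀o : IsOpen V₀ := by
    refine hV.inter ?_
    exact (isOpen_lt continuous_subtype_val.fst.norm continuous_const).inter
      (isOpen_lt continuous_subtype_val.snd.snd.norm continuous_const)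
  have hV₀0 : origin n ∈ V₀ := ⟨hV0, by simp [origin]; positivity⟩
  set η := ω - θ with hη
  have hηs : IsSymDiff n m (resolve n ⁻¹' V₀ \ exceptional n) η := by
    have h1 := hω.mono (W' := resolve n ⁻¹' V₀ \ exceptional n) fun x hx => ⟨hx.1.1, hx.2⟩
    have h2 := (isSymDiff_of_mem_monoSpan hθ).mono (W' := resolve n ⁻¹' V₀ \ exceptional n)
      fun x hx => ⟨trivial, hx.2⟩
    have := h1.add (h2.smul (-1))
    rwa [neg_one_smul, ← sub_eq_add_neg] at this
  have hηb : ∀ z ∈ torus, quotientMap n z ∈ V₀ → ∀ (r : Fin (n + 1)) (τ : ℂ × ℂ),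
      ‖logEval (η (r, chartPoint n r z)) (chartPoint n r z) (chartLog n r τ)‖ ≤
        C * ‖z‖ ^ (n * m + m) * ‖τ‖ ^ m := by
    intro z hz hzV r τ
    refine hball z ?_ hz r τ
    rw [mem_ball_zero_iff, Prod.norm_def]
    obtain ⟨-, h1, h2⟩ := hzV
    simp only [quotientMap, norm_pow] at h1 h2
    exact max_lt (lt_of_pow_lt_pow_left₀ _ hε.le h1) (lt_of_pow_lt_pow_left₀ _ hε.le h2)
  have hDo : ∀ r : Fin (n + 1), IsOpen {u : ℂ × ℂ | resolveChart n (r, u) ∈ V₀} := fun r =>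
    hV₀o.preimage (continuous_resolveChart n r)
  have htor : ∀ (r : Fin (n + 1)) (u : ℂ × ℂ), u ∈ torus → resolveChart n (r, u) ≠ origin n := by
    intro r u hu
    obtain ⟨z, hz, rfl⟩ := exists_chartPoint_eq r hu
    rw [resolveChart_chartPoint r hz]
    exact quotientMap_ne_origin fun h0 => hz.1 (by rw [h0]; rfl)
  have hext : ∀ (r : Fin (n + 1)) (q : Fin (m + 1)), ∃ h : ℂ × ℂ → ℂ,
      DifferentiableOn ℂ h {u | resolveChart n (r, u) ∈ V₀} ∧
      ∀ u ∈ {u | resolveChart n (r, u) ∈ V₀}, u ∈ torus → h u = η (r, u) q := by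
    intro r q
    refine exists_extension (hDo r) (fun u hu ht => hηs.differentiableAt hV₀o hu (htor r u ht) q)
      fun p hp hp0 hpt => ?_
    -- On E away from the crossings the coefficients are bounded by the remainder estimate; at other
    -- axis points they are already holomorphic. The chart origin is left to Hartogs inside
    -- `exists_extension`.
    by_cases hpo : resolveChart n (r, p) = origin n
    · have hx := congrArg (fun s : Surface n => s.1.1) hpo
      have hz := congrArg (fun s : Surface n => s.1.2.2) hpo
      simp only [resolveChart, origin] at hx hz
      have hr := r.2
      refine eventually_norm_coeff_le hC hηb r ((hDo r).mem_nhds hp) ?_ ?_ q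
      · by_contra! hc
        have hrn : (r : ℕ) = n := by omega
        rw [hrn, Nat.sub_self, pow_zero, one_mul, Nat.add_sub_cancel_left, pow_one] at hz
        exact hp0 (Prod.ext hc.1 hz)
      · by_contra! hc
        have hrn : (r : ℕ) = 0 := by omega
        rw [hrn, zero_add, pow_one, pow_zero, mul_one] at hx
        exact hp0 (Prod.ext hx hc.1)
    · have hc := (hηs.differentiableAt hV₀o hp hpo q).continuousAt.norm
      refine ⟨‖η (r, p) q‖ + 1, ?_⟩
      filter_upwards [hc.eventually_lt_const (lt_add_one _)] with u hu _ using hu.le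
  choose F hFd hFe using hext
  -- Values of η on E are irrelevant, so they are replaced by the extension; the germ off E is
  -- unchanged.
  set η' : Charts n → Fin (m + 1) → ℂ := fun p q => F p.1 q p.2 with hη'
  have hη'd : ∀ (r : Fin (n + 1)) (q : Fin (m + 1)) (u : ℂ × ℂ), resolveChart n (r, u) ∈ V₀ →
      DifferentiableAt ℂ (fun u => η' (r, u) q) u := fun r q u hu =>
    (hFd r q).differentiableAt ((hDo r).mem_nhds hu)
  have hη't : ∀ (r : Fin (n + 1)) (u : ℂ × ℂ), resolveChart n (r, u) ∈ V₀ → u ∈ torus →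
      η' (r, u) = η (r, u) := fun r u hu ht => funext fun q => hFe r q u hu ht
  refine mem_germsOff.2 ⟨V₀, hV₀o, hV₀0, η', ⟨fun r q u hu =>
    (hη'd r q u hu.1).differentiableWithinAt, fun r u hu2 hu v => ?_⟩, ?_⟩
  · have hV1 : resolveChart n (r.castSucc, u) ∈ V₀ := hu.1
    have hV2 : ∀ u : ℂ × ℂ, u.2 ≠ 0 → resolveChart n (r.succ, transition u) =
        resolveChart n (r.castSucc, u) := fun u hu =>
      (resolveChart_glue n _ _ ⟨r, u, hu, rfl, rfl⟩).symm
    refine compat_of_torus r hu2 (fun q => (hη'd _ q u hV1).continuousAt)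
      (fun q => (hη'd _ q _ (by rw [hV2 u hu2]; exact hV1)).continuousAt) ?_ v
    filter_upwards [(hDo r.castSucc).mem_nhds hV1] with u' hu' ht t
    rw [hη't _ _ hu' ht, hη't _ _ (by rw [hV2 u' ht.2]; exact hu') (transition_mem_torus ht)]
    exact hηs.logEval_succ r ht ⟨hu', htor _ _ ht⟩ t
  · change ((η : Charts n → Fin (m + 1) → ℂ) : SectionGerm n m) = (η' : SectionGerm n m)
    refine Germ.coe_eq.2 (eventually_puncturedNhds hV₀o hV₀0 ?_)
    rintro ⟨r, u⟩ hu hu0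
    funext q
    refine eq_of_eventually_eq_torus (f := fun u => η (r, u) q) (g := fun u => η' (r, u) q)
      (hηs.differentiableAt hV₀o hu hu0 q).continuousAt (hη'd r q u hu).continuousAt ?_
    filter_upwards [(hDo r).mem_nhds hu] with u' hu' ht
    rw [hη't _ _ hu' ht]

end AnSing

/-! ### Laurent polynomials bounded near a divisor -/

namespace AnSing

/-- If l < 0 were the least exponent with nonzero total coefficient, multiplying by x⁻ˡ would give
limit d_l, while boundedness forces limit 0. Several indices may share an exponent, hence the fibre
sums. -/
theorem sum_fiber_eq_zero_of_bounded {ι : Type*} (s : Finset ι) (i : ι → ℤ) (c : ι → ℂ) {K : ℝ}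
    (h : ∀ᶠ x in 𝓝[≠] (0 : ℂ), ‖∑ w ∈ s, c w * x ^ i w‖ ≤ K) {k : ℤ} (hk : k < 0) :
    ∑ w ∈ s with i w = k, c w = 0 := by
  classical
  set d : ℤ → ℂ := fun k => ∑ w ∈ s with i w = k, c w with hd
  by_contra hne
  have hmem : ∀ l, d l ≠ 0 → l ∈ s.image i := by
    intro l hl
    obtain ⟨w, hw, -⟩ := Finset.exists_ne_zero_of_sum_ne_zero hl
    rw [Finset.mem_filter] at hw
    exact Finset.mem_image.2 ⟨w, hw.1, hw.2⟩
  set N := (s.image i).filter fun l => d l ≠ 0 with hN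
  have hkN : k ∈ N := Finset.mem_filter.2 ⟨hmem k hne, hne⟩
  set l := N.min' ⟨k, hkN⟩ with hl
  have hlN : l ∈ N := Finset.min'_mem _ _
  have hl0 : l < 0 := (Finset.min'_le _ _ hkN).trans_lt hk
  have hdl : d l ≠ 0 := (Finset.mem_filter.1 hlN).2
  have hsum : ∀ x : ℂ, x ≠ 0 → x ^ (-l) * ∑ w ∈ s, c w * x ^ i w = ∑ j ∈ N, d j * x ^ (j - l) := by
    intro x hx
    have e1 : ∑ w ∈ s, c w * x ^ i w = ∑ j ∈ s.image i, d j * x ^ j := by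
      rw [← Finset.sum_fiberwise_of_maps_to (g := i) (t := s.image i)
        fun w hw => Finset.mem_image_of_mem i hw]
      refine Finset.sum_congr rfl fun j _ => ?_
      rw [hd, Finset.sum_mul]
      refine Finset.sum_congr rfl fun w hw => ?_
      rw [(Finset.mem_filter.1 hw).2]
    have e2 : ∑ j ∈ N, d j * x ^ j = ∑ j ∈ s.image i, d j * x ^ j :=
      Finset.sum_filter_of_ne fun j _ hj => left_ne_zero_of_mul hj
    rw [e1, ← e2, Finset.mul_sum]
    refine Finset.sum_congr rfl fun j _ => ?_
    rw [mul_left_comm, ← zpow_add₀ hx]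
    congr 2
    ring
  have ht1 : Tendsto (fun x : ℂ => ∑ j ∈ N, d j * x ^ (j - l)) (𝓝[≠] 0) (𝓝 (d l)) := by
    have : d l = ∑ j ∈ N, d j * (0 : ℂ) ^ (j - l) := by
      rw [Finset.sum_eq_single_of_mem l hlN]
      · simp
      · intro j _ hj
        rw [zero_zpow _ (sub_ne_zero.2 hj), mul_zero]
    rw [this]
    refine tendsto_finsetSum _ fun j hj => Tendsto.const_mul _ ?_
    have hc : ContinuousAt (fun x : ℂ => x ^ (j - l)) 0 :=
      continuousAt_zpow₀ _ _ (Or.inr (sub_nonneg.2 (Finset.min'_le _ _ hj)))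
    exact hc.tendsto.mono_left nhdsWithin_le_nhds
  have ht2 : Tendsto (fun x : ℂ => x ^ (-l) * ∑ w ∈ s, c w * x ^ i w) (𝓝[≠] 0) (𝓝 0) := by
    refine Tendsto.zero_mul_isBoundedUnder_le ?_ (isBoundedUnder_of_eventually_le h)
    have hc : ContinuousAt (fun x : ℂ => x ^ (-l)) 0 :=
      continuousAt_zpow₀ _ _ (Or.inr (by omega))
    have := hc.tendsto.mono_left (nhdsWithin_le_nhds (s := {0}ᶜ))
    rwa [zero_zpow _ (by omega)] at this
  refine hdl (tendsto_nhds_unique ht1 (ht2.congr' ?_))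
  filter_upwards [self_mem_nhdsWithin] with x hx using hsum x hx

theorem coeff_eq_zero_of_sum_eq_zero {ι : Type*} (s : Finset ι) (j : ι → ℤ) (c : ι → ℂ)
    (hj : Set.InjOn j s) (h : ∀ y : ℂ, y ≠ 0 → ∑ w ∈ s, c w * y ^ j w = 0) {w : ι} (hw : w ∈ s) :
    c w = 0 := by
  classical
  -- Shifting all exponents so that the one at `w` becomes -1 makes the coefficient visible to the
  -- previous lemma; the shifted sum is still zero.
  have := sum_fiber_eq_zero_of_bounded s (fun w' => j w' - (j w + 1)) c (K := 0) (k := -1) (by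
    filter_upwards [self_mem_nhdsWithin] with y hy
    have hy0 : y ≠ 0 := hy
    have e : ∑ w' ∈ s, c w' * y ^ (j w' - (j w + 1)) = 0 := by
      simp only [zpow_sub₀ hy0, mul_div_assoc']
      rw [← Finset.sum_div, h y hy0, zero_div]
    rw [e, norm_zero]) (by norm_num)
  rw [Finset.sum_eq_single_of_mem w (Finset.mem_filter.2 ⟨hw, by ring⟩)] at this
  · exact this
  · intro w' hw' hne
    rw [Finset.mem_filter] at hw'
    exact absurd (hj hw'.1 hw (by omega)) hne

/-- A combination of monomial forms of distinct weights extends over `E` only if all of them do. -/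
theorem mem_admissible_of_sum_mem_formsOnRes {n m : ℕ} (S : Finset (ℤ × ℤ))
    (f : ℤ × ℤ → Polynomial ℂ) (hf : ∀ w ∈ S, f w ∈ admissible m w {0, n + 1})
    (h : ((∑ w ∈ S, monoForm n m w (f w) : Charts n → Fin (m + 1) → ℂ) : SectionGerm n m) ∈
      formsOnRes n m) {w : ℤ × ℤ} (hw : w ∈ S) :
    f w ∈ admissible m w (Finset.range (n + 2)) := by
  classical
  obtain ⟨V, hV, hV0, η, hη, he⟩ := mem_germsOff.1 h
  refine ⟨(hf w hw).1, fun r hr => ?_⟩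
  rw [Finset.mem_range] at hr
  by_cases hend : r ∈ ({0, n + 1} : Finset ℕ)
  · exact (hf w hw).2 r hend
  simp only [Finset.mem_insert, Finset.mem_singleton, not_or] at hend
  obtain ⟨s, rfl⟩ := Nat.exists_eq_succ_of_ne_zero hend.1
  rw [Nat.succ_eq_add_one, X_sub_pow_dvd_iff_right (natDegree_le_of_mem_admissible (hf w hw))]
  intro q hq
  have hsn : s < n := by omega
  set r : Fin (n + 1) := ⟨s, by omega⟩ with hrd
  have hgerm := Germ.coe_eq.1 he
  obtain ⟨U, hU, hUeq⟩ := mem_comap.1 hgerm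
  rw [mem_nhdsWithin] at hU
  obtain ⟨U', hU'o, hU'0, hU'⟩ := hU
  -- In chart s the axis {u₁ = 0} lies on the divisor s + 1; i and j are the exponents of u₁ and u₂
  -- in the coefficient q. The assumption `hq` says i w < 0, a pole that the extension must not
  -- have.
  set i : ℤ × ℤ → ℤ := fun w => ord m w (s + 1) - (m - (q : ℕ) : ℤ) with hi
  set j : ℤ × ℤ → ℤ := fun w => ord m w s - (q : ℕ) with hj
  have hval : ∀ u : ℂ × ℂ, (∑ w ∈ S, monoForm n m w (f w)) (r, u) q =
      ∑ w ∈ S, chartCoeff m s (f w) q * u.2 ^ j w * u.1 ^ i w := by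
    intro u
    rw [Finset.sum_apply, Finset.sum_apply]
    refine Finset.sum_congr rfl fun w _ => ?_
    simp only [monoForm, hi, hj, hrd]
    ring
  have hfib : ∀ y : ℂ, y ≠ 0 →
      ∑ w' ∈ S with i w' = i w, chartCoeff m s (f w') q * y ^ j w' = 0 := by
    intro y hy
    have hyo : resolveChart n (r, (0, y)) = origin n := resolveChart_eq_origin_of_left rfl hsn
    have hcx : Continuous fun x : ℂ => ((x, y) : ℂ × ℂ) := by fun_prop
    have hopen : IsOpen {u : ℂ × ℂ | resolveChart n (r, u) ∈ V} :=
      hV.preimage (continuous_resolveChart n r)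
    have hcont : ContinuousAt (fun x : ℂ => η (r, (x, y)) q) 0 := by
      have hd : DifferentiableAt ℂ (fun u : ℂ × ℂ => η (r, u) q) (0, y) :=
        (hη.holo r q).differentiableAt (mem_of_superset (hopen.mem_nhds (by
          change resolveChart n (r, (0, y)) ∈ V
          rwa [hyo])) fun u hu => ⟨hu, fun h => h.elim⟩)
      exact hd.continuousAt.comp (f := fun x : ℂ => ((x, y) : ℂ × ℂ)) hcx.continuousAt
    refine sum_fiber_eq_zero_of_bounded S i (fun w => chartCoeff m s (f w) q * y ^ j w)
      (K := ‖η (r, (0, y)) q‖ + 1) ?_ (k := i w) (by simp only [hi]; omega)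
    have hUx : ∀ᶠ x in 𝓝 (0 : ℂ), resolveChart n (r, (x, y)) ∈ U' := by
      refine ((continuous_resolveChart n r).comp hcx).continuousAt.eventually_mem
        (hU'o.mem_nhds ?_)
      change resolveChart n (r, (0, y)) ∈ U'
      rwa [hyo]
    filter_upwards [nhdsWithin_le_nhds (hcont.norm.eventually_lt_const (lt_add_one _)),
      nhdsWithin_le_nhds hUx, self_mem_nhdsWithin] with x hx hxU hx0
    have hx0' : x ≠ 0 := hx0
    have hne : resolveChart n (r, (x, y)) ≠ origin n := by
      intro h0
      have := congrArg (fun s : Surface n => s.1.2.1) h0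
      simp only [resolveChart, origin] at this
      exact mul_ne_zero hx0' hy this
    have := congrFun (hUeq (hU' ⟨hxU, hne⟩ : ((r, (x, y)) : Charts n) ∈
      (fun p => resolve n (toRes n p)) ⁻¹' U)) q
    rw [hval] at this
    simp only at this
    rw [this]
    exact hx.le
  refine coeff_eq_zero_of_sum_eq_zero (S.filter fun w' => i w' = i w) j
    (fun w => chartCoeff m s (f w) q) ?_ hfib (Finset.mem_filter.2 ⟨hw, rfl⟩)
  -- The pair (i, j) determines the weight, so among weights with equal i the exponents j are
  -- distinct.
  rintro ⟨g₁, d₁⟩ h₁ ⟨g₂, d₂⟩ h₂ h12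
  have e1 : i (g₁, d₁) = i w := (Finset.mem_filter.1 h₁).2
  have e2 : i (g₂, d₂) = i w := (Finset.mem_filter.1 h₂).2
  have e3 := e1.trans e2.symm
  simp only [hi, hj, ord] at e3 h12
  push_cast at e3
  have hd : d₁ = d₂ := by linear_combination h12 - e3
  subst hd
  simp only [Prod.mk.injEq, and_true]
  omega

/-! ### Dimensions -/

/-- The multiplicity of the root `r` forced by holomorphy along the `r`-th divisor. -/
def mult (w : ℤ × ℤ) (r : ℕ) : ℕ := (r * w.2 - w.1).toNat

theorem toNat_sub_ord (m : ℕ) (w : ℤ × ℤ) (r : ℕ) : (m - ord m w r).toNat = mult w r := by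
  simp only [ord, mult]
  congr 1
  ring

/-- The required factors at distinct integers are coprime, so the conditions amount to divisibility
by one monic product, and the quotient polynomial is free up to its degree. If the product is too
large, the truncated subtraction gives the zero space. -/
theorem admissible_eq_map (m : ℕ) (w : ℤ × ℤ) (s : Finset ℕ) :
    admissible m w s = (Polynomial.degreeLT ℂ (m + 1 - ∑ r ∈ s, mult w r)).map
      (LinearMap.mulLeft ℂ (∏ r ∈ s, (Polynomial.X - Polynomial.C (r : ℂ)) ^ mult w r)) := by
  set D : Polynomial ℂ := ∏ r ∈ s, (Polynomial.X - Polynomial.C (r : ℂ)) ^ mult w r with hD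
  have hmonic : D.Monic := Polynomial.monic_prod_of_monic _ _ fun r _ =>
    (Polynomial.monic_X_sub_C _).pow _
  have hdeg : D.natDegree = ∑ r ∈ s, mult w r := by
    rw [hD, Polynomial.natDegree_prod_of_monic _ _ fun r _ => (Polynomial.monic_X_sub_C _).pow _]
    exact Finset.sum_congr rfl fun r _ => by
      rw [(Polynomial.monic_X_sub_C _).natDegree_pow, Polynomial.natDegree_X_sub_C, mul_one]
  have hdvd : ∀ f : Polynomial ℂ, (∀ r ∈ s,
      (Polynomial.X - Polynomial.C (r : ℂ)) ^ (m - ord m w r).toNat ∣ f) ↔ D ∣ f := by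
    intro f
    simp only [toNat_sub_ord]
    constructor
    · refine fun h => Finset.prod_dvd_of_coprime (fun a _ b _ hab => ?_) h
      have hc : IsCoprime (Polynomial.X - Polynomial.C (a : ℂ))
          (Polynomial.X - Polynomial.C (b : ℂ)) :=
        Polynomial.isCoprime_X_sub_C_of_isUnit_sub (isUnit_iff_ne_zero.2
          (sub_ne_zero.2 (Nat.cast_injective.ne hab)))
      exact hc.pow
    · exact fun h r hr => (Finset.dvd_prod_of_mem
        (fun r : ℕ => (Polynomial.X - Polynomial.C (r : ℂ)) ^ mult w r) hr).trans h
  ext f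
  rw [Submodule.mem_map]
  constructor
  · rintro ⟨h1, h2⟩
    obtain ⟨g, rfl⟩ := (hdvd f).1 h2
    refine ⟨g, ?_, rfl⟩
    rw [Polynomial.mem_degreeLT]
    rcases eq_or_ne g 0 with rfl | hg
    · rw [Polynomial.degree_zero]
      exact WithBot.bot_lt_coe _
    rw [Polynomial.degree_mul, Polynomial.degree_eq_natDegree hmonic.ne_zero,
      Polynomial.degree_eq_natDegree hg] at h1
    rw [Polynomial.degree_eq_natDegree hg]
    have h1' : D.natDegree + g.natDegree < m + 1 := by exact_mod_cast h1
    have : g.natDegree < m + 1 - ∑ r ∈ s, mult w r := by omega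
    exact_mod_cast this
  · rintro ⟨g, hg, rfl⟩
    refine ⟨?_, (hdvd _).2 (dvd_mul_right _ _)⟩
    change (D * g).degree < _
    rw [Polynomial.mem_degreeLT] at hg
    rcases eq_or_ne g 0 with rfl | hg0
    · rw [mul_zero, Polynomial.degree_zero]
      exact WithBot.bot_lt_coe _
    rw [Polynomial.degree_eq_natDegree hg0] at hg
    rw [Polynomial.degree_mul, Polynomial.degree_eq_natDegree hmonic.ne_zero,
      Polynomial.degree_eq_natDegree hg0]
    have hg' : g.natDegree < m + 1 - ∑ r ∈ s, mult w r := by exact_mod_cast hg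
    have : D.natDegree + g.natDegree < m + 1 := by omega
    exact_mod_cast this

theorem finrank_admissible (m : ℕ) (w : ℤ × ℤ) (s : Finset ℕ) :
    Module.Finite ℂ (admissible m w s) ∧
      Module.finrank ℂ (admissible m w s) = m + 1 - ∑ r ∈ s, mult w r := by
  rw [admissible_eq_map]
  set D : Polynomial ℂ := ∏ r ∈ s, (Polynomial.X - Polynomial.C (r : ℂ)) ^ mult w r with hD
  have hmonic : D.Monic := Polynomial.monic_prod_of_monic _ _ fun r _ =>
    (Polynomial.monic_X_sub_C _).pow _
  have hinj : Function.Injective (LinearMap.mulLeft ℂ D) := fun a b hab =>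
    mul_left_cancel₀ hmonic.ne_zero hab
  set K := m + 1 - ∑ r ∈ s, mult w r
  have e := (Polynomial.degreeLTEquiv ℂ K).symm.trans
    (Submodule.equivMapOfInjective _ hinj (Polynomial.degreeLT ℂ K))
  exact ⟨Module.Finite.equiv e, by rw [← e.finrank_eq]; simp⟩

end AnSing

/-! ### The dimension of the quotient -/

namespace AnSing

theorem admissible_le (n m : ℕ) (w : ℤ × ℤ) :
    admissible m w (Finset.range (n + 2)) ≤ admissible m w {0, n + 1} := fun f hf =>
  ⟨hf.1, fun r hr => hf.2 r (by
    simp only [Finset.mem_insert, Finset.mem_singleton] at hr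
    simp only [Finset.mem_range]
    omega)⟩

/-- The dimension of the weight component of the forms off `E`. -/
def dimOff (n m : ℕ) (w : ℤ × ℤ) : ℕ := m + 1 - (mult w 0 + mult w (n + 1))

/-- The dimension of the weight component of the forms on the resolution. -/
def dimOn (n m : ℕ) (w : ℤ × ℤ) : ℕ := m + 1 - ∑ r ∈ Finset.range (n + 2), mult w r

theorem finrank_admissible_ends (n m : ℕ) (w : ℤ × ℤ) :
    Module.finrank ℂ (admissible m w {0, n + 1}) = dimOff n m w := by
  rw [(finrank_admissible m w _).2, Finset.sum_pair (by omega)]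
  rfl

theorem chartCoeff_add (m r : ℕ) (f g : Polynomial ℂ) (q : Fin (m + 1)) :
    chartCoeff m r (f + g) q = chartCoeff m r f q + chartCoeff m r g q := by
  simp only [chartCoeff, map_add, Polynomial.coeff_add, add_mul, Finset.sum_add_distrib]

theorem chartCoeff_smul (m r : ℕ) (a : ℂ) (f : Polynomial ℂ) (q : Fin (m + 1)) :
    chartCoeff m r (a • f) q = a * chartCoeff m r f q := by
  simp only [chartCoeff, map_smul, Polynomial.coeff_smul, smul_eq_mul, Finset.mul_sum, mul_assoc]

/-- The germ of the monomial form, as a linear function of the polynomial. -/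
noncomputable def monoGerm (n m : ℕ) (w : ℤ × ℤ) : Polynomial ℂ →ₗ[ℂ] SectionGerm n m where
  toFun f := (monoForm n m w f : SectionGerm n m)
  map_add' f g := by
    have : monoForm n m w (f + g) = monoForm n m w f + monoForm n m w g := by
      funext p q
      simp only [monoForm, chartCoeff_add, Pi.add_apply, add_mul]
    rw [this]
    rfl
  map_smul' a f := by
    have : monoForm n m w (a • f) = a • monoForm n m w f := by
      funext p q
      simp only [monoForm, chartCoeff_smul, Pi.smul_apply, smul_eq_mul, mul_assoc]
    rw [this]
    rfl

theorem monoGerm_mem_formsOffE {n m : ℕ} {w : ℤ × ℤ} {f : Polynomial ℂ}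
    (hf : f ∈ admissible m w {0, n + 1}) : monoGerm n m w f ∈ formsOffE n m :=
  mem_germsOff.2 ⟨_, isOpen_univ, trivial, _, isSymDiff_of_admissible_ends hf, rfl⟩

theorem monoGerm_mem_formsOnRes {n m : ℕ} {w : ℤ × ℤ} {f : Polynomial ℂ}
    (hf : f ∈ admissible m w (Finset.range (n + 2))) : monoGerm n m w f ∈ formsOnRes n m :=
  mem_germsOff.2 ⟨_, isOpen_univ, trivial, _, isSymDiff_of_admissible hf, rfl⟩

/-- The germ of a family of weight components. -/
noncomputable def sumGerm (n m : ℕ) (S : Finset (ℤ × ℤ)) :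
    (∀ w : S, admissible m w {0, n + 1}) →ₗ[ℂ] formsOffE n m :=
  LinearMap.codRestrict _ (∑ w : S, (monoGerm n m w).comp
    ((admissible m w {0, n + 1}).subtype.comp (LinearMap.proj w))) fun x => by
      simp only [LinearMap.coe_sum, Finset.sum_apply, LinearMap.comp_apply]
      exact Submodule.sum_mem _ fun w _ => monoGerm_mem_formsOffE (x w).2

theorem coe_sumGerm {n m : ℕ} {S : Finset (ℤ × ℤ)} (x : ∀ w : S, admissible m w {0, n + 1}) :
    (sumGerm n m S x : SectionGerm n m) = ∑ w : S, monoGerm n m w (x w) := by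
  simp [sumGerm]

/-- Weights outside S contribute only forms that extend, so finitely many weights generate the
quotient. -/
theorem germ_mem_sup {n m : ℕ} {S : Finset (ℤ × ℤ)}
    (hS : ∀ w ∉ S, admissible m w {0, n + 1} ≤ admissible m w (Finset.range (n + 2)))
    {θ : Charts n → Fin (m + 1) → ℂ} (hθ : θ ∈ monoSpan n m) :
    (θ : SectionGerm n m) ∈ formsOnRes n m ⊔
      ((formsOffE n m).subtype.comp (sumGerm n m S)).range := by
  classical
  induction hθ using Submodule.span_induction with
  | zero => exact Submodule.zero_mem _
  | add x y _ _ hx hy => exact Submodule.add_mem _ hx hy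
  | smul a x _ hx => exact Submodule.smul_mem _ a hx
  | mem x hx =>
    obtain ⟨w, f, hf, rfl⟩ := hx
    by_cases hw : w ∈ S
    · refine Submodule.mem_sup_right ⟨Pi.single ⟨w, hw⟩ ⟨f, hf⟩, ?_⟩
      rw [LinearMap.comp_apply, Submodule.subtype_apply, coe_sumGerm,
        Finset.sum_eq_single_of_mem ⟨w, hw⟩ (Finset.mem_univ _)]
      · rw [Pi.single_eq_same]
        rfl
      · intro w' _ hw'
        rw [Pi.single_eq_of_ne hw']
        simp
    · exact Submodule.mem_sup_left (monoGerm_mem_formsOnRes (hS w hw hf))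

theorem sumGerm_mem_formsOnRes_iff {n m : ℕ} {S : Finset (ℤ × ℤ)}
    (x : ∀ w : S, admissible m w {0, n + 1}) :
    (sumGerm n m S x : SectionGerm n m) ∈ formsOnRes n m ↔
      ∀ w : S, (x w : Polynomial ℂ) ∈ admissible m w (Finset.range (n + 2)) := by
  classical
  rw [coe_sumGerm]
  constructor
  · intro h w
    set f : ℤ × ℤ → Polynomial ℂ := fun w => if hw : w ∈ S then x ⟨w, hw⟩ else 0 with hf
    have hfx : ∀ w : S, f w = x w := fun w => by simp [hf]
    have h1 : ∑ w : S, monoGerm n m w (x w) =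
        ((∑ w ∈ S, monoForm n m w (f w) : Charts n → Fin (m + 1) → ℂ) : SectionGerm n m) := by
      have e := map_sum (Germ.coeAddHom (puncturedNhds n)) (fun w => monoForm n m w (f w)) S
      refine Eq.trans ?_ e.symm
      rw [← Finset.sum_coe_sort S]
      refine Finset.sum_congr rfl fun w _ => ?_
      rw [hfx]
      rfl
    have h2 := mem_admissible_of_sum_mem_formsOnRes S f (fun w hw => by
      rw [hfx ⟨w, hw⟩]
      exact (x ⟨w, hw⟩).2) (h1 ▸ h) w.2
    rwa [hfx] at h2
  · exact fun h => Submodule.sum_mem _ fun w _ => monoGerm_mem_formsOnRes (h w)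

/-- The map from the product of the weight components onto the quotient is surjective by
approximation, and its kernel is the product of the extendable parts by independence of weights.
Finiteness is recorded as well, because `finrank` alone is zero in infinite dimension. -/
theorem finrank_obstruction {n m : ℕ} {S : Finset (ℤ × ℤ)}
    (hS : ∀ w ∉ S, dimOff n m w = dimOn n m w) :
    Module.Finite ℂ (Obstruction n m) ∧
      hbar n m = ∑ w ∈ S, (dimOff n m w - dimOn n m w) := by
  classical
  have hS' : ∀ w ∉ S, admissible m w {0, n + 1} ≤ admissible m w (Finset.range (n + 2)) := by
    intro w hw
    have := (finrank_admissible m w {0, n + 1}).1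
    refine (Submodule.eq_of_le_of_finrank_eq (admissible_le n m w) ?_).ge
    rw [finrank_admissible_ends, hS w hw, (finrank_admissible m w _).2]
    rfl
  set P : ∀ w : S, Submodule ℂ (admissible m w {0, n + 1}) := fun w =>
    (admissible m w (Finset.range (n + 2))).submoduleOf (admissible m w {0, n + 1}) with hP
  set Q := (formsOnRes n m).submoduleOf (formsOffE n m) with hQ
  set Φ := Q.mkQ.comp (sumGerm n m S) with hΦ
  have hker : LinearMap.ker Φ = Submodule.pi Set.univ P := by
    ext x
    rw [LinearMap.mem_ker, hΦ, LinearMap.comp_apply, Submodule.mkQ_apply,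
      Submodule.Quotient.mk_eq_zero]
    refine (sumGerm_mem_formsOnRes_iff x).trans ?_
    simp only [Submodule.mem_pi, Set.mem_univ, true_implies]
    rfl
  have hsurj : Function.Surjective Φ := by
    intro y
    obtain ⟨⟨g, hg⟩, rfl⟩ := Submodule.mkQ_surjective _ y
    obtain ⟨θ, hθ, hgθ⟩ := exists_sub_mem_formsOnRes hg
    obtain ⟨a, ha, b, ⟨x, rfl⟩, hab⟩ := Submodule.mem_sup.1 (germ_mem_sup hS' hθ)
    refine ⟨x, ?_⟩
    rw [hΦ, LinearMap.comp_apply, Submodule.mkQ_apply, Submodule.mkQ_apply, eq_comm,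
      Submodule.Quotient.eq]
    have : g - (sumGerm n m S x : SectionGerm n m) = (g - (θ : SectionGerm n m)) + a := by
      rw [← hab]
      simp only [LinearMap.comp_apply, Submodule.subtype_apply]
      abel
    change g - (sumGerm n m S x : SectionGerm n m) ∈ formsOnRes n m
    rw [this]
    exact Submodule.add_mem _ hgθ ha
  have e : (∀ w : S, admissible m w {0, n + 1} ⧸ P w) ≃ₗ[ℂ] Obstruction n m :=
    (Submodule.quotientPi P).symm.trans ((Submodule.quotEquivOfEq _ _ hker.symm).trans
      (Φ.quotKerEquivOfSurjective hsurj))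
  have hfin : ∀ w : S, Module.Finite ℂ (admissible m w {0, n + 1}) := fun w =>
    (finrank_admissible m w _).1
  have hfree : ∀ w : S, Module.Free ℂ (admissible m w {0, n + 1} ⧸ P w) := fun w =>
    Module.Free.of_divisionRing ℂ _
  refine ⟨Module.Finite.equiv e, ?_⟩
  rw [hbar, ← e.finrank_eq, Module.finrank_pi_fintype, ← Finset.sum_coe_sort S]
  refine Finset.sum_congr rfl fun w _ => ?_
  have h1 := Submodule.finrank_quotient_add_finrank (P w)
  have h2 : Module.finrank ℂ (P w) = dimOn n m w := by
    rw [(Submodule.submoduleOfEquivOfLe (admissible_le n m w)).finrank_eq,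
      (finrank_admissible m w _).2]
    rfl
  rw [finrank_admissible_ends, h2] at h1
  omega

end AnSing

/-! ### The weighted lattice sum -/

namespace AnSing

/-- The lattice point of the polygon corresponding to a weight. -/
def latticePoint (n m : ℕ) (w : ℤ × ℤ) : ℤ × ℤ := (m + 2 * w.1 - (n + 1) * w.2, w.2)

theorem latticePoint_injective (n m : ℕ) : Function.Injective (latticePoint n m) := by
  rintro ⟨g, d⟩ ⟨g', d'⟩ h
  simp only [latticePoint, Prod.mk.injEq] at h
  obtain ⟨h1, rfl⟩ := h
  simp only [Prod.mk.injEq, and_true]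
  linarith

theorem natCast_tsub_eq_max (a b : ℕ) : ((a - b : ℕ) : ℝ) = max 0 ((a : ℝ) - b) := by
  rcases le_total a b with h | h
  · rw [Nat.sub_eq_zero_of_le h, max_eq_left]
    · simp
    · simpa using h
  · rw [Nat.cast_sub h, max_eq_right]
    simpa using h

theorem cast_mult (w : ℤ × ℤ) (r : ℕ) : (mult w r : ℝ) = max 0 ((r : ℝ) * w.2 - w.1) := by
  have h : ((mult w r : ℕ) : ℤ) = max ((r : ℤ) * w.2 - w.1) 0 := Int.toNat_eq_max _
  have := congrArg (Int.cast : ℤ → ℝ) h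
  push_cast at this
  rw [this, max_comm]

theorem alpha_latticePoint (n m s : ℕ) (w : ℤ × ℤ) :
    alpha n m ((s : ℤ) - 1) (((latticePoint n m w).1 : ℝ), ((latticePoint n m w).2 : ℝ)) =
      mult w s := by
  rw [cast_mult, alpha]
  congr 1
  simp only [latticePoint]
  push_cast
  ring

theorem weight_latticePoint (n m : ℕ) (w : ℤ × ℤ) :
    weight n m (((latticePoint n m w).1 : ℝ), ((latticePoint n m w).2 : ℝ)) =
      ((dimOff n m w - dimOn n m w : ℕ) : ℝ) := by
  have h0 := alpha_latticePoint n m 0 w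
  have h1 := alpha_latticePoint n m (n + 1) w
  simp only [Nat.cast_zero, zero_sub, Nat.cast_add, Nat.cast_one, add_sub_cancel_right] at h0 h1
  have hs : ∑ r ∈ Finset.range n, alpha n m (r : ℤ)
      (((latticePoint n m w).1 : ℝ), ((latticePoint n m w).2 : ℝ)) =
      ((∑ r ∈ Finset.range n, mult w (r + 1) : ℕ) : ℝ) := by
    rw [Nat.cast_sum]
    refine Finset.sum_congr rfl fun r _ => ?_
    have := alpha_latticePoint n m (r + 1) w
    simpa only [Nat.cast_add, Nat.cast_one, add_sub_cancel_right] using this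
  have hb : beta n m (((latticePoint n m w).1 : ℝ), ((latticePoint n m w).2 : ℝ)) =
      (dimOff n m w : ℝ) := by
    rw [beta, h0, h1, dimOff, natCast_tsub_eq_max]
    push_cast
    congr 1
    ring
  -- With a = `dimOff n m w` and s the sum of the middle multiplicities, `dimOn n m w` is a - s
  -- truncated at zero, and a - (a - s) = min(s, a).
  have e : dimOff n m w - dimOn n m w =
      min (∑ r ∈ Finset.range n, mult w (r + 1)) (dimOff n m w) := by
    rw [dimOn, Finset.sum_range_succ', Finset.sum_range_succ, dimOff]
    omega
  rw [weight, hs, hb, e, Nat.cast_min]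

theorem latticePoint_mem_iff (n m : ℕ) (w : ℤ × ℤ) :
    latticePoint n m w ∈ latticePoints n m ↔ 0 ≤ m + 2 * w.1 - (n + 1) * w.2 ∧
      ((0 ≤ w.2 ∧ w.1 ≤ n * w.2 ∧ (n + 1) * w.2 - w.1 ≤ m + 1) ∨
        (w.2 ≤ 0 ∧ w.1 ≤ w.2 ∧ -w.1 ≤ m + 1)) := by
  obtain ⟨g, d⟩ := w
  have hpar : (latticePoint n m (g, d)).1 + ((n : ℤ) + 1) * (latticePoint n m (g, d)).2 ≡ (m : ℤ)
      [ZMOD 2] := by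
    simp only [latticePoint]
    rw [Int.modEq_iff_dvd]
    exact ⟨-g, by ring⟩
  refine (and_iff_left hpar).trans ?_
  simp only [Set.mem_ofPred_eq, polygon, halfPolygon, latticePoint]
  push_cast
  have i1 : (0 : ℤ) ≤ m + 2 * g - (n + 1) * d ↔ (0 : ℝ) ≤ m + 2 * g - (n + 1) * d := by
    exact_mod_cast Iff.rfl
  have i2 : (0 : ℤ) ≤ d ↔ (0 : ℝ) ≤ d := by exact_mod_cast Iff.rfl
  have i3 : g ≤ n * d ↔ (g : ℝ) ≤ n * d := by exact_mod_cast Iff.rfl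
  have i4 : (n + 1) * d - g ≤ m + 1 ↔ ((n : ℝ) + 1) * d - g ≤ m + 1 := by exact_mod_cast Iff.rfl
  have i5 : d ≤ 0 ↔ (d : ℝ) ≤ 0 := by exact_mod_cast Iff.rfl
  have i6 : g ≤ d ↔ (g : ℝ) ≤ d := by exact_mod_cast Iff.rfl
  have i7 : -g ≤ m + 1 ↔ -(g : ℝ) ≤ m + 1 := by exact_mod_cast Iff.rfl
  rw [i1, i2, i3, i4, i5, i6, i7]
  constructor
  · rintro (⟨h1, h2, h3, h4⟩ | ⟨h1, h2, h3, h4⟩)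
    · exact ⟨by linarith, Or.inl ⟨by linarith, by linarith, by linarith⟩⟩
    · exact ⟨by linarith, Or.inr ⟨by linarith, by linarith, by linarith⟩⟩
  · rintro ⟨h1, ⟨h2, h3, h4⟩ | ⟨h2, h3, h4⟩⟩
    · exact Or.inl ⟨by linarith, by linarith, by linarith, by linarith⟩
    · exact Or.inr ⟨by linarith, by linarith, by linarith, by linarith⟩

/-- The weights at which forms off `E` may fail to extend. -/
theorem bounds_of_dimOff_ne {n m : ℕ} {w : ℤ × ℤ} (h : dimOff n m w ≠ dimOn n m w) :
    (∃ r : ℕ, 1 ≤ r ∧ r ≤ n ∧ w.1 < r * w.2) ∧ -w.1 ≤ m ∧ (n + 1) * w.2 - w.1 ≤ m ∧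
      0 ≤ m + 2 * w.1 - (n + 1) * w.2 := by
  have e : dimOn n m w = m + 1 - (∑ r ∈ Finset.range n, mult w (r + 1) +
      (mult w 0 + mult w (n + 1))) := by
    rw [dimOn, Finset.sum_range_succ', Finset.sum_range_succ]
    congr 1
    ring
  rw [e, dimOff] at h
  have hne : ∑ r ∈ Finset.range n, mult w (r + 1) ≠ 0 := by omega
  have hle : mult w 0 + mult w (n + 1) ≤ m := by omega
  constructor
  · obtain ⟨r, hr, hr0⟩ := Finset.exists_ne_zero_of_sum_ne_zero hne
    refine ⟨r + 1, by omega, by simpa using hr, ?_⟩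
    have : ¬ (((r + 1 : ℕ) : ℤ) * w.2 - w.1 ≤ 0) := fun h0 => hr0 (Int.toNat_eq_zero.2 h0)
    omega
  · have h0 : -w.1 ≤ mult w 0 := by
      simp [mult]
    have h1 : (n + 1) * w.2 - w.1 ≤ mult w (n + 1) := by
      simp [mult]
    have h2 : ((mult w 0 + mult w (n + 1) : ℕ) : ℤ) ≤ m := by exact_mod_cast hle
    push_cast at h2
    have h3 : (0 : ℤ) ≤ mult w 0 := Int.natCast_nonneg _
    have h4 : (0 : ℤ) ≤ mult w (n + 1) := Int.natCast_nonneg _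
    exact ⟨by linarith, by linarith, by linarith⟩

/-- The polygon is slightly larger than needed: it allows m + 1 where the bounds give m. On those
extra edges a single end multiplicity reaches m + 1, so `dimOff` and the weight vanish. -/
theorem latticePoint_mem_of_dimOff_ne {n m : ℕ} {w : ℤ × ℤ} (h : dimOff n m w ≠ dimOn n m w) :
    latticePoint n m w ∈ latticePoints n m := by
  obtain ⟨⟨r, hr1, hrn, hr⟩, h1, h2, h3⟩ := bounds_of_dimOff_ne h
  have hr1' : (1 : ℤ) ≤ r := by exact_mod_cast hr1
  have hrn' : (r : ℤ) ≤ n := by exact_mod_cast hrn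
  rw [latticePoint_mem_iff]
  refine ⟨h3, ?_⟩
  rcases le_total 0 w.2 with hd | hd
  · exact Or.inl ⟨hd, by nlinarith, by linarith⟩
  · exact Or.inr ⟨hd, by nlinarith, by linarith⟩

/-- The parity condition is precisely solvability of x₁ = m + 2g - (n + 1)x₂ for an integer g. -/
theorem latticePoints_eq_image (n m : ℕ) : latticePoints n m =
    latticePoint n m '' {w | latticePoint n m w ∈ latticePoints n m} := by
  ext ⟨x, y⟩
  constructor
  · intro h
    obtain ⟨k, hk⟩ := Int.modEq_iff_dvd.1 h.2
    have e : latticePoint n m (-k, y) = (x, y) := by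
      simp only [latticePoint, Prod.mk.injEq, and_true]
      simp only at hk
      linarith
    exact ⟨_, by rw [Set.mem_ofPred_eq, e]; exact h, e⟩
  · rintro ⟨w, hw, he⟩
    rw [← he]
    exact hw

theorem finite_preimage_latticePoints (n m : ℕ) :
    {w | latticePoint n m w ∈ latticePoints n m}.Finite := by
  refine ((Set.finite_Icc (-((m : ℤ) + 1)) (n * (m + 1))).prod
    (Set.finite_Icc (-((m : ℤ) + 1)) (m + 1))).subset ?_
  rintro ⟨g, d⟩ hw
  rw [Set.mem_ofPred_eq, latticePoint_mem_iff] at hw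
  simp only at hw
  have hn : (0 : ℤ) ≤ n := Int.natCast_nonneg n
  have hm : (0 : ℤ) ≤ m := Int.natCast_nonneg m
  obtain ⟨h0, ⟨h1, h2, h3⟩ | ⟨h1, h2, h3⟩⟩ := hw
  · have hd : d ≤ m + 1 := by linarith
    refine ⟨⟨by nlinarith, ?_⟩, ⟨by linarith, hd⟩⟩
    exact h2.trans (mul_le_mul_of_nonneg_left hd hn)
  · exact ⟨⟨by linarith, by nlinarith⟩, ⟨by linarith, by linarith⟩⟩

theorem obstruction_lattice_sum (n m : ℕ) :
    Module.Finite ℂ (Obstruction n m) ∧ (latticePoints n m).Finite ∧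
      (hbar n m : ℝ) = ∑ᶠ x ∈ latticePoints n m, weight n m ((x.1 : ℝ), (x.2 : ℝ)) := by
  have hfin := finite_preimage_latticePoints n m
  obtain ⟨h1, h2⟩ := finrank_obstruction (n := n) (m := m) (S := hfin.toFinset) (by
    intro w hw
    by_contra hne
    exact hw (hfin.mem_toFinset.2 (latticePoint_mem_of_dimOff_ne hne)))
  refine ⟨h1, ?_, ?_⟩
  · rw [latticePoints_eq_image]
    exact hfin.image _
  · rw [latticePoints_eq_image, finsum_mem_image (latticePoint_injective n m).injOn,
      finsum_mem_eq_finite_toFinset_sum _ hfin, h2, Nat.cast_sum]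
    exact Finset.sum_congr rfl fun w _ => (weight_latticePoint n m w).symm

/-! ### Decomposition of the sum over weights into cones -/

/-- The contribution of a weight, as a real number. -/
noncomputable def contrib (n m : ℕ) (w : ℤ × ℤ) : ℝ := (dimOff n m w : ℝ) - dimOn n m w

/-- The symmetry of the weights exchanging the two ends of the chain of divisors. -/
def flip (n : ℕ) (w : ℤ × ℤ) : ℤ × ℤ := (w.1 - (n + 1) * w.2, -w.2)

theorem flip_flip (n : ℕ) (w : ℤ × ℤ) : flip n (flip n w) = w := by
  simp only [flip]
  ext <;> simp

theorem mult_flip {n r : ℕ} (hr : r ≤ n + 1) (w : ℤ × ℤ) :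
    mult (flip n w) r = mult w (n + 1 - r) := by
  simp only [mult, flip]
  congr 1
  push_cast [Nat.cast_sub hr]
  ring

theorem contrib_flip (n m : ℕ) (w : ℤ × ℤ) : contrib n m (flip n w) = contrib n m w := by
  have h1 : dimOff n m (flip n w) = dimOff n m w := by
    simp only [dimOff]
    rw [mult_flip (by omega), mult_flip le_rfl, Nat.sub_zero, Nat.sub_self, add_comm (mult w 0)]
  have h2 : dimOn n m (flip n w) = dimOn n m w := by
    simp only [dimOn]
    rw [← Finset.sum_range_reflect]
    congr 1
    refine Finset.sum_congr rfl fun r hr => ?_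
    have hr' := Finset.mem_range.1 hr
    rw [mult_flip (by omega)]
    congr 1
    omega
  rw [contrib, contrib, h1, h2]

theorem hbar_eq_sum_contrib {n m : ℕ} {S : Finset (ℤ × ℤ)}
    (hS : ∀ w ∉ S, dimOff n m w = dimOn n m w) : (hbar n m : ℝ) = ∑ w ∈ S, contrib n m w := by
  rw [(finrank_obstruction hS).2, Nat.cast_sum]
  refine Finset.sum_congr rfl fun w _ => ?_
  rw [contrib, Nat.cast_sub]
  rw [dimOff, dimOn, Finset.sum_range_succ', Finset.sum_range_succ]
  omega

/-- `flip` exchanges d > 0 with d < 0 and fixes the line d = 0, whence the factor 2. For d > 0 the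
weights are split at g = 0; g < nd and the cut-offs at m + 1 lose nothing, by `bounds_of_dimOff_ne`.
-/
theorem hbar_eq_sums (n m : ℕ) : (hbar n m : ℝ) =
    ∑ i ∈ Finset.range (m + 1), contrib n m (-(i + 1 : ℤ), 0) +
      2 * (∑ i ∈ Finset.range (m + 1), ∑ j ∈ Finset.range (m + 1),
          contrib n m (-(i + 1 : ℤ), (j : ℤ) + 1) +
        ∑ d ∈ Finset.range (m + 1), ∑ g ∈ Finset.range (n * (d + 1)),
          contrib n m ((g : ℤ), (d : ℤ) + 1)) := by
  classical
  set S₀ := (Finset.range (m + 1)).image fun i : ℕ => (-(i + 1 : ℤ), (0 : ℤ)) with hS₀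
  set S₁ := (Finset.range (m + 1) ×ˢ Finset.range (m + 1)).image
    fun p : ℕ × ℕ => (-(p.1 + 1 : ℤ), (p.2 : ℤ) + 1) with hS₁
  set S₂ := ((Finset.range (m + 1)).sigma fun d => Finset.range (n * (d + 1))).image
    fun p : (_ : ℕ) × ℕ => ((p.2 : ℤ), (p.1 : ℤ) + 1) with hS₂
  have m₀ : ∀ w : ℤ × ℤ, w.2 = 0 → w.1 < 0 → -w.1 ≤ m + 1 → w ∈ S₀ := by
    rintro ⟨g, d⟩ h1 h2 h3
    simp only at h1 h2 h3
    refine Finset.mem_image.2 ⟨(-g - 1).toNat, Finset.mem_range.2 (by omega), ?_⟩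
    ext
    · simp only
      omega
    · exact h1.symm
  have m₁ : ∀ w : ℤ × ℤ, 0 < w.2 → w.1 < 0 → -w.1 ≤ m + 1 → w.2 ≤ m + 1 → w ∈ S₁ := by
    rintro ⟨g, d⟩ h1 h2 h3 h4
    simp only at h1 h2 h3 h4
    refine Finset.mem_image.2 ⟨((-g - 1).toNat, (d - 1).toNat), Finset.mem_product.2
      ⟨Finset.mem_range.2 (by dsimp only; omega), Finset.mem_range.2 (by dsimp only; omega)⟩, ?_⟩
    ext <;> simp only <;> omega
  have m₂ : ∀ w : ℤ × ℤ, 0 < w.2 → 0 ≤ w.1 → w.1 < n * w.2 → w.2 ≤ m + 1 → w ∈ S₂ := by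
    rintro ⟨g, d⟩ h1 h2 h3 h4
    simp only at h1 h2 h3 h4
    obtain ⟨e, he⟩ := Int.eq_ofNat_of_zero_le (show 0 ≤ d - 1 by omega)
    obtain rfl : d = e + 1 := by omega
    lift g to ℕ using h2
    refine Finset.mem_image.2 ⟨⟨e, g⟩, Finset.mem_sigma.2
      ⟨Finset.mem_range.2 (by dsimp only; omega), Finset.mem_range.2 ?_⟩, rfl⟩
    exact_mod_cast h3
  have p₀ : ∀ w ∈ S₀, w.2 = 0 := by
    intro w hw
    obtain ⟨i, -, rfl⟩ := Finset.mem_image.1 hw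
    rfl
  have p₁ : ∀ w ∈ S₁, 0 < w.2 ∧ w.1 < 0 := by
    intro w hw
    obtain ⟨i, -, rfl⟩ := Finset.mem_image.1 hw
    exact ⟨by dsimp only; omega, by dsimp only; omega⟩
  have p₂ : ∀ w ∈ S₂, 0 < w.2 ∧ 0 ≤ w.1 := by
    intro w hw
    obtain ⟨i, -, rfl⟩ := Finset.mem_image.1 hw
    exact ⟨by dsimp only; omega, by dsimp only; omega⟩
  have hpos : ∀ w, dimOff n m w ≠ dimOn n m w → 0 < w.2 → w ∈ S₁ ∪ S₂ := by
    intro w hw hd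
    obtain ⟨⟨r, hr1, hrn, hr⟩, h1, h2, h3⟩ := bounds_of_dimOff_ne hw
    have hrn' : (r : ℤ) ≤ n := by exact_mod_cast hrn
    have hn : w.1 < n * w.2 := hr.trans_le (mul_le_mul_of_nonneg_right hrn' hd.le)
    have hd' : w.2 ≤ m + 1 := by linarith
    rcases lt_or_ge w.1 0 with hg | hg
    · exact Finset.mem_union_left _ (m₁ w hd hg (by linarith) hd')
    · exact Finset.mem_union_right _ (m₂ w hd hg hn hd')
  have hflip : Function.Injective (flip n) := Function.LeftInverse.injective (flip_flip n)
  have hS : ∀ w ∉ S₀ ∪ ((S₁ ∪ S₂) ∪ (S₁ ∪ S₂).image (flip n)), dimOff n m w = dimOn n m w := by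
    intro w hw
    by_contra hne
    refine hw ?_
    obtain ⟨⟨r, hr1, hrn, hr⟩, h1, h2, h3⟩ := bounds_of_dimOff_ne hne
    rcases lt_trichotomy w.2 0 with hd | hd | hd
    · refine Finset.mem_union_right _ (Finset.mem_union_right _ (Finset.mem_image.2
        ⟨flip n w, hpos _ (fun h0 => hne ?_) (by simp only [flip]; omega), flip_flip n w⟩))
      have := contrib_flip n m w
      rw [contrib, contrib, h0, sub_self, eq_comm, sub_eq_zero] at this
      exact_mod_cast this
    · refine Finset.mem_union_left _ (m₀ w hd ?_ (by linarith))
      rwa [hd, mul_zero] at hr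
    · exact Finset.mem_union_right _ (Finset.mem_union_left _ (hpos w hne hd))
  rw [hbar_eq_sum_contrib hS, Finset.sum_union, Finset.sum_union, Finset.sum_image hflip.injOn,
    Finset.sum_congr rfl fun w _ => contrib_flip n m w, ← two_mul, Finset.sum_union]
  · congr 1
    · rw [hS₀, Finset.sum_image]
      intro a _ b _ hab
      simpa using hab
    · congr 2
      · rw [hS₁, Finset.sum_image, Finset.sum_product]
        rintro ⟨a, a'⟩ _ ⟨b, b'⟩ _ hab
        simpa using hab
      · rw [hS₂, Finset.sum_image, Finset.sum_sigma]
        rintro ⟨a, a'⟩ _ ⟨b, b'⟩ _ hab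
        simp only [Prod.mk.injEq, Nat.cast_inj, add_left_inj] at hab
        obtain ⟨rfl, rfl⟩ := hab
        rfl
  · rw [Finset.disjoint_left]
    intro w h1 h2
    exact absurd (p₁ w h1).2 (not_lt.2 (p₂ w h2).2)
  · rw [Finset.disjoint_left]
    intro w h1 h2
    obtain ⟨w', h3, rfl⟩ := Finset.mem_image.1 h2
    have a1 : 0 < (flip n w').2 := (Finset.mem_union.1 h1).elim (fun h => (p₁ _ h).1)
      fun h => (p₂ _ h).1
    have a2 : 0 < w'.2 := (Finset.mem_union.1 h3).elim (fun h => (p₁ _ h).1) fun h => (p₂ _ h).1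
    simp only [flip] at a1
    omega
  · rw [Finset.disjoint_left]
    intro w h1 h2
    have a0 := p₀ w h1
    rcases Finset.mem_union.1 h2 with h2 | h2
    · have a1 : 0 < w.2 := (Finset.mem_union.1 h2).elim (fun h => (p₁ _ h).1)
        fun h => (p₂ _ h).1
      omega
    · obtain ⟨w', h3, rfl⟩ := Finset.mem_image.1 h2
      have a2 : 0 < w'.2 := (Finset.mem_union.1 h3).elim (fun h => (p₁ _ h).1) fun h => (p₂ _ h).1
      simp only [flip] at a0
      omega

end AnSing

/-! ### Asymptotics of sums over cones -/

namespace AnSing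

/-- The sum of the truncated linear function `K - A * i` over `i ≥ 1`. -/
noncomputable def raySum (A : ℝ) (K : ℕ) : ℝ :=
  ∑ i ∈ Finset.range K, max 0 ((K : ℝ) - A * (i + 1))

/-- The sum of the truncated linear function `K - A * i - B * j` over `i ≥ 0`, `j ≥ 1`. -/
noncomputable def coneSum (A B : ℝ) (K : ℕ) : ℝ :=
  ∑ i ∈ Finset.range K, ∑ j ∈ Finset.range K, max 0 ((K : ℝ) - A * i - B * (j + 1))

/-- Removing the first term replaces L by L - A, and L²/(2A) - L/2 obeys the same recursion exactly.
The error is therefore that of some L in [0, A], where the sum is zero. A ≥ 1 keeps L - A within the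
shortened range. -/
theorem abs_sum_sub_le {A : ℝ} (hA : 1 ≤ A) (K : ℕ) {L : ℝ} (hL0 : 0 ≤ L) (hLK : L ≤ K) :
    |∑ i ∈ Finset.range K, max 0 (L - A * (i + 1)) - (L ^ 2 / (2 * A) - L / 2)| ≤ A := by
  have hA0 : 0 < A := by linarith
  have base : L ≤ A → |(0 : ℝ) - (L ^ 2 / (2 * A) - L / 2)| ≤ A := by
    intro h
    have e : (0 : ℝ) - (L ^ 2 / (2 * A) - L / 2) = L * (A - L) / (2 * A) := by
      field_simp
      ring
    rw [e, abs_of_nonneg (div_nonneg (mul_nonneg hL0 (by linarith)) (by positivity)),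
      div_le_iff₀ (by positivity)]
    nlinarith
  induction K generalizing L with
  | zero =>
    have : L = 0 := le_antisymm (by simpa using hLK) hL0
    subst this
    simpa using base hA0.le
  | succ K ih =>
    rcases le_total L A with h | h
    · rw [Finset.sum_eq_zero]
      · exact base h
      · intro i _
        refine max_eq_left ?_
        have : (0 : ℝ) ≤ i := Nat.cast_nonneg i
        nlinarith
    · push_cast at hLK
      have := ih (L := L - A) (by linarith) (by linarith) (by
        intro h'
        have e : (0 : ℝ) - ((L - A) ^ 2 / (2 * A) - (L - A) / 2) =
            (L - A) * (A - (L - A)) / (2 * A) := by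
          field_simp
          ring
        rw [e, abs_of_nonneg (div_nonneg (mul_nonneg (by linarith) (by linarith))
          (by positivity)), div_le_iff₀ (by positivity)]
        nlinarith)
      rw [Finset.sum_range_succ']
      convert this using 2
      have e1 : max 0 (L - A * (((0 : ℕ) : ℝ) + 1)) = L - A := by
        rw [max_eq_right] <;> simp [h]
      have e2 : ∀ i : ℕ, L - A * (((i + 1 : ℕ) : ℝ) + 1) = L - A - A * (i + 1) := fun i => by
        push_cast
        ring
      rw [e1]
      simp only [e2]
      field_simp
      ring

/-- The same peeling argument: the cubic changes by exactly (L - B)² when L drops to L - B. -/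
theorem abs_sum_sq_sub_le {B : ℝ} (hB : 1 ≤ B) (K : ℕ) {L : ℝ} (hL0 : 0 ≤ L) (hLK : L ≤ K) :
    |∑ j ∈ Finset.range K, max 0 (L - B * (j + 1)) ^ 2 -
      (L ^ 3 / (3 * B) - L ^ 2 / 2 + B * L / 6)| ≤ B ^ 2 := by
  have hB0 : 0 < B := by linarith
  have base : ∀ L : ℝ, 0 ≤ L → L ≤ B →
      |(0 : ℝ) - (L ^ 3 / (3 * B) - L ^ 2 / 2 + B * L / 6)| ≤ B ^ 2 := by
    intro L hL0 h
    have e : (0 : ℝ) - (L ^ 3 / (3 * B) - L ^ 2 / 2 + B * L / 6) =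
        -(L * (B - L) * (B - 2 * L)) / (6 * B) := by
      field_simp
      ring
    rw [e, abs_div, abs_neg, abs_mul, abs_mul, abs_of_nonneg hL0,
      abs_of_nonneg (show (0 : ℝ) ≤ B - L by linarith), abs_of_pos (show (0 : ℝ) < 6 * B by
        positivity), div_le_iff₀ (by positivity)]
    have h1 : |B - 2 * L| ≤ B := abs_le.2 ⟨by linarith, by linarith⟩
    calc L * (B - L) * |B - 2 * L| ≤ B * B * B := by
          gcongr
          linarith
      _ ≤ B ^ 2 * (6 * B) := by nlinarith [pow_pos hB0 3]
  induction K generalizing L with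
  | zero =>
    have : L = 0 := le_antisymm (by simpa using hLK) hL0
    subst this
    simpa using base 0 le_rfl hB0.le
  | succ K ih =>
    rcases le_total L B with h | h
    · rw [Finset.sum_eq_zero]
      · exact base L hL0 h
      · intro i _
        rw [max_eq_left]
        · simp
        · have : (0 : ℝ) ≤ i := Nat.cast_nonneg i
          nlinarith
    · push_cast at hLK
      have := ih (L := L - B) (by linarith) (by linarith)
      rw [Finset.sum_range_succ']
      convert this using 2
      have e1 : max 0 (L - B * (((0 : ℕ) : ℝ) + 1)) = L - B := by
        rw [max_eq_right] <;> simp [h]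
      have e2 : ∀ i : ℕ, L - B * (((i + 1 : ℕ) : ℝ) + 1) = L - B - B * (i + 1) := fun i => by
        push_cast
        ring
      rw [e1]
      simp only [e2]
      field_simp
      ring

theorem raySum_isBigO {A : ℝ} (hA : 1 ≤ A) :
    (fun K : ℕ => raySum A K - (K : ℝ) ^ 2 / (2 * A)) =O[atTop] fun K : ℕ => (K : ℝ) := by
  refine Asymptotics.IsBigO.of_bound (A + 1) ?_
  filter_upwards [eventually_ge_atTop 1] with K hK
  have hK' : (1 : ℝ) ≤ K := by exact_mod_cast hK
  have h := abs_sum_sub_le hA K (Nat.cast_nonneg K) le_rfl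
  rw [Real.norm_eq_abs, Real.norm_eq_abs, abs_of_nonneg (by linarith : (0 : ℝ) ≤ K)]
  have e : raySum A K - (K : ℝ) ^ 2 / (2 * A) =
      (∑ i ∈ Finset.range K, max 0 ((K : ℝ) - A * (i + 1)) - ((K : ℝ) ^ 2 / (2 * A) - K / 2)) -
        K / 2 := by
    rw [raySum]
    ring
  rw [e]
  refine (abs_sub _ _).trans ?_
  rw [abs_of_nonneg (by positivity : (0 : ℝ) ≤ (K : ℝ) / 2)]
  nlinarith

theorem abs_inner_sum_sub_le {A : ℝ} (hA : 1 ≤ A) (K : ℕ) {L : ℝ} (hLK : L ≤ K) :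
    |∑ i ∈ Finset.range (K + 1), max 0 (L - A * i) - (max 0 L ^ 2 / (2 * A) + max 0 L / 2)| ≤
      A := by
  have hL : max 0 L ≤ K := max_le (Nat.cast_nonneg K) hLK
  have h := abs_sum_sub_le hA K (le_max_left 0 L) hL
  have e : ∀ i : ℕ, max 0 (L - A * i) = max 0 (max 0 L - A * i) := by
    intro i
    rcases le_total L 0 with h0 | h0
    · have : (0 : ℝ) ≤ A * i := by positivity
      rw [max_eq_left h0, max_eq_left, max_eq_left] <;> linarith
    · rw [max_eq_right h0]
  rw [Finset.sum_congr rfl fun i _ => e i, Finset.sum_range_succ']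
  convert h using 2
  have e1 : max 0 (max 0 L - A * ((0 : ℕ) : ℝ)) = max 0 L := by simp
  rw [e1]
  push_cast
  ring

/-- Summing over i leaves (x²/(2A) + x/2) with x the truncated remainder, up to an error A for each
of the K values of j. The square and linear sums over j supply the cubic term and the two quadratic
terms. -/
theorem coneSum_isBigO {A B : ℝ} (hA : 1 ≤ A) (hB : 1 ≤ B) :
    (fun K : ℕ => coneSum A B K - ((K : ℝ) ^ 3 / (6 * A * B) +
      (K : ℝ) ^ 2 * (1 / (4 * B) - 1 / (4 * A)))) =O[atTop] fun K : ℕ => (K : ℝ) := by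
  have hA0 : 0 < A := by linarith
  have hB0 : 0 < B := by linarith
  set E : ℕ → ℝ := fun K => coneSum A B K - ∑ j ∈ Finset.range K,
    (max 0 ((K : ℝ) - B * (j + 1)) ^ 2 / (2 * A) + max 0 ((K : ℝ) - B * (j + 1)) / 2) with hE
  set E₂ : ℕ → ℝ := fun K => ∑ j ∈ Finset.range K, max 0 ((K : ℝ) - B * (j + 1)) ^ 2 -
    ((K : ℝ) ^ 3 / (3 * B) - (K : ℝ) ^ 2 / 2) with hE₂
  have b1 : E =O[atTop] fun K : ℕ => (K : ℝ) := by
    refine Asymptotics.IsBigO.of_bound A ?_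
    filter_upwards [eventually_ge_atTop 1] with K hK
    obtain ⟨k, rfl⟩ := Nat.exists_eq_add_of_le' hK
    rw [Real.norm_eq_abs, Real.norm_eq_abs, Nat.abs_cast]
    simp only [hE, coneSum]
    rw [Finset.sum_comm, ← Finset.sum_sub_distrib]
    refine (Finset.abs_sum_le_sum_abs _ _).trans ?_
    have hj : ∀ j ∈ Finset.range (k + 1),
        |∑ i ∈ Finset.range (k + 1), max 0 (((k + 1 : ℕ) : ℝ) - A * i - B * (j + 1)) -
          (max 0 (((k + 1 : ℕ) : ℝ) - B * (j + 1)) ^ 2 / (2 * A) +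
            max 0 (((k + 1 : ℕ) : ℝ) - B * (j + 1)) / 2)| ≤ A := by
      intro j _
      have hj0 : (0 : ℝ) ≤ j := Nat.cast_nonneg j
      have := abs_inner_sum_sub_le hA k (L := ((k + 1 : ℕ) : ℝ) - B * (j + 1)) (by
        push_cast
        nlinarith)
      convert this using 5
      ring
    refine (Finset.sum_le_sum hj).trans (le_of_eq ?_)
    rw [Finset.sum_const, Finset.card_range, nsmul_eq_mul, mul_comm]
  have b2 : E₂ =O[atTop] fun K : ℕ => (K : ℝ) := by
    refine Asymptotics.IsBigO.of_bound (B ^ 2 + B) ?_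
    filter_upwards [eventually_ge_atTop 1] with K hK
    have hK' : (1 : ℝ) ≤ K := by exact_mod_cast hK
    have h := abs_sum_sq_sub_le hB K (Nat.cast_nonneg K) le_rfl
    rw [Real.norm_eq_abs, Real.norm_eq_abs, Nat.abs_cast]
    have e : E₂ K = (∑ j ∈ Finset.range K, max 0 ((K : ℝ) - B * (j + 1)) ^ 2 -
        ((K : ℝ) ^ 3 / (3 * B) - (K : ℝ) ^ 2 / 2 + B * K / 6)) + B * K / 6 := by
      simp only [hE₂]
      ring
    rw [e]
    refine (abs_add_le _ _).trans ?_
    rw [abs_of_nonneg (by positivity : (0 : ℝ) ≤ B * (K : ℝ) / 6)]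
    nlinarith [mul_pos hB0 hB0, mul_pos hB0 (by linarith : (0 : ℝ) < K)]
  have b3 := raySum_isBigO hB
  have := (b1.add (b2.const_mul_left (1 / (2 * A)))).add (b3.const_mul_left (1 / 2))
  refine this.congr_left fun K => ?_
  simp only [hE, hE₂, raySum, Finset.sum_add_distrib, ← Finset.sum_div]
  field_simp
  ring

/-! ### The contributions of the cones -/

theorem contrib_eq (n m : ℕ) (w : ℤ × ℤ) : contrib n m w =
    max 0 (((m + 1 : ℕ) : ℝ) - ((mult w 0 : ℝ) + mult w (n + 1))) -
      max 0 (((m + 1 : ℕ) : ℝ) - ∑ r ∈ Finset.range (n + 2), (mult w r : ℝ)) := by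
  rw [contrib, dimOff, dimOn, natCast_tsub_eq_max, natCast_tsub_eq_max, Nat.cast_add (mult w 0),
    Nat.cast_sum]

theorem sum_range_cast (n : ℕ) : ∑ r ∈ Finset.range n, (r : ℝ) = n * (n - 1) / 2 := by
  induction n with
  | zero => simp
  | succ n ih =>
    rw [Finset.sum_range_succ, ih]
    push_cast
    ring

/-- For g < 0 ≤ d no multiplicity is truncated, so all of them are linear in (i, j). -/
theorem contrib_left (n m i j : ℕ) : contrib n m (-(i + 1 : ℤ), (j : ℤ)) =
    max 0 (((m + 1 : ℕ) : ℝ) - 2 * (i + 1) - (n + 1) * j) -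
      max 0 (((m + 1 : ℕ) : ℝ) - (n + 2) * (i + 1) - (n + 1) * (n + 2) / 2 * j) := by
  have hm : ∀ r : ℕ, (mult (-(i + 1 : ℤ), (j : ℤ)) r : ℝ) = r * j + (i + 1) := by
    intro r
    rw [cast_mult, max_eq_right]
    · push_cast
      ring
    · push_cast
      have : (0 : ℝ) ≤ r * j := by positivity
      have : (0 : ℝ) ≤ i := Nat.cast_nonneg i
      linarith
  rw [contrib_eq]
  simp only [hm, Finset.sum_add_distrib, ← Finset.sum_mul, sum_range_cast, Finset.sum_const,
    Finset.card_range, nsmul_eq_mul]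
  push_cast
  congr 2 <;> ring

/-- Here d = i + j + 1 and g = kd + i, so kd ≤ g < (k + 1)d. Multiplicities vanish for r ≤ k and are
linear for the t + 2 indices k < r ≤ n + 1, where n = k + t + 1. -/
theorem contrib_cone (k t m i j : ℕ) :
    contrib (k + t + 1) m ((k * (i + j + 1) + i : ℕ), ((i + j : ℕ) : ℤ) + 1) =
      max 0 (((m + 1 : ℕ) : ℝ) - (t + 1) * i - (t + 2) * (j + 1)) -
        max 0 (((m + 1 : ℕ) : ℝ) - (t + 1) * (t + 2) / 2 * i -
          (t + 2) * (t + 3) / 2 * (j + 1)) := by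
  set w : ℤ × ℤ := ((k * (i + j + 1) + i : ℕ), ((i + j : ℕ) : ℤ) + 1) with hw
  have hi : (0 : ℝ) ≤ i := Nat.cast_nonneg i
  have hj : (0 : ℝ) ≤ j := Nat.cast_nonneg j
  have hlow : ∀ r : ℕ, r ≤ k → (mult w r : ℝ) = 0 := by
    intro r hr
    have hr' : (r : ℝ) ≤ k := by exact_mod_cast hr
    rw [cast_mult, max_eq_left]
    simp only [hw]
    push_cast
    nlinarith
  have hhigh : ∀ s : ℕ, (mult w (k + 1 + s) : ℝ) = (s + 1) * (i + j + 1) - i := by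
    intro s
    have hs : (0 : ℝ) ≤ s := Nat.cast_nonneg s
    rw [cast_mult, max_eq_right]
    · simp only [hw]
      push_cast
      ring
    · simp only [hw]
      push_cast
      nlinarith
  have hsum : ∑ r ∈ Finset.range (k + t + 1 + 2), (mult w r : ℝ) =
      (t + 2) * (t + 3) / 2 * (i + j + 1) - (t + 2) * i := by
    rw [show k + t + 1 + 2 = (k + 1) + (t + 2) by ring, Finset.sum_range_add,
      Finset.sum_eq_zero fun r hr => hlow r (Nat.lt_succ_iff.1 (Finset.mem_range.1 hr)), zero_add,
      Finset.sum_congr rfl fun s _ => hhigh s, Finset.sum_sub_distrib, ← Finset.sum_mul,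
      Finset.sum_add_distrib, sum_range_cast]
    simp only [Finset.sum_const, Finset.card_range, nsmul_eq_mul]
    push_cast
    ring
  have hlast : (mult w (k + t + 1 + 1) : ℝ) = (t + 1 + 1) * (i + j + 1) - i := by
    have := hhigh (t + 1)
    push_cast at this
    rw [show k + t + 1 + 1 = k + 1 + (t + 1) by ring]
    exact this
  rw [contrib_eq, hsum, hlow 0 (Nat.zero_le k), hlast]
  congr 2 <;> ring

/-- `coneSum` includes the row i = 0, which is a `raySum`; the row i = K gained by the shift is
zero. -/
theorem sum_quadrant {A B : ℝ} (hA : 1 ≤ A) (hB : 1 ≤ B) (K : ℕ) :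
    ∑ i ∈ Finset.range K, ∑ j ∈ Finset.range K,
      max 0 ((K : ℝ) - A * (i + 1) - B * (j + 1)) = coneSum A B K - raySum B K := by
  set f : ℕ → ℝ := fun i => ∑ j ∈ Finset.range K, max 0 ((K : ℝ) - A * i - B * (j + 1)) with hf
  have h1 := Finset.sum_range_succ f K
  rw [Finset.sum_range_succ'] at h1
  have hK : f K = 0 := by
    refine Finset.sum_eq_zero fun j _ => max_eq_left ?_
    have hj : (0 : ℝ) ≤ j := Nat.cast_nonneg j
    have hK : (0 : ℝ) ≤ K := Nat.cast_nonneg K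
    nlinarith
  have h0 : f 0 = raySum B K := by
    simp only [hf, raySum]
    refine Finset.sum_congr rfl fun j _ => ?_
    push_cast
    ring_nf
  rw [hK, h0] at h1
  have h2 : ∑ i ∈ Finset.range K, ∑ j ∈ Finset.range K,
      max 0 ((K : ℝ) - A * (i + 1) - B * (j + 1)) = ∑ i ∈ Finset.range K, f (i + 1) := by
    simp only [hf]
    push_cast
    rfl
  rw [h2, coneSum]
  change _ = ∑ i ∈ Finset.range K, f i - _
  linarith

theorem sum_range_mul_eq (f : ℕ → ℝ) (n e : ℕ) :
    ∑ g ∈ Finset.range (n * e), f g =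
      ∑ k ∈ Finset.range n, ∑ i ∈ Finset.range e, f (k * e + i) := by
  induction n with
  | zero => simp
  | succ n ih => rw [Finset.sum_range_succ, ← ih, add_mul, one_mul, Finset.sum_range_add]

theorem sum_triangle_eq {F : ℕ → ℕ → ℝ} {K : ℕ} (hF : ∀ i j, K ≤ i + j → F i j = 0) :
    ∑ d ∈ Finset.range K, ∑ i ∈ Finset.range (d + 1), F i (d - i) =
      ∑ i ∈ Finset.range K, ∑ j ∈ Finset.range K, F i j := by
  rw [Finset.sum_range_diag_flip]
  refine Finset.sum_congr rfl fun i _ => ?_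
  refine Finset.sum_subset (Finset.range_mono (Nat.sub_le _ _)) fun j _ hj => hF i j ?_
  rw [Finset.mem_range] at hj
  omega

theorem max_cone_eq_zero {A B : ℝ} (hA : 1 ≤ A) (hB : 1 ≤ B) {K i j : ℕ} (h : K ≤ i + j) :
    max 0 ((K : ℝ) - A * i - B * (j + 1)) = 0 := by
  refine max_eq_left ?_
  have hi : (0 : ℝ) ≤ i := Nat.cast_nonneg i
  have hj : (0 : ℝ) ≤ j := Nat.cast_nonneg j
  have h' : (K : ℝ) ≤ i + j := by exact_mod_cast h
  nlinarith

theorem hbar_eq_coneSums (n m : ℕ) : (hbar n m : ℝ) =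
    raySum 2 (m + 1) - raySum (n + 2) (m + 1) +
      2 * ((coneSum 2 (n + 1) (m + 1) - raySum (n + 1) (m + 1)) -
          (coneSum (n + 2) ((n + 1) * (n + 2) / 2) (m + 1) -
            raySum ((n + 1) * (n + 2) / 2) (m + 1)) +
        ∑ t ∈ Finset.range n, (coneSum (t + 1) (t + 2) (m + 1) -
          coneSum ((t + 1) * (t + 2) / 2) ((t + 2) * (t + 3) / 2) (m + 1))) := by
  have hn0 : (0 : ℝ) ≤ n := Nat.cast_nonneg n
  rw [hbar_eq_sums]
  congr 1
  · rw [raySum, raySum, ← Finset.sum_sub_distrib]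
    refine Finset.sum_congr rfl fun i _ => ?_
    have := contrib_left n m i 0
    simpa using this
  congr 2
  · rw [← sum_quadrant (by norm_num) (by linarith), ← sum_quadrant (by linarith) (by nlinarith),
      ← Finset.sum_sub_distrib]
    refine Finset.sum_congr rfl fun i _ => ?_
    rw [← Finset.sum_sub_distrib]
    refine Finset.sum_congr rfl fun j _ => ?_
    have := contrib_left n m i (j + 1)
    push_cast at this ⊢
    exact this
  · have h1 : ∀ d ∈ Finset.range (m + 1), ∑ g ∈ Finset.range (n * (d + 1)),
        contrib n m ((g : ℤ), (d : ℤ) + 1) = ∑ k ∈ Finset.range n, ∑ i ∈ Finset.range (d + 1),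
          contrib n m ((k * (i + (d - i) + 1) + i : ℕ), ((i + (d - i) : ℕ) : ℤ) + 1) := by
      intro d _
      rw [sum_range_mul_eq (fun g => contrib n m ((g : ℤ), (d : ℤ) + 1))]
      refine Finset.sum_congr rfl fun k _ => Finset.sum_congr rfl fun i hi => ?_
      rw [Nat.add_sub_cancel' (Nat.lt_succ_iff.1 (Finset.mem_range.1 hi))]
    -- Division with remainder g = k(d + 1) + i separates the cones; reflecting k = n - 1 - t makes
    -- their contributions independent of n.
    rw [Finset.sum_congr rfl h1, Finset.sum_comm, ← Finset.sum_range_reflect]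
    refine Finset.sum_congr rfl fun t ht => ?_
    obtain ⟨k, rfl⟩ : ∃ k, n = k + t + 1 := ⟨n - 1 - t, by
      have := Finset.mem_range.1 ht
      omega⟩
    rw [show k + t + 1 - 1 - t = k by omega]
    have ht0 : (0 : ℝ) ≤ t := Nat.cast_nonneg t
    have c1 : (1 : ℝ) ≤ t + 1 := by linarith
    have c2 : (1 : ℝ) ≤ t + 2 := by linarith
    have c3 : (1 : ℝ) ≤ (t + 1) * (t + 2) / 2 := by nlinarith
    have c4 : (1 : ℝ) ≤ (t + 2) * (t + 3) / 2 := by nlinarith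
    rw [sum_triangle_eq (F := fun i j => contrib (k + t + 1) m
      ((k * (i + j + 1) + i : ℕ), ((i + j : ℕ) : ℤ) + 1))]
    · rw [coneSum, coneSum, ← Finset.sum_sub_distrib]
      refine Finset.sum_congr rfl fun i _ => ?_
      rw [← Finset.sum_sub_distrib]
      exact Finset.sum_congr rfl fun j _ => contrib_cone k t m i j
    · intro i j hij
      rw [contrib_cone, max_cone_eq_zero c1 c2 hij, max_cone_eq_zero c3 c4 hij, sub_zero]

/-! ### The leading coefficient -/

/-- The right side collects the coefficients 1/(6AB). With x = t + 2, the identity 1/((x² - 1)x²) =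
1/(x² - 1) - 1/x² is the source of the sum of 1/j²; everything else telescopes. Induction on n only
needs the increments. -/
theorem hbarOmega_eq (n : ℕ) : hbarOmega n =
    2 * (1 / (6 * 2 * ((n : ℝ) + 1)) - 1 / (6 * ((n : ℝ) + 2) * ((n + 1) * (n + 2) / 2)) +
      ∑ t ∈ Finset.range n, (1 / (6 * ((t : ℝ) + 1) * (t + 2)) -
        1 / (6 * (((t : ℝ) + 1) * (t + 2) / 2) * ((t + 2) * (t + 3) / 2)))) := by
  induction n with
  | zero => norm_num [hbarOmega]
  | succ n ih =>
    have hstep : hbarOmega (n + 1) = hbarOmega n + 4 / 3 * (1 / ((n : ℝ) + 1) ^ 2) +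
        (12 * (n : ℝ) ^ 4 + 65 * (n : ℝ) ^ 3 + 117 * (n : ℝ) ^ 2 + 72 * (n : ℝ)) /
          (6 * ((n : ℝ) + 1) ^ 2 * ((n : ℝ) + 2) ^ 2) -
        (12 * ((n : ℝ) + 1) ^ 4 + 65 * ((n : ℝ) + 1) ^ 3 + 117 * ((n : ℝ) + 1) ^ 2 +
          72 * ((n : ℝ) + 1)) / (6 * ((n : ℝ) + 2) ^ 2 * ((n : ℝ) + 3) ^ 2) := by
      rw [hbarOmega, hbarOmega, Finset.sum_Icc_succ_top (by omega)]
      push_cast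
      ring
    rw [hstep, ih, Finset.sum_range_succ]
    set s := ∑ t ∈ Finset.range n, (1 / (6 * ((t : ℝ) + 1) * (t + 2)) -
        1 / (6 * (((t : ℝ) + 1) * (t + 2) / 2) * ((t + 2) * (t + 3) / 2)))
    push_cast
    have h1 : (n : ℝ) + 1 ≠ 0 := by positivity
    have h2 : (n : ℝ) + 2 ≠ 0 := by positivity
    have h3 : (n : ℝ) + 3 ≠ 0 := by positivity
    rw [show (n : ℝ) + 1 + 1 = n + 2 by ring, show (n : ℝ) + 1 + 2 = n + 3 by ring]
    field_simp
    ring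

/-- The parameter B of each cone is the parameter A of the next, in both families, so the quadratic
coefficients telescope. -/
theorem sum_quadratic_coeff (n : ℕ) :
    ∑ t ∈ Finset.range n, ((1 / (4 * ((t : ℝ) + 2)) - 1 / (4 * ((t : ℝ) + 1))) -
      (1 / (4 * (((t : ℝ) + 2) * (t + 3) / 2)) - 1 / (4 * (((t : ℝ) + 1) * (t + 2) / 2)))) =
      1 / (4 * ((n : ℝ) + 1)) - 1 / (2 * ((n : ℝ) + 1) * (n + 2)) := by
  induction n with
  | zero => norm_num
  | succ n ih =>
    rw [Finset.sum_range_succ, ih]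
    push_cast
    have h1 : (n : ℝ) + 1 ≠ 0 := by positivity
    have h2 : (n : ℝ) + 2 ≠ 0 := by positivity
    have h3 : (n : ℝ) + 3 ≠ 0 := by positivity
    rw [show (n : ℝ) + 1 + 1 = n + 2 by ring, show (n : ℝ) + 1 + 2 = n + 3 by ring]
    field_simp
    ring

/-- The telescoped quadratic terms cancel against those of the rays and of the quadrant, leaving a
pure cube of m + 1. -/
theorem hbar_isBigO (n : ℕ) :
    (fun m : ℕ => (hbar n m : ℝ) - hbarOmega n * ((m : ℝ) + 1) ^ 3) =O[atTop]
      fun m : ℕ => (m : ℝ) := by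
  have hn0 : (0 : ℝ) ≤ n := Nat.cast_nonneg n
  have a1 : (1 : ℝ) ≤ n + 1 := by linarith
  have a2 : (1 : ℝ) ≤ n + 2 := by linarith
  have a3 : (1 : ℝ) ≤ ((n : ℝ) + 1) * (n + 2) / 2 := by nlinarith
  have hsum := Asymptotics.IsBigO.fun_sum (s := Finset.range n) (l := atTop)
    (g := fun K : ℕ => (K : ℝ)) fun t _ =>
      (coneSum_isBigO (A := (t : ℝ) + 1) (B := t + 2) (by simp) (by
        have : (0 : ℝ) ≤ t := Nat.cast_nonneg t
        linarith)).sub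
      (coneSum_isBigO (A := ((t : ℝ) + 1) * (t + 2) / 2) (B := (t + 2) * (t + 3) / 2) (by
        have : (0 : ℝ) ≤ t := Nat.cast_nonneg t
        nlinarith) (by
        have : (0 : ℝ) ≤ t := Nat.cast_nonneg t
        nlinarith))
  have hmain := ((raySum_isBigO (A := 2) (by norm_num)).sub (raySum_isBigO a2)).add
    (((((coneSum_isBigO (A := 2) (by norm_num) a1).sub (raySum_isBigO a1)).sub
      ((coneSum_isBigO a2 a3).sub (raySum_isBigO a3))).add hsum).const_mul_left 2)
  have hshift := hmain.comp_tendsto (tendsto_add_atTop_nat 1)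
  have hlin : (fun m : ℕ => ((m + 1 : ℕ) : ℝ)) =O[atTop] fun m : ℕ => (m : ℝ) := by
    refine Asymptotics.IsBigO.of_bound 2 ?_
    filter_upwards [eventually_ge_atTop 1] with m hm
    have hm' : (1 : ℝ) ≤ m := by exact_mod_cast hm
    rw [Real.norm_eq_abs, Real.norm_eq_abs, Nat.abs_cast, Nat.abs_cast]
    push_cast
    linarith
  refine (hshift.trans hlin).congr_left fun m => ?_
  simp only [Function.comp]
  rw [hbar_eq_coneSums, hbarOmega_eq]
  have hq := sum_quadratic_coeff n
  set M : ℝ := ((m + 1 : ℕ) : ℝ) with hM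
  rw [show (m : ℝ) + 1 = M by rw [hM]; push_cast; ring]
  have hs : ∑ t ∈ Finset.range n, (coneSum (t + 1) (t + 2) (m + 1) -
        (M ^ 3 / (6 * ((t : ℝ) + 1) * (t + 2)) +
          M ^ 2 * (1 / (4 * ((t : ℝ) + 2)) - 1 / (4 * ((t : ℝ) + 1)))) -
      (coneSum (((t : ℝ) + 1) * (t + 2) / 2) ((t + 2) * (t + 3) / 2) (m + 1) -
        (M ^ 3 / (6 * (((t : ℝ) + 1) * (t + 2) / 2) * ((t + 2) * (t + 3) / 2)) +
          M ^ 2 * (1 / (4 * (((t : ℝ) + 2) * (t + 3) / 2)) -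
            1 / (4 * (((t : ℝ) + 1) * (t + 2) / 2)))))) =
      ∑ t ∈ Finset.range n, (coneSum (t + 1) (t + 2) (m + 1) -
        coneSum ((t + 1) * (t + 2) / 2) ((t + 2) * (t + 3) / 2) (m + 1)) -
      M ^ 3 * ∑ t ∈ Finset.range n, (1 / (6 * ((t : ℝ) + 1) * (t + 2)) -
        1 / (6 * (((t : ℝ) + 1) * (t + 2) / 2) * ((t + 2) * (t + 3) / 2))) -
      M ^ 2 * ∑ t ∈ Finset.range n, ((1 / (4 * ((t : ℝ) + 2)) - 1 / (4 * ((t : ℝ) + 1))) -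
        (1 / (4 * (((t : ℝ) + 2) * (t + 3) / 2)) - 1 / (4 * (((t : ℝ) + 1) * (t + 2) / 2)))) := by
    rw [Finset.mul_sum, Finset.mul_sum, ← Finset.sum_sub_distrib, ← Finset.sum_sub_distrib]
    refine Finset.sum_congr rfl fun t _ => ?_
    ring
  rw [hs, hq]
  have h1 : (n : ℝ) + 1 ≠ 0 := by positivity
  have h2 : (n : ℝ) + 2 ≠ 0 := by positivity
  field_simp
  ring

end AnSing

namespace AnSing

/-! ### Expansion in powers of m and the limit -/

theorem hbar_asymptotics (n : ℕ) :
    (fun m : ℕ => (hbar n m : ℝ) - (hbarOmega n * (m : ℝ) ^ 3 + 3 * hbarOmega n * (m : ℝ) ^ 2))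
      =O[atTop] fun m : ℕ => (m : ℝ) := by
  have h1 : (fun m : ℕ => hbarOmega n * (3 * (m : ℝ) + 1)) =O[atTop] fun m : ℕ => (m : ℝ) := by
    refine Asymptotics.IsBigO.const_mul_left (Asymptotics.IsBigO.of_bound 4 ?_) _
    filter_upwards [eventually_ge_atTop 1] with m hm
    have hm' : (1 : ℝ) ≤ m := by exact_mod_cast hm
    rw [Real.norm_eq_abs, Real.norm_eq_abs, Nat.abs_cast,
      abs_of_nonneg (by positivity : (0 : ℝ) ≤ 3 * (m : ℝ) + 1)]
    linarith
  refine ((hbar_isBigO n).add h1).congr_left fun m => ?_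
  ring

theorem tendsto_hbar_div (n : ℕ) :
    Tendsto (fun m : ℕ => (hbar n m : ℝ) / (m : ℝ) ^ 3) atTop (𝓝 (hbarOmega n)) := by
  have hinv : Tendsto (fun m : ℕ => ((m : ℝ))⁻¹) atTop (𝓝 0) :=
    tendsto_inv_atTop_zero.comp tendsto_natCast_atTop_atTop
  have h1 := (hbar_asymptotics n).mul (Asymptotics.isBigO_refl
    (fun m : ℕ => (((m : ℝ)) ^ 3)⁻¹) atTop)
  have h2 : Tendsto (fun m : ℕ => (m : ℝ) * (((m : ℝ)) ^ 3)⁻¹) atTop (𝓝 0) := by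
    have := hinv.pow 2
    rw [zero_pow two_ne_zero] at this
    refine this.congr' ?_
    filter_upwards [eventually_ge_atTop 1] with m hm
    have hm' : (m : ℝ) ≠ 0 := by positivity
    field_simp
  have h3 := h1.trans_tendsto h2
  have h4 : Tendsto (fun m : ℕ => hbarOmega n + 3 * hbarOmega n * ((m : ℝ))⁻¹) atTop
      (𝓝 (hbarOmega n)) := by
    simpa using (hinv.const_mul (3 * hbarOmega n)).const_add (hbarOmega n)
  have h5 := h3.add h4
  rw [zero_add] at h5
  refine h5.congr' ?_
  filter_upwards [eventually_ge_atTop 1] with m hm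
  have hm' : (m : ℝ) ≠ 0 := by positivity
  field_simp
  ring

end AnSing

theorem theorem1 (n : ℕ) (hn : 1 ≤ n) :
    (∀ m : ℕ,
      Module.Finite ℂ (AnSing.Obstruction n m) ∧
      (AnSing.latticePoints n m).Finite ∧
      (AnSing.hbar n m : ℝ) =
        ∑ᶠ x ∈ AnSing.latticePoints n m, AnSing.weight n m ((x.1 : ℝ), (x.2 : ℝ))) ∧
    Filter.Tendsto (fun m : ℕ => (AnSing.hbar n m : ℝ) / (m : ℝ) ^ 3) Filter.atTop
      (nhds (AnSing.hbarOmega n)) ∧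
    Asymptotics.IsBigO Filter.atTop
      (fun m : ℕ => (AnSing.hbar n m : ℝ) -
        (AnSing.hbarOmega n * (m : ℝ) ^ 3 + 3 * AnSing.hbarOmega n * (m : ℝ) ^ 2))
      (fun m : ℕ => (m : ℝ)) := by
  exact ⟨fun m => AnSing.obstruction_lattice_sum n m, AnSing.tendsto_hbar_div n,
    AnSing.hbar_asymptotics n⟩
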